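/- Let $\mu$ be the Möbius function, $\zeta$ the Riemann zeta function and $\gamma$ Euler's constant; $p$ denotes primes. For real $s$ and an integer $q\ge 1$ put $$\varphi_s(q)=q^s\prod_{p\mid q}\Bigl(1-\frac1{p^s}\Bigr),\qquad \kappa_s(q)=q^s\prod_{p\mid q}\Bigl(1+\frac1{p^s}\Bigr),\qquad \kappa=\kappa_1,$$ $$\mathfrak b_q=\sum_p\frac{2\log p}{p^2-1}+\gamma+\sum_{p\mid q}\frac{\log p}{p+1}.$$ Let $\mathrm D_1=0.43$, $\mathrm D_2=0.120$, $\mathrm E_1^{(1)}=1.044$, $\mathrm E_1^{(2)}=0.232$ and, for $\alpha>\frac12$, $\alpha\ne1$ and $v\in\{1,2\}$, $$\mathrm E_\alpha^{(v)}=\max\Biggl\{\mathrm D_v\Bigl(1+\frac{|\alpha-1|}{\alpha-\frac12}\Bigr),\ \frac{\varphi_{1/2}(v)}{\sqrt v}\left|\frac{v^\alpha}{\kappa_\alpha(v)}\frac{\zeta(\alpha)}{\zeta(2\alpha)}-\frac{v}{\kappa(v)}\frac{6}{(\alpha-1)\pi^2}\right|,\ \frac{\varphi_{1/2}(v)}{\sqrt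 v}\frac{|\alpha-1|}{\alpha-\frac12}\left(\frac{3\,\kappa_\alpha(v)\,\zeta(2\alpha)}{(\alpha-\frac12)\,v^{\alpha-1}\kappa(v)\,\pi^2\,|\zeta(\alpha)(\alpha-1)|}\right)^{\frac{2}{\alpha-1}}\Biggr\}.$$ For $\alpha>\frac12$ put $$\mathrm C_\alpha(q)=\frac{\sqrt q}{\varphi_{1/2}(q)}\cdot\begin{cases}\mathrm E_\alpha^{(1)}&\text{if }2\nmid q,\\ \mathrm E_\alpha^{(2)}&\text{if }2\mid q.\end{cases}$$ Then for every real $X>0$ and every integer $q\ge1$, $$\left|\sum_{\substack{\ell\le X\\(\ell,q)=1}}\frac{\mu^2(\ell)}{\ell}-\frac{q}{\kappa(q)}\frac{6}{\pi^2}\bigl(\log X+\mathfrak b_q\bigr)\right|\le\frac{\mathrm C_1(q)}{\sqrt X},$$ and for every real $\alpha>\frac12$ with $\alpha\neq1$, $$\left|\sum_{\substack{\ell\le X\\(\ell,q)=1}}\frac{\mu^2(\ell)}{\ell^\alpha}-\left(\frac{q^\alpha}{\kappa_\alpha(q)}\frac{\zeta(\alpha)}{\zeta(2\alpha)}-\frac{q}{\kappa(q)}\frac{6}{(\alpha-1)\pi^2}\frac1{X^{\alpha-1}}\right)\right|\le\frac{\mathrm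 C_\alpha(q)}{X^{\alpha-\frac12}}.$$ The sums run over positive integers $\ell$. -/

import Mathlib

noncomputable section

namespace SqfreeAverage

/-- The function `φ_s(q) = q^s ∏_{p ∣ q} (1 - p^{-s})`, for real `s`. -/
def phi (s : ℝ) (q : ℕ) : ℝ :=
  (q : ℝ) ^ s * ∏ p ∈ q.primeFactors, (1 - 1 / (p : ℝ) ^ s)

/-- The function `κ_s(q) = q^s ∏_{p ∣ q} (1 + p^{-s})`, for real `s`; `κ` stands for `κ_1`. -/
def kappa (s : ℝ) (q : ℕ) : ℝ :=
  (q : ℝ) ^ s * ∏ p ∈ q.primeFactors, (1 + 1 / (p : ℝ) ^ s)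

/-- The Riemann zeta function at a real argument, as a real number. -/
def zetaReal (x : ℝ) : ℝ := (riemannZeta (x : ℂ)).re

/-- Nothing is lost by taking the real part: `ζ` is real on the real axis. -/
theorem ofReal_zetaReal (x : ℝ) : ((zetaReal x : ℝ) : ℂ) = riemannZeta (x : ℂ) := by
  have h := riemannZeta_conj (x : ℂ)
  rw [Complex.conj_ofReal] at h
  exact Complex.conj_eq_iff_re.mp h.symm

/-- The series `∑_p 2 log p / (p² - 1)` over the primes converges. -/
theorem summable_prime_log :
    Summable fun p : Nat.Primes => 2 * Real.log (p : ℕ) / (((p : ℕ) : ℝ) ^ 2 - 1) := by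
  have h1 : Summable fun n : ℕ => 6 * (1 / (n : ℝ) ^ (3 / 2 : ℝ)) :=
    (Real.summable_one_div_nat_rpow.mpr (by norm_num)).mul_left 6
  have h2 : Summable fun p : Nat.Primes => 6 * (1 / ((p : ℕ) : ℝ) ^ (3 / 2 : ℝ)) :=
    h1.comp_injective Nat.Primes.coe_nat_injective
  refine Summable.of_nonneg_of_le (fun p => ?_) (fun p => ?_) h2
  · have hp : (2 : ℝ) ≤ ((p : ℕ) : ℝ) := by exact_mod_cast p.2.two_le
    have hl : 0 ≤ Real.log ((p : ℕ) : ℝ) := Real.log_nonneg (by linarith)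
    exact div_nonneg (by linarith) (by nlinarith)
  · have hp : (2 : ℝ) ≤ ((p : ℕ) : ℝ) := by exact_mod_cast p.2.two_le
    set x : ℝ := ((p : ℕ) : ℝ) with hx
    have hx0 : 0 < x := by linarith
    have hl : Real.log x ≤ x ^ (1 / 2 : ℝ) / (1 / 2) :=
      Real.log_le_rpow_div hx0.le (by norm_num)
    have hpos : 0 < x ^ (3 / 2 : ℝ) := Real.rpow_pos_of_pos hx0 _
    have hmul : x ^ (1 / 2 : ℝ) * x ^ (3 / 2 : ℝ) = x ^ 2 := by
      rw [← Real.rpow_add hx0, ← Real.rpow_natCast]; norm_num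
    rw [mul_one_div, div_le_div_iff₀ (by nlinarith) hpos]
    have h3 : 2 * Real.log x * x ^ (3 / 2 : ℝ) ≤ 4 * x ^ 2 := by
      rw [← hmul]
      nlinarith
    nlinarith

/-- `𝔟_q = ∑_p 2 log p / (p² - 1) + γ + ∑_{p ∣ q} log p / (p + 1)`. -/
def bConst (q : ℕ) : ℝ :=
  (∑' p : Nat.Primes, 2 * Real.log (p : ℕ) / (((p : ℕ) : ℝ) ^ 2 - 1))
    + Real.eulerMascheroniConstant
    + ∑ p ∈ q.primeFactors, Real.log (p : ℝ) / ((p : ℝ) + 1)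

/-- The constants `D_1 = 0.43` and `D_2 = 0.120` (used for `v ∈ {1, 2}` only). -/
def Dconst (v : ℕ) : ℝ := if v = 1 then 0.43 else 0.120

/-- The constants `E_α^{(v)}` (used for `v ∈ {1, 2}` and `α > 1/2` only):
`E_1^{(1)} = 1.044`, `E_1^{(2)} = 0.232`, and a maximum of three terms when `α ≠ 1`. -/
def Econst (α : ℝ) (v : ℕ) : ℝ :=
  if α = 1 then (if v = 1 then 1.044 else 0.232)
  else
    max (Dconst v * (1 + |α - 1| / (α - 1 / 2)))
      (max
        (phi (1 / 2) v / √(v : ℝ) *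
          |(v : ℝ) ^ α / kappa α v * (zetaReal α / zetaReal (2 * α))
            - (v : ℝ) / kappa 1 v * (6 / ((α - 1) * Real.pi ^ 2))|)
        (phi (1 / 2) v / √(v : ℝ) * (|α - 1| / (α - 1 / 2)) *
          (3 * kappa α v * zetaReal (2 * α) /
            ((α - 1 / 2) * (v : ℝ) ^ (α - 1) * kappa 1 v * Real.pi ^ 2 *
              |zetaReal α * (α - 1)|)) ^ (2 / (α - 1))))

/-- The coefficient `(√q / φ_{1/2}(q)) E_α^{(1)} ∏_{2 ∣ q} (E_α^{(2)} / E_α^{(1)})` of the error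
term; the product has one factor if `q` is even and none if `q` is odd. -/
def errCoeff (α : ℝ) (q : ℕ) : ℝ :=
  √(q : ℝ) / phi (1 / 2) q *
    (Econst α 1 * (if 2 ∣ q then Econst α 2 / Econst α 1 else 1))

/-- `∑_{ℓ ≤ X, (ℓ, q) = 1} μ²(ℓ) / ℓ^α`, over positive integers `ℓ`. -/
def sqfreeSum (α : ℝ) (q : ℕ) (X : ℝ) : ℝ :=
  ∑ l ∈ (Finset.Icc 1 ⌊X⌋₊).filter (fun l => Nat.Coprime l q),
    (ArithmeticFunction.moebius l : ℝ) ^ 2 / (l : ℝ) ^ α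

end SqfreeAverage

end

/-! Everything rests on the exponent `1` and the moduli `v ∈ {1, 2}`. By `μ²(l) = ∑_{d² ∣ l} μ(d)`
the sum is a combination of harmonic sums at `X / d²`. Replacing these by their asymptotics and
summing over all `d` gives exactly the main term, by the Dirichlet series of `μ`, `μ log` and `Λ` at
`2`. Hence the remainder is `R(X) = ∑_d μ_v(d) d⁻² e(X / d²)`, where `μ_v` is `μ` restricted to
integers coprime to `v` and `e` is the error of the harmonic sum over such integers
(`tendsto_sum_harmErr`).

For `X / d² ≥ w` the bound on `e(y)` has leading part `1 / (2y)`, and the density of a sieve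
containing the squarefree numbers bounds the contribution. For `X / d² < w` (`w = 2` if `v = 1`, `w
= 3` if `v = 2`) the harmonic sum is `0` or `1`, so a smooth logarithmic weight is summed against
`μ_v`. Partial summation with `|∑_{n ≤ t} μ(n)| ≤ 0.036 t`, respectively `0.072 t` over odd `n`, for
`t ≥ 201`, settles this range. The Möbius bounds come from a Chebyshev-type identity and a finite
computation. Together they give `|R| ≤ 0.43 / √X` for `v = 1` and `0.409 / √X` for `v = 2` once `X ≥
w · 201²`. Below that, integer arithmetic checked by the kernel takes over, from `X = 2` and `X = 1`
on.

Exponent `α ≠ 1`: with `E_α` the error term, `E_α(Y) - Y^(1-α) R(Y)` is continuous on `[1, ∞)` with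
derivative `(α - 1) t^(-α) R(t)` between integers, and tends to `0` along squares. So `|R| ≤ D / √t`
on `[Y, ∞)` yields `|E_α(Y)| ≤ D (1 + |α - 1| / (α - 1/2)) Y^(-(α - 1/2))`
(`abs_sqfreeErr_le_of_rem`). The limit needs `ζ(α)` left of `1`, which is reached through a series
for `(s - 1) ζ(s)`. For `X < 1` the sum is empty and the error explicit; its size is governed by
`mainGap`, the second entry of the maximum in `Econst`. For `v = 1` the interval `[1, 2)` also needs
separate treatment, since `0.43` fails there. The first two entries of the maximum suffice
throughout.

Other moduli: for a prime `p ∤ q` the sum and the main term both satisfy `F_q(X) = F_{pq}(X) +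
p^(-α) F_{pq}(X / p)`. Inverting this costs a geometric series with ratio `p^(-1/2)`, which is the
factor `(1 - p^(-1/2))⁻¹` of `√q / φ_{1/2}(q)` (`abs_sqfreeErr_mul_le`). Only the set of primes of
`q` matters, so odd `q` is reached from `1` and even `q` from `2`. -/

namespace SqfreeAverage

open Finset

/-! ### A Chebyshev-type bound for the summatory Möbius function -/

/-- The summatory Möbius function. -/
def mertensNat (N : ℕ) : ℤ := ∑ d ∈ Icc 1 N, ArithmeticFunction.moebius d

theorem sum_moebius_mul_div {N : ℕ} (hN : 1 ≤ N) :
    ∑ d ∈ Icc 1 N, ArithmeticFunction.moebius d * ((N / d : ℕ) : ℤ) = 1 := by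
  have h1 : ∀ d ∈ Icc 1 N, ((N / d : ℕ) : ℤ) = ∑ m ∈ Icc 1 N, if d ∣ m then 1 else 0 := by
    intro d hd
    rw [Finset.sum_boole]
    have := Nat.Ioc_filter_dvd_card_eq_div N d
    rw [← this]
    rfl
  rw [Finset.sum_congr rfl (fun d hd => by rw [h1 d hd, Finset.mul_sum]), Finset.sum_comm]
  have h2 : ∀ m ∈ Icc 1 N, ∑ d ∈ Icc 1 N, ArithmeticFunction.moebius d * (if d ∣ m then 1 else 0)
      = if m = 1 then 1 else 0 := by
    intro m hm
    rw [mem_Icc] at hm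
    have h3 := congrArg (fun f => f m) ArithmeticFunction.moebius_mul_coe_zeta
    simp only [ArithmeticFunction.coe_mul_zeta_apply, ArithmeticFunction.one_apply] at h3
    rw [← h3]
    simp only [mul_ite, mul_one, mul_zero]
    rw [← Finset.sum_filter]
    apply Finset.sum_congr _ (fun _ _ => rfl)
    ext d
    simp only [mem_filter, mem_Icc, Nat.mem_divisors]
    constructor
    · rintro ⟨_, h⟩; exact ⟨h, by omega⟩
    · rintro ⟨h, _⟩
      exact ⟨⟨Nat.pos_of_dvd_of_pos h (by omega), (Nat.le_of_dvd (by omega) h).trans hm.2⟩, h⟩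
  rw [Finset.sum_congr rfl h2]
  simp [hN]

theorem sum_moebius_mul_div_div {N k : ℕ} (hk : 1 ≤ k) (hN : k ≤ N) :
    ∑ d ∈ Icc 1 N, ArithmeticFunction.moebius d * ((N / d / k : ℕ) : ℤ) = 1 := by
  have h1 : 1 ≤ N / k := Nat.div_pos hN hk
  rw [← sum_moebius_mul_div h1]
  symm
  have : ∀ d, N / d / k = N / k / d := fun d => by
    rw [Nat.div_div_eq_div_mul, Nat.div_div_eq_div_mul, mul_comm]
  simp_rw [this]
  apply Finset.sum_subset (Finset.Icc_subset_Icc_right (Nat.div_le_self _ _))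
  intro d hd hd'
  rw [mem_Icc] at hd hd'
  have : N / k / d = 0 := Nat.div_eq_of_lt (by omega)
  simp [this]

/-- The step function used in the Chebyshev-type argument. -/
def chebStep (n : ℕ) : ℤ :=
  (n : ℤ) - (n / 2 : ℕ) - (n / 3 : ℕ) - (n / 5 : ℕ) + (n / 6 : ℕ) - (n / 7 : ℕ) + (n / 70 : ℕ)
    - (n / 210 : ℕ)

/-- The linear growth cancels: `210 - 105 - 70 - 42 + 35 - 30 + 3 - 1 = 0`, and all the divisors
divide `210`. -/
theorem chebStep_add_period (n : ℕ) : chebStep (n + 210) = chebStep n := by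
  simp only [chebStep]; omega

theorem abs_one_sub_chebStep_le (n : ℕ) : |1 - chebStep n| ≤ 1 := by
  have h0 : ∀ m < 210, |1 - chebStep m| ≤ 1 := by decide +kernel
  induction n using Nat.strong_induction_on with
  | _ n ih =>
    by_cases h : n < 210
    · exact h0 n h
    · have := chebStep_add_period (n - 210)
      rw [Nat.sub_add_cancel (by omega)] at this
      rw [this]; exact ih _ (by omega)

/-- Each of the eight floors contributes its sign, three times `+1` and five times `-1`. -/
theorem sum_moebius_mul_chebStep {N : ℕ} (hN : 210 ≤ N) :
    ∑ d ∈ Icc 1 N, ArithmeticFunction.moebius d * chebStep (N / d) = -2 := by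
  have h : ∀ k, 1 ≤ k → k ≤ 210 →
      ∑ d ∈ Icc 1 N, ArithmeticFunction.moebius d * ((N / d / k : ℕ) : ℤ) = 1 :=
    fun k h1 h2 => sum_moebius_mul_div_div h1 (h2.trans hN)
  simp only [chebStep, mul_sub, mul_add, Finset.sum_sub_distrib, Finset.sum_add_distrib]
  rw [sum_moebius_mul_div (by omega), h 2 (by norm_num) (by norm_num),
    h 3 (by norm_num) (by norm_num), h 5 (by norm_num) (by norm_num),
    h 6 (by norm_num) (by norm_num), h 7 (by norm_num) (by norm_num),
    h 70 (by norm_num) (by norm_num), h 210 (by norm_num) (by norm_num)]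
  norm_num

/-- The indicator function of the integers divisible neither by `4` nor by `9`. -/
def sieveInd (n : ℕ) : ℕ := if n % 4 = 0 ∨ n % 9 = 0 then 0 else 1

/-- The counting function of `sieveInd`. -/
def sieveCount (N : ℕ) : ℕ := ∑ d ∈ Icc 1 N, sieveInd d

theorem sq_dvd_moebius_eq_zero {n p : ℕ} (hp : 2 ≤ p) (h : p * p ∣ n) :
    ArithmeticFunction.moebius n = 0 := by
  apply ArithmeticFunction.moebius_eq_zero_of_not_squarefree
  intro hs
  have := hs p h
  rw [Nat.isUnit_iff] at this
  omega

theorem abs_moebius_le_sieveInd (n : ℕ) :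
    |ArithmeticFunction.moebius n| ≤ (sieveInd n : ℤ) := by
  unfold sieveInd
  split_ifs with h
  · have : ArithmeticFunction.moebius n = 0 := by
      rcases h with h | h
      · exact sq_dvd_moebius_eq_zero (p := 2) le_rfl (Nat.dvd_of_mod_eq_zero h)
      · exact sq_dvd_moebius_eq_zero (p := 3) (by norm_num) (Nat.dvd_of_mod_eq_zero h)
    simp [this]
  · exact_mod_cast ArithmeticFunction.abs_moebius_le_one

theorem sieveCount_succ (N : ℕ) : sieveCount (N + 1) = sieveCount N + sieveInd (N + 1) := by
  unfold sieveCount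
  rw [Finset.sum_Icc_succ_top (by omega)]

theorem sieveCount_add_period (N : ℕ) : sieveCount (N + 36) = sieveCount N + 24 := by
  induction N with
  | zero => decide +kernel
  | succ N ih =>
    rw [show N + 1 + 36 = (N + 36) + 1 by ring, sieveCount_succ (N + 36), sieveCount_succ N, ih]
    have : sieveInd (N + 36 + 1) = sieveInd (N + 1) := by
      have h1 : (N + 36 + 1) % 4 = (N + 1) % 4 := by omega
      have h2 : (N + 36 + 1) % 9 = (N + 1) % 9 := by omega
      rw [sieveInd, sieveInd, h1, h2]
    omega

/-- In each period of `36` exactly `24` integers survive, hence the density `2/3`; the additive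
constants are checked on one period. -/
theorem sieveCount_bounds (N : ℕ) :
    3 * sieveCount N ≤ 2 * N + 4 ∧ 2 * N ≤ 3 * sieveCount N + 2 := by
  have h0 : ∀ m < 36, 3 * sieveCount m ≤ 2 * m + 4 ∧ 2 * m ≤ 3 * sieveCount m + 2 := by
    decide +kernel
  induction N using Nat.strong_induction_on with
  | _ n ih =>
    by_cases h : n < 36
    · exact h0 n h
    · have h1 := sieveCount_add_period (n - 36)
      rw [Nat.sub_add_cancel (by omega)] at h1
      have := ih (n - 36) (by omega)
      omega

/-- The weight `|1 - chebStep n|` for `n < 100`, replaced by `1` from `100` on. -/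
def chebWeight (n : ℕ) : ℤ := if n = 0 then 0 else if n < 100 then |1 - chebStep n| else 1

/-- The increments of `chebWeight`. -/
def chebJump (n : ℕ) : ℤ := chebWeight n - chebWeight (n - 1)

/-- Telescoping; there are only finitely many jumps because the weight is frozen at `1` from `100`
on. -/
theorem chebWeight_eq_sum (m : ℕ) :
    chebWeight m = ∑ n ∈ Icc 1 100, if n ≤ m then chebJump n else 0 := by
  have h0 : ∀ m ≤ 100, chebWeight m = ∑ n ∈ Icc 1 100, if n ≤ m then chebJump n else 0 := by
    decide +kernel
  by_cases h : m ≤ 100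
  · exact h0 m h
  · have h1 : chebWeight m = chebWeight 100 := by
      simp only [chebWeight]
      rw [if_neg (by omega), if_neg (by omega)]; norm_num
    rw [h1, h0 100 le_rfl]
    apply Finset.sum_congr rfl
    intro n hn
    rw [mem_Icc] at hn
    rw [if_pos hn.2, if_pos (by omega)]

/-- Partial summation: `n ≤ N / d` exactly when `d ≤ N / n`, so after swapping the sums each jump
multiplies a counting function. -/
theorem sum_sieveInd_mul_chebWeight (N : ℕ) :
    ∑ d ∈ Icc 1 N, (sieveInd d : ℤ) * chebWeight (N / d)
      = ∑ n ∈ Icc 1 100, chebJump n * (sieveCount (N / n) : ℤ) := by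
  simp_rw [chebWeight_eq_sum, Finset.mul_sum]
  rw [Finset.sum_comm]
  apply Finset.sum_congr rfl
  intro n hn
  rw [mem_Icc] at hn
  unfold sieveCount
  rw [Nat.cast_sum, Finset.mul_sum]
  symm
  rw [← Finset.sum_subset (Finset.Icc_subset_Icc_right (Nat.div_le_self N n))]
  · apply Finset.sum_congr rfl
    intro d hd
    rw [mem_Icc] at hd
    have : n ≤ N / d := by
      rw [Nat.le_div_iff_mul_le (by omega), mul_comm]
      exact (Nat.le_div_iff_mul_le (by omega)).1 hd.2
    rw [if_pos this, mul_comm]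
  · intro d hd hd'
    rw [mem_Icc] at hd hd'
    have : ¬ n ≤ N / d := by
      intro h
      apply hd'
      refine ⟨hd.1, ?_⟩
      rw [Nat.le_div_iff_mul_le (by omega)] at h ⊢
      rwa [mul_comm]
    rw [if_neg this, mul_zero]

/-- Jumps are `0` or `±1`. A positive jump loses `4/3` from the upper sieve bound; a negative one
loses `2/3` from the lower bound and `2/3` from the floor, again `4/3`. -/
theorem chebJump_mul_sieveCount_le (N : ℕ) {n : ℕ} (hn : n ∈ Icc 1 100) :
    ((chebJump n * (sieveCount (N / n) : ℤ) : ℤ) : ℚ)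
      ≤ 2 / 3 * N * (chebJump n / n) + 4 / 3 * |(chebJump n : ℚ)| := by
  have h0 : ∀ n ∈ Icc 1 100, chebJump n = 1 ∨ chebJump n = 0 ∨ chebJump n = -1 := by
    decide +kernel
  obtain ⟨h1, h2⟩ := sieveCount_bounds (N / n)
  have hn1 := (mem_Icc.1 hn).1
  have hnq : (0 : ℚ) < n := by exact_mod_cast hn1
  have h3 : ((N / n : ℕ) : ℚ) ≤ N / n := Nat.cast_div_le
  have h4 : (N : ℚ) / n ≤ ((N / n : ℕ) : ℚ) + 1 := by
    rw [div_le_iff₀ hnq]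
    have := Nat.div_add_mod N n
    have h5 := Nat.mod_lt N hn1
    have h6 : N ≤ (N / n + 1) * n := by nlinarith
    exact_mod_cast h6
  have h1' : (3 : ℚ) * sieveCount (N / n) ≤ 2 * (N / n : ℕ) + 4 := by exact_mod_cast h1
  have h2' : (2 : ℚ) * (N / n : ℕ) ≤ 3 * sieveCount (N / n) + 2 := by exact_mod_cast h2
  rcases h0 n hn with h | h | h <;> rw [h]
  · push_cast
    rw [abs_one]
    have : (2 : ℚ) / 3 * N * (1 / n) = 2 / 3 * (N / n) := by ring
    rw [this]; linarith
  · simp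
  · push_cast
    rw [abs_neg, abs_one]
    have : (2 : ℚ) / 3 * N * (-1 / n) = -(2 / 3 * (N / n)) := by ring
    rw [this]; linarith

/-- In `M(N) + 2 = ∑ μ(d) (1 - chebStep (N / d))` the weight is bounded by `1`, and its jumps,
weighted by `1/n`, nearly cancel. The main part is `2/3 · 0.04953 N = 0.03302 N`; the additive `4/3
· 43 + 2 < 59.4` is at most `0.00297 N` from `20000` on. -/
theorem abs_mertensNat_le_of_ge {N : ℕ} (hN : 20000 ≤ N) :
    1000 * |mertensNat N| ≤ 36 * (N : ℤ) := by
  have h1 : mertensNat N + 2 =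
      ∑ d ∈ Icc 1 N, ArithmeticFunction.moebius d * (1 - chebStep (N / d)) := by
    simp only [mul_sub, mul_one, Finset.sum_sub_distrib]
    rw [sum_moebius_mul_chebStep (by omega)]
    unfold mertensNat; ring
  have h2 : |mertensNat N + 2| ≤ ∑ d ∈ Icc 1 N, (sieveInd d : ℤ) * chebWeight (N / d) := by
    rw [h1]
    refine (Finset.abs_sum_le_sum_abs _ _).trans (Finset.sum_le_sum fun d hd => ?_)
    rw [abs_mul]
    rw [mem_Icc] at hd
    refine mul_le_mul (abs_moebius_le_sieveInd d) ?_ (abs_nonneg _) (by positivity)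
    have h3 : N / d ≠ 0 := (Nat.div_pos hd.2 hd.1).ne'
    simp only [chebWeight]
    rw [if_neg h3]
    split_ifs
    · exact le_rfl
    · exact abs_one_sub_chebStep_le _
  rw [sum_sieveInd_mul_chebWeight] at h2
  have h3 : ((|mertensNat N + 2| : ℤ) : ℚ) ≤
      2 / 3 * N * (∑ n ∈ Icc 1 100, (chebJump n : ℚ) / n)
        + 4 / 3 * ∑ n ∈ Icc 1 100, |(chebJump n : ℚ)| := by
    have h4 : ((|mertensNat N + 2| : ℤ) : ℚ) ≤
        ((∑ n ∈ Icc 1 100, chebJump n * (sieveCount (N / n) : ℤ) : ℤ) : ℚ) := by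
      exact_mod_cast h2
    refine h4.trans ?_
    rw [Int.cast_sum, Finset.mul_sum, Finset.mul_sum, ← Finset.sum_add_distrib]
    exact Finset.sum_le_sum fun n hn => chebJump_mul_sieveCount_le N hn
  have h5 : ∑ n ∈ Icc 1 100, (chebJump n : ℚ) / n ≤ 4953 / 100000 := by decide +kernel
  have h6 : ∑ n ∈ Icc 1 100, |(chebJump n : ℚ)| ≤ 43 := by decide +kernel
  have hNq : (20000 : ℚ) ≤ N := by exact_mod_cast hN
  have h7 : ((|mertensNat N| : ℤ) : ℚ) ≤ ((|mertensNat N + 2| : ℤ) : ℚ) + 2 := by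
    have : |mertensNat N| ≤ |mertensNat N + 2| + 2 := by
      have := abs_sub_abs_le_abs_sub (mertensNat N) (mertensNat N + 2)
      have h8 : mertensNat N - (mertensNat N + 2) = -2 := by ring
      rw [h8] at this
      norm_num at this
      linarith
    exact_mod_cast this
  have h9 : (1000 : ℚ) * ((|mertensNat N| : ℤ) : ℚ) ≤ 36 * N := by nlinarith
  exact_mod_cast h9

end SqfreeAverage


namespace SqfreeAverage

open Finset

/-! ### Verification of a finite range by binary recursion -/

/-- Runs `step` at `n, n + 1, …, n + 2 ^ k - 1`. -/
def binRun {σ : Type} (step : ℕ → σ → Option σ) : ℕ → ℕ → σ → Option σ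
  | 0, n, s => step n s
  | k + 1, n, s => match binRun step k n s with
    | none => none
    | some s' => binRun step k (n + 2 ^ k) s'

/-- `P n s` is the invariant of the state before position `n`, and `Q n` is what a successful step
there certifies. Halving the range keeps the recursion depth at `k` for `2 ^ k` steps, which makes
kernel evaluation feasible. -/
theorem binRun_spec {σ : Type} {step : ℕ → σ → Option σ} {P : ℕ → σ → Prop} {Q : ℕ → Prop}
    (h : ∀ n s s', P n s → step n s = some s' → P (n + 1) s' ∧ Q n) :
    ∀ k n s s', P n s → binRun step k n s = some s' →
      P (n + 2 ^ k) s' ∧ ∀ j, n ≤ j → j < n + 2 ^ k → Q j := by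
  intro k
  induction k with
  | zero =>
    intro n s s' hP hs
    obtain ⟨h1, h2⟩ := h n s s' hP hs
    refine ⟨by simpa using h1, fun j hj hj' => ?_⟩
    have : j = n := by simp at hj'; omega
    rwa [this]
  | succ k ih =>
    intro n s s' hP hs
    rw [binRun] at hs
    cases h1 : binRun step k n s with
    | none => rw [h1] at hs; simp at hs
    | some t =>
      rw [h1] at hs
      obtain ⟨h2, h3⟩ := ih n s t hP h1
      obtain ⟨h4, h5⟩ := ih _ t s' h2 hs
      refine ⟨by rw [pow_succ, mul_two, ← add_assoc]; exact h4, fun j hj hj' => ?_⟩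
      rw [pow_succ, mul_two, ← add_assoc] at hj'
      by_cases hjk : j < n + 2 ^ k
      · exact h3 j hj hjk
      · exact h5 j (by omega) hj'

/-- The sign `±1`, shifted by one. -/
def signCode (s : Bool) : ℕ := bif s then 2 else 0

/-- One plus the value of the Möbius function (or of its negative, when `s` is false), computed by
trial division by the elements of the list. -/
def moebiusCode : List ℕ → ℕ → Bool → ℕ
  | [], n, s => bif Nat.beq n 1 then signCode s else signCode (!s)
  | p :: l, n, s => bif Nat.ble (p * p) n then
      (bif Nat.beq (n % p) 0 then
        (bif Nat.beq (n / p % p) 0 then 1 else moebiusCode l (n / p) (!s))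
        else moebiusCode l n s)
    else bif Nat.beq n 1 then signCode s else signCode (!s)

theorem signCode_eq {n : ℕ} (hn : n = 1 ∨ n.Prime) (s : Bool) :
    (((bif Nat.beq n 1 then signCode s else signCode (!s) : ℕ)) : ℤ) - 1
      = (bif s then 1 else -1) * ArithmeticFunction.moebius n := by
  rcases hn with rfl | hn
  · cases s <;> simp [signCode]
  · rw [ArithmeticFunction.moebius_apply_prime hn]
    have : Nat.beq n 1 = false := by
      have := hn.one_lt
      rw [← Bool.not_eq_true, Nat.beq_eq]; omega
    rw [this]
    cases s <;> simp [signCode]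

theorem eq_one_or_prime_of_lt_sq {n p : ℕ} (hn : 0 < n) (h : n < p * p)
    (hp : ∀ q, q.Prime → q ∣ n → p ≤ q) : n = 1 ∨ n.Prime := by
  by_contra hc
  push Not at hc
  have h1 := Nat.minFac_sq_le_self hn hc.2
  have h2 := hp _ (Nat.minFac_prime hc.1) (Nat.minFac_dvd n)
  nlinarith

/-- Stated for the cofactor left after some divisions, with accumulated sign `s`. Its prime divisors
are still in the list or at least `B`, so once `p * p > n`, or the list ends with `n < B * B`, the
cofactor is `1` or prime. -/
theorem moebiusCode_eq (B : ℕ) : ∀ (l : List ℕ) (n : ℕ) (s : Bool), 0 < n → n < B * B →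
    l.Pairwise (· < ·) → (∀ p ∈ l, p.Prime ∧ p < B) →
    (∀ q, q.Prime → q ∣ n → q ∈ l ∨ B ≤ q) →
    (moebiusCode l n s : ℤ) - 1 = (bif s then 1 else -1) * ArithmeticFunction.moebius n := by
  intro l
  induction l with
  | nil =>
    intro n s hn hB _ _ h
    exact signCode_eq (eq_one_or_prime_of_lt_sq hn hB fun q hq hqn => by simpa using h q hq hqn) s
  | cons p l ih =>
    intro n s hn hB hl hlp h
    rw [List.pairwise_cons] at hl
    obtain ⟨hpp, hpB⟩ := hlp p (by simp)
    have hlp' : ∀ q ∈ l, q.Prime ∧ q < B := fun q hq => hlp q (by simp [hq])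
    rw [moebiusCode]
    cases h1 : Nat.ble (p * p) n
    · have h1' : n < p * p := by
        by_contra hc
        rw [Nat.ble_eq_true_of_le (by omega)] at h1
        exact absurd h1 (by simp)
      refine signCode_eq (eq_one_or_prime_of_lt_sq hn h1' fun q hq hqn => ?_) s
      rcases h q hq hqn with h2 | h2
      · rcases List.mem_cons.1 h2 with rfl | h3
        · exact le_rfl
        · exact (hl.1 q h3).le
      · omega
    · simp only [cond_true]
      by_cases h2 : p ∣ n
      · have h2' : Nat.beq (n % p) 0 = true := by rw [Nat.beq_eq]; exact Nat.mod_eq_zero_of_dvd h2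
        rw [h2', cond_true]
        obtain ⟨m, rfl⟩ := h2
        rw [Nat.mul_div_cancel_left _ hpp.pos]
        by_cases h3 : p ∣ m
        · have h3' : Nat.beq (m % p) 0 = true := by
            rw [Nat.beq_eq]; exact Nat.mod_eq_zero_of_dvd h3
          rw [h3', cond_true, sq_dvd_moebius_eq_zero hpp.two_le (mul_dvd_mul_left p h3)]
          simp
        · have h3' : Nat.beq (m % p) 0 = false := by
            rw [← Bool.not_eq_true, Nat.beq_eq]; rwa [Nat.dvd_iff_mod_eq_zero] at h3
          rw [h3', cond_false, ih m (!s) (Nat.pos_of_mul_pos_left hn)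
            (lt_of_le_of_lt (Nat.le_mul_of_pos_left _ hpp.pos) hB) hl.2 hlp' ?_]
          · rw [ArithmeticFunction.isMultiplicative_moebius.map_mul_of_coprime
              ((Nat.Prime.coprime_iff_not_dvd hpp).2 h3),
              ArithmeticFunction.moebius_apply_prime hpp]
            cases s <;> simp
          · intro q hq hqm
            rcases h q hq (dvd_mul_of_dvd_right hqm p) with h4 | h4
            · rcases List.mem_cons.1 h4 with rfl | h5
              · exact absurd hqm h3
              · exact Or.inl h5
            · exact Or.inr h4
      · have h2' : Nat.beq (n % p) 0 = false := by
          rw [← Bool.not_eq_true, Nat.beq_eq]; rwa [Nat.dvd_iff_mod_eq_zero] at h2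
        rw [h2', cond_false]
        refine ih n s hn hB hl.2 hlp' fun q hq hqn => ?_
        rcases h q hq hqn with h4 | h4
        · rcases List.mem_cons.1 h4 with rfl | h5
          · exact absurd hqn h2
          · exact Or.inl h5
        · exact Or.inr h4

/-- The primes below `149`. -/
def smallPrimes : List ℕ :=
  [2, 3, 5, 7, 11, 13, 17, 19, 23, 29, 31, 37, 41, 43, 47, 53, 59, 61, 67, 71, 73, 79, 83, 89, 97,
    101, 103, 107, 109, 113, 127, 131, 137, 139]

/-- `149² = 22201` exceeds the range up to `22000` in which the summatory function is followed. -/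
theorem moebiusCode_smallPrimes {n : ℕ} (hn : 0 < n) (hn' : n < 149 * 149) :
    (moebiusCode smallPrimes n true : ℤ) = ArithmeticFunction.moebius n + 1 := by
  have h1 : smallPrimes.Pairwise (· < ·) := by decide +kernel
  have h2 : ∀ p ∈ smallPrimes, p.Prime ∧ p < 149 := by
    simp only [smallPrimes, List.forall_mem_cons]
    norm_num
  have h3 : ∀ q < 149, q.Prime → q ∈ smallPrimes := by decide +kernel
  have := moebiusCode_eq 149 smallPrimes n true hn hn' h1 h2 fun q hq _ => by
    by_cases h : q < 149
    · exact Or.inl (h3 q h hq)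
    · exact Or.inr (by omega)
  simp only [cond_true, one_mul] at this
  omega

/-- The verification step for the summatory Möbius function; the state is its value, shifted by
`5000`. -/
def mertensStep (n m : ℕ) : Option ℕ :=
  let m' := m + moebiusCode smallPrimes n true
  bif Nat.ble n 200 || (Nat.ble (1000 * (m' - 5001)) (36 * n)
      && Nat.ble (1000 * (5001 - m')) (36 * n))
    then some (m' - 1) else none

theorem mertensNat_succ (N : ℕ) :
    mertensNat (N + 1) = mertensNat N + ArithmeticFunction.moebius (N + 1) := by
  unfold mertensNat
  rw [Finset.sum_Icc_succ_top (by omega)]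

theorem abs_mertensNat_le_nat (N : ℕ) : |mertensNat N| ≤ N := by
  induction N with
  | zero => simp [mertensNat]
  | succ N ih =>
    rw [mertensNat_succ]
    have h := (abs_add_le (mertensNat N) (ArithmeticFunction.moebius (N + 1)))
    have h2 : |ArithmeticFunction.moebius (N + 1)| ≤ 1 := ArithmeticFunction.abs_moebius_le_one
    push_cast; linarith

/-- The intermediate value `t` is `M(n) + 5001`, the extra `1` coming from the shifted Möbius code.
The two truncated subtractions together test `|M(n)|`; up to `200` nothing is tested. -/
theorem mertensStep_spec (n m m' : ℕ)
    (h : 1 ≤ n ∧ (n ≤ 22000 → (m : ℤ) = mertensNat (n - 1) + 5000))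
    (hs : mertensStep n m = some m') :
    (1 ≤ n + 1 ∧ (n + 1 ≤ 22000 → (m' : ℤ) = mertensNat (n + 1 - 1) + 5000)) ∧
      (201 ≤ n → n < 22000 → 1000 * |mertensNat n| ≤ 36 * (n : ℤ)) := by
  simp only [mertensStep] at hs
  set t := m + moebiusCode smallPrimes n true with ht
  cases hc : (Nat.ble n 200 || (Nat.ble (1000 * (t - 5001)) (36 * n)
      && Nat.ble (1000 * (5001 - t)) (36 * n)))
  · rw [hc] at hs; simp at hs
  · rw [hc, cond_true, Option.some.injEq] at hs
    have key : n < 22000 → (t : ℤ) = mertensNat n + 5001 := by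
      intro hn
      have h1 := moebiusCode_smallPrimes (n := n) (by omega) (by omega)
      have h2 := mertensNat_succ (n - 1)
      rw [Nat.sub_add_cancel h.1] at h2
      have := h.2 hn.le
      rw [ht]; push_cast; rw [h1, h2, this]; ring
    refine ⟨⟨by omega, fun hn => ?_⟩, fun hn hn' => ?_⟩
    · have h1 := key (by omega)
      simp only [Nat.add_sub_cancel]
      -- The new state `t - 1` is a truncated subtraction, so `t = 0` has to be excluded.
      by_cases ht0 : t = 0
      · exfalso
        rw [ht0] at h1
        by_cases hn2 : n ≤ 200
        · have := (abs_le.1 (abs_mertensNat_le_nat n)).1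
          push_cast at h1; omega
        · simp only [ht0, Bool.or_eq_true, Bool.and_eq_true, Nat.ble_eq] at hc
          omega
      · omega
    · have h1 := key hn'
      simp only [Bool.or_eq_true, Bool.and_eq_true, Nat.ble_eq] at hc
      have h3 : |mertensNat n| = mertensNat n ∨ |mertensNat n| = -mertensNat n :=
        abs_choice _
      rcases h3 with h3 | h3 <;> rw [h3] <;> omega

/-- The two runs cover `1` to `16384` and `16385` to `20480`, which meets the analytic range
starting at `20000`. -/
theorem binRun_mertensStep :
    ((binRun mertensStep 14 1 5000).bind fun m => binRun mertensStep 12 16385 m).isSome = true := by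
  decide +kernel

theorem abs_mertensNat_le {N : ℕ} (hN : 201 ≤ N) : 1000 * |mertensNat N| ≤ 36 * (N : ℤ) := by
  by_cases h : 20000 ≤ N
  · exact abs_mertensNat_le_of_ge h
  have h0 := binRun_mertensStep
  have spec := binRun_spec mertensStep_spec
  cases h1 : binRun mertensStep 14 1 5000 with
  | none => rw [h1] at h0; simp at h0
  | some m =>
    rw [h1, Option.bind_some] at h0
    obtain ⟨h2, h3⟩ := spec 14 1 5000 m ⟨le_rfl, by simp [mertensNat]⟩ h1
    cases h4 : binRun mertensStep 12 16385 m with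
    | none => rw [h4] at h0; simp at h0
    | some m' =>
      obtain ⟨_, h5⟩ := spec 12 16385 m m' h2 h4
      by_cases h6 : N < 16385
      · exact h3 N (by omega) (by omega) hN (by omega)
      · exact h5 N (by omega) (by omega) hN (by omega)

end SqfreeAverage


/-! ### The summatory Möbius function over odd integers. -/

namespace SqfreeAverage

open Finset

/-- The Möbius function at odd integers, extended by zero. -/
def moebiusOdd (n : ℕ) : ℤ := if n % 2 = 1 then ArithmeticFunction.moebius n else 0

/-- The summatory function of `moebiusOdd`. -/
def mertensOddNat (N : ℕ) : ℤ := ∑ d ∈ Icc 1 N, moebiusOdd d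

theorem mertensOddNat_succ (N : ℕ) :
    mertensOddNat (N + 1) = mertensOddNat N + moebiusOdd (N + 1) := by
  unfold mertensOddNat
  rw [Finset.sum_Icc_succ_top (by omega)]

theorem moebius_two_mul (e : ℕ) :
    ArithmeticFunction.moebius (2 * e) = -moebiusOdd e := by
  unfold moebiusOdd
  split_ifs with h
  · rw [ArithmeticFunction.isMultiplicative_moebius.map_mul_of_coprime
      ((Nat.coprime_two_left).2 (Nat.odd_iff.2 h)),
      ArithmeticFunction.moebius_apply_prime Nat.prime_two]
    ring
  · rw [sq_dvd_moebius_eq_zero (p := 2) le_rfl (mul_dvd_mul_left 2 (by omega))]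
    simp

/-- The even integers `2e ≤ N` contribute `μ(2e) = -moebiusOdd e` to `M(N)`. -/
theorem mertensOddNat_eq (N : ℕ) : mertensOddNat N = mertensNat N + mertensOddNat (N / 2) := by
  induction N with
  | zero => simp [mertensNat, mertensOddNat]
  | succ N ih =>
    rw [mertensOddNat_succ, mertensNat_succ, ih]
    rcases Nat.even_or_odd' N with ⟨e, rfl | rfl⟩
    · have h1 : (2 * e + 1) / 2 = e := by omega
      have h2 : 2 * e / 2 = e := by omega
      rw [h1, h2, moebiusOdd, if_pos (by omega)]; ring
    · have h1 : (2 * e + 1 + 1) / 2 = e + 1 := by omega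
      have h2 : (2 * e + 1) / 2 = e := by omega
      rw [h1, h2, moebiusOdd, if_neg (by omega), mertensOddNat_succ,
        show 2 * e + 1 + 1 = 2 * (e + 1) by ring, moebius_two_mul]; ring

/-- The verification step for `mertensOddNat`; the state is its value, shifted by `5000`. -/
def mertensOddStep (n m : ℕ) : Option ℕ :=
  let m' := bif Nat.beq (n % 2) 1 then m + moebiusCode smallPrimes n true else m + 1
  bif Nat.ble n 200 || (Nat.ble (1000 * (m' - 5001)) (72 * n)
      && Nat.ble (1000 * (5001 - m')) (72 * n))
    then some (m' - 1) else none

theorem abs_mertensOddNat_le_nat (N : ℕ) : |mertensOddNat N| ≤ N := by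
  induction N with
  | zero => simp [mertensOddNat]
  | succ N ih =>
    rw [mertensOddNat_succ]
    have h := (abs_add_le (mertensOddNat N) (moebiusOdd (N + 1)))
    have h2 : |moebiusOdd (N + 1)| ≤ 1 := by
      unfold moebiusOdd
      split_ifs
      · exact ArithmeticFunction.abs_moebius_le_one
      · simp
    push_cast; linarith

theorem mertensOddStep_spec (n m m' : ℕ)
    (h : 1 ≤ n ∧ (n ≤ 600 → (m : ℤ) = mertensOddNat (n - 1) + 5000))
    (hs : mertensOddStep n m = some m') :
    (1 ≤ n + 1 ∧ (n + 1 ≤ 600 → (m' : ℤ) = mertensOddNat (n + 1 - 1) + 5000)) ∧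
      (201 ≤ n → n < 600 → 1000 * |mertensOddNat n| ≤ 72 * (n : ℤ)) := by
  simp only [mertensOddStep] at hs
  set t := bif Nat.beq (n % 2) 1 then m + moebiusCode smallPrimes n true else m + 1 with ht
  cases hc : (Nat.ble n 200 || (Nat.ble (1000 * (t - 5001)) (72 * n)
      && Nat.ble (1000 * (5001 - t)) (72 * n)))
  · rw [hc] at hs; simp at hs
  · rw [hc, cond_true, Option.some.injEq] at hs
    have key : n < 600 → (t : ℤ) = mertensOddNat n + 5001 := by
      intro hn
      have h1 := moebiusCode_smallPrimes (n := n) (by omega) (by omega)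
      have h2 := mertensOddNat_succ (n - 1)
      rw [Nat.sub_add_cancel h.1] at h2
      have h3 := h.2 hn.le
      cases hb : Nat.beq (n % 2) 1
      · have : n % 2 ≠ 1 := by
          intro h4; rw [h4] at hb; simp at hb
        rw [ht, hb, cond_false, h2, moebiusOdd, if_neg this]; push_cast; rw [h3]; ring
      · rw [ht, hb, cond_true, h2, moebiusOdd, if_pos (Nat.beq_eq ▸ hb)]
        push_cast; rw [h1, h3]; ring
    refine ⟨⟨by omega, fun hn => ?_⟩, fun hn hn' => ?_⟩
    · have h1 := key (by omega)
      simp only [Nat.add_sub_cancel]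
      by_cases ht0 : t = 0
      · exfalso
        rw [ht0] at h1
        have := (abs_le.1 (abs_mertensOddNat_le_nat n)).1
        push_cast at h1; omega
      · omega
    · have h1 := key hn'
      simp only [Bool.or_eq_true, Bool.and_eq_true, Nat.ble_eq] at hc
      have h3 : |mertensOddNat n| = mertensOddNat n ∨ |mertensOddNat n| = -mertensOddNat n :=
        abs_choice _
      rcases h3 with h3 | h3 <;> rw [h3] <;> omega

theorem binRun_mertensOddStep : (binRun mertensOddStep 9 1 5000).isSome = true := by
  decide +kernel

theorem abs_mertensOddNat_le {N : ℕ} (hN : 201 ≤ N) :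
    1000 * |mertensOddNat N| ≤ 72 * (N : ℤ) := by
  induction N using Nat.strong_induction_on with
  | _ N ih =>
    -- From `402` on, `N / 2 ≥ 201` and the recursion closes: `0.036 N + 0.072 · N / 2 = 0.072 N`.
    by_cases h : N < 402
    · have h0 := binRun_mertensOddStep
      cases h1 : binRun mertensOddStep 9 1 5000 with
      | none => rw [h1] at h0; simp at h0
      | some m =>
        exact (binRun_spec mertensOddStep_spec 9 1 5000 m ⟨le_rfl, by simp [mertensOddNat]⟩ h1).2
          N (by omega) (by omega) hN (by omega)
    · have h1 := ih (N / 2) (by omega) (by omega)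
      have h2 := abs_mertensNat_le hN
      have h3 := abs_add_le (mertensNat N) (mertensOddNat (N / 2))
      rw [← mertensOddNat_eq] at h3
      omega

/-- The Möbius function restricted to the integers coprime to `v`. -/
noncomputable def muCop (v n : ℕ) : ℝ := if n.Coprime v then (ArithmeticFunction.moebius n : ℝ) else 0

/-- The summatory function of `muCop v`. -/
noncomputable def mertens (v : ℕ) (t : ℝ) : ℝ := ∑ n ∈ Icc 0 ⌊t⌋₊, muCop v n

theorem sum_Icc_zero_eq {f : ℕ → ℝ} (h : f 0 = 0) (N : ℕ) :
    ∑ n ∈ Icc 0 N, f n = ∑ n ∈ Icc 1 N, f n := by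
  rw [← Finset.insert_Icc_add_one_left_eq_Icc (Nat.zero_le N), Finset.sum_insert (by simp), h,
    zero_add, zero_add]

theorem muCop_zero (v : ℕ) : muCop v 0 = 0 := by simp [muCop]

theorem muCop_one (n : ℕ) : muCop 1 n = ArithmeticFunction.moebius n := by simp [muCop]

theorem muCop_two (n : ℕ) : muCop 2 n = moebiusOdd n := by
  unfold muCop moebiusOdd
  simp only [Nat.coprime_two_right, Nat.odd_iff]
  split_ifs <;> simp

theorem abs_muCop_le_one (v n : ℕ) : |muCop v n| ≤ 1 := by
  unfold muCop
  split_ifs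
  · exact_mod_cast ArithmeticFunction.abs_moebius_le_one
  · simp

theorem abs_mertens_one_le {t : ℝ} (ht : 201 ≤ t) : |mertens 1 t| ≤ 0.036 * t := by
  have h1 : mertens 1 t = (mertensNat ⌊t⌋₊ : ℝ) := by
    unfold mertens mertensNat
    rw [sum_Icc_zero_eq (muCop_zero 1)]
    push_cast
    exact Finset.sum_congr rfl fun n _ => muCop_one n
  have h2 : 201 ≤ ⌊t⌋₊ := Nat.le_floor (by exact_mod_cast ht)
  have h3 : (1000 : ℝ) * |(mertensNat ⌊t⌋₊ : ℝ)| ≤ 36 * (⌊t⌋₊ : ℝ) := by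
    exact_mod_cast abs_mertensNat_le h2
  have h4 := Nat.floor_le (show (0 : ℝ) ≤ t by linarith)
  rw [h1]; linarith

theorem abs_mertens_two_le {t : ℝ} (ht : 201 ≤ t) : |mertens 2 t| ≤ 0.072 * t := by
  have h1 : mertens 2 t = (mertensOddNat ⌊t⌋₊ : ℝ) := by
    unfold mertens mertensOddNat
    rw [sum_Icc_zero_eq (muCop_zero 2)]
    push_cast
    exact Finset.sum_congr rfl fun n _ => muCop_two n
  have h2 : 201 ≤ ⌊t⌋₊ := Nat.le_floor (by exact_mod_cast ht)
  have h3 : (1000 : ℝ) * |(mertensOddNat ⌊t⌋₊ : ℝ)| ≤ 72 * (⌊t⌋₊ : ℝ) := by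
    exact_mod_cast abs_mertensOddNat_le h2
  have h4 := Nat.floor_le (show (0 : ℝ) ≤ t by linarith)
  rw [h1]; linarith

end SqfreeAverage


namespace SqfreeAverage

open Finset Filter Topology

/-! ### Harmonic sums -/

/-- The trapezoid rule for the convex function `1 / (1 + t)` on `[0, x]`. -/
theorem log_one_add_le {x : ℝ} (hx : 0 ≤ x) :
    Real.log (1 + x) ≤ 1 / 2 * (x + x / (1 + x)) := by
  have hd : ∀ y ∈ Set.Ici (0 : ℝ), HasDerivAt
      (fun y => 1 / 2 * (y + y / (1 + y)) - Real.log (1 + y))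
      (1 / 2 * (1 + (1 * (1 + y) - y * 1) / (1 + y) ^ 2) - 1 / (1 + y)) y := by
    intro y hy
    rw [Set.mem_Ici] at hy
    have h1 : HasDerivAt (fun y : ℝ => 1 + y) 1 y := (hasDerivAt_id y).const_add 1
    exact (((hasDerivAt_id y).add ((hasDerivAt_id y).div h1 (by positivity))).const_mul
      (1 / 2)).sub (h1.log (by positivity))
  have hm : MonotoneOn (fun y : ℝ => 1 / 2 * (y + y / (1 + y)) - Real.log (1 + y))
      (Set.Ici 0) := by
    apply monotoneOn_of_deriv_nonneg (convex_Ici 0)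
      (fun y hy => (hd y hy).continuousAt.continuousWithinAt)
    · exact fun y hy => (hd y (interior_subset hy)).differentiableAt.differentiableWithinAt
    · intro y hy
      have hy' := interior_subset hy
      rw [(hd y hy').deriv]
      rw [Set.mem_Ici] at hy'
      have h1 : (1 : ℝ) + y ≠ 0 := by positivity
      have : 1 / 2 * (1 + (1 * (1 + y) - y * 1) / (1 + y) ^ 2) - 1 / (1 + y)
          = 1 / 2 * (y / (1 + y)) ^ 2 := by
        field_simp; ring
      rw [this]; positivity
  have := hm (Set.mem_Ici.2 le_rfl) (Set.mem_Ici.2 hx) hx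
  norm_num at this
  linarith

/-- The trapezoid rule with the next Euler–Maclaurin correction; the difference of the two sides has
derivative `y⁴ / (6 (1 + y)³)`. -/
theorem le_log_one_add {x : ℝ} (hx : 0 ≤ x) :
    1 / 2 * (x + x / (1 + x)) + 1 / 12 * ((x / (1 + x)) ^ 2 - x ^ 2) ≤ Real.log (1 + x) := by
  have hd : ∀ y ∈ Set.Ici (0 : ℝ), HasDerivAt
      (fun y => Real.log (1 + y) -
        (1 / 2 * (y + y / (1 + y)) + 1 / 12 * ((y / (1 + y)) ^ 2 - y ^ 2)))
      (1 / (1 + y) - (1 / 2 * (1 + (1 * (1 + y) - y * 1) / (1 + y) ^ 2)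
        + 1 / 12 * ((2 : ℕ) * (y / (1 + y)) ^ (2 - 1) * ((1 * (1 + y) - y * 1) / (1 + y) ^ 2)
          - (2 : ℕ) * y ^ (2 - 1) * 1))) y := by
    intro y hy
    rw [Set.mem_Ici] at hy
    have h1 : HasDerivAt (fun y : ℝ => 1 + y) 1 y := (hasDerivAt_id y).const_add 1
    have h2 := (hasDerivAt_id y).div h1 (by positivity)
    exact (h1.log (by positivity)).sub ((((hasDerivAt_id y).add h2).const_mul
      (1 / 2)).add (((h2.pow 2).sub ((hasDerivAt_id y).pow 2)).const_mul (1 / 12)))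
  have hm : MonotoneOn (fun y => Real.log (1 + y) -
        (1 / 2 * (y + y / (1 + y)) + 1 / 12 * ((y / (1 + y)) ^ 2 - y ^ 2)))
      (Set.Ici 0) := by
    apply monotoneOn_of_deriv_nonneg (convex_Ici 0)
      (fun y hy => (hd y hy).continuousAt.continuousWithinAt)
    · exact fun y hy => (hd y (interior_subset hy)).differentiableAt.differentiableWithinAt
    · intro y hy
      have hy' := interior_subset hy
      rw [(hd y hy').deriv]
      rw [Set.mem_Ici] at hy'
      have h1 : (1 : ℝ) + y ≠ 0 := by positivity
      have : (1 / (1 + y) - (1 / 2 * (1 + (1 * (1 + y) - y * 1) / (1 + y) ^ 2)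
        + 1 / 12 * ((2 : ℕ) * (y / (1 + y)) ^ (2 - 1) * ((1 * (1 + y) - y * 1) / (1 + y) ^ 2)
          - (2 : ℕ) * y ^ (2 - 1) * 1))) = y ^ 4 / (6 * (1 + y) ^ 3) := by
        push_cast
        field_simp; ring
      rw [this]; positivity
  have := hm (Set.mem_Ici.2 le_rfl) (Set.mem_Ici.2 hx) hx
  norm_num at this
  linarith

/-- The harmonic numbers as real numbers. -/
noncomputable def harm (n : ℕ) : ℝ := ∑ k ∈ Icc 1 n, 1 / (k : ℝ)

theorem harm_succ (n : ℕ) : harm (n + 1) = harm n + 1 / ((n : ℝ) + 1) := by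
  unfold harm
  rw [Finset.sum_Icc_succ_top (by omega)]; push_cast; rfl

theorem tendsto_harm_sub_log :
    Tendsto (fun n : ℕ => harm n - Real.log n) atTop (𝓝 Real.eulerMascheroniConstant) := by
  convert Real.tendsto_harmonic_sub_log using 3 with n
  rw [harmonic_eq_sum_Icc, harm]; push_cast
  simp

theorem log_succ_eq {n : ℕ} (hn : 1 ≤ n) :
    Real.log ((n : ℝ) + 1) = Real.log n + Real.log (1 + 1 / (n : ℝ)) := by
  have : (0 : ℝ) < n := by exact_mod_cast hn
  rw [← Real.log_mul this.ne' (by positivity)]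
  congr 1; field_simp

/-- The left side increases in `n`, by the trapezoid bound at `1/n`, and tends to `γ`. The next
bound is its decreasing counterpart. -/
theorem harm_le {n : ℕ} (hn : 1 ≤ n) :
    harm n - Real.log n - 1 / (2 * (n : ℝ)) ≤ Real.eulerMascheroniConstant := by
  have hm : Monotone fun k : ℕ => harm (k + 1) - Real.log ((k + 1 : ℕ) : ℝ)
      - 1 / (2 * ((k + 1 : ℕ) : ℝ)) := by
    apply monotone_nat_of_le_succ
    intro k
    have h1 := log_succ_eq (n := k + 1) (by omega)
    have h2 := log_one_add_le (x := 1 / ((k + 1 : ℕ) : ℝ)) (by positivity)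
    have h3 := harm_succ (k + 1)
    have h4 : 1 / 2 * (1 / ((k + 1 : ℕ) : ℝ) + 1 / ((k + 1 : ℕ) : ℝ) /
        (1 + 1 / ((k + 1 : ℕ) : ℝ))) = 1 / (2 * ((k + 1 : ℕ) : ℝ))
        + 1 / (((k + 1 : ℕ) : ℝ) + 1) - 1 / (2 * (((k + 1 : ℕ) : ℝ) + 1)) := by
      have : (0 : ℝ) < ((k + 1 : ℕ) : ℝ) := by positivity
      field_simp; ring
    rw [h3]
    push_cast at *
    rw [h1]; linarith
  have ht : Tendsto (fun k : ℕ => harm (k + 1) - Real.log ((k + 1 : ℕ) : ℝ)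
      - 1 / (2 * ((k + 1 : ℕ) : ℝ))) atTop (𝓝 Real.eulerMascheroniConstant) := by
    have h1 : Tendsto (fun n : ℕ => harm n - Real.log n - 1 / (2 * (n : ℝ))) atTop
        (𝓝 (Real.eulerMascheroniConstant - 0)) := by
      refine tendsto_harm_sub_log.sub ?_
      have := (tendsto_one_div_atTop_nhds_zero_nat (𝕜 := ℝ)).const_mul (1 / 2)
      rw [mul_zero] at this
      refine this.congr fun n => ?_
      rw [one_div_mul_one_div]
    rw [sub_zero] at h1
    exact h1.comp (tendsto_add_atTop_nat 1)
  have := hm.ge_of_tendsto ht (n - 1)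
  simpa [Nat.sub_add_cancel hn] using this

theorem le_harm {n : ℕ} (hn : 1 ≤ n) :
    Real.eulerMascheroniConstant ≤
      harm n - Real.log n - 1 / (2 * (n : ℝ)) + 1 / (12 * (n : ℝ) ^ 2) := by
  have hm : Antitone fun k : ℕ => harm (k + 1) - Real.log ((k + 1 : ℕ) : ℝ)
      - 1 / (2 * ((k + 1 : ℕ) : ℝ)) + 1 / (12 * ((k + 1 : ℕ) : ℝ) ^ 2) := by
    apply antitone_nat_of_succ_le
    intro k
    have h1 := log_succ_eq (n := k + 1) (by omega)
    have h2 := le_log_one_add (x := 1 / ((k + 1 : ℕ) : ℝ)) (by positivity)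
    have h3 := harm_succ (k + 1)
    have h4 : 1 / 2 * (1 / ((k + 1 : ℕ) : ℝ) + 1 / ((k + 1 : ℕ) : ℝ) /
        (1 + 1 / ((k + 1 : ℕ) : ℝ))) + 1 / 12 * ((1 / ((k + 1 : ℕ) : ℝ) /
        (1 + 1 / ((k + 1 : ℕ) : ℝ))) ^ 2 - (1 / ((k + 1 : ℕ) : ℝ)) ^ 2)
        = 1 / (2 * ((k + 1 : ℕ) : ℝ))
        + 1 / (((k + 1 : ℕ) : ℝ) + 1) - 1 / (2 * (((k + 1 : ℕ) : ℝ) + 1))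
        + 1 / (12 * (((k + 1 : ℕ) : ℝ) + 1) ^ 2) - 1 / (12 * ((k + 1 : ℕ) : ℝ) ^ 2) := by
      have : (0 : ℝ) < ((k + 1 : ℕ) : ℝ) := by positivity
      field_simp; ring
    rw [h3]
    push_cast at *
    rw [h1]; linarith
  have ht : Tendsto (fun k : ℕ => harm (k + 1) - Real.log ((k + 1 : ℕ) : ℝ)
      - 1 / (2 * ((k + 1 : ℕ) : ℝ)) + 1 / (12 * ((k + 1 : ℕ) : ℝ) ^ 2)) atTop
      (𝓝 Real.eulerMascheroniConstant) := by
    have h1 : Tendsto (fun n : ℕ => harm n - Real.log n - 1 / (2 * (n : ℝ))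
        + 1 / (12 * (n : ℝ) ^ 2)) atTop
        (𝓝 (Real.eulerMascheroniConstant - 0 + 0)) := by
      have h0 := tendsto_one_div_atTop_nhds_zero_nat (𝕜 := ℝ)
      refine (tendsto_harm_sub_log.sub ?_).add ?_
      · have := h0.const_mul (1 / 2)
        rw [mul_zero] at this
        refine this.congr fun n => ?_
        rw [one_div_mul_one_div]
      · have := (h0.mul h0).const_mul (1 / 12)
        rw [mul_zero, mul_zero] at this
        refine this.congr fun n => ?_
        rw [one_div_mul_one_div, one_div_mul_one_div, sq]
    rw [sub_zero, add_zero] at h1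
    exact h1.comp (tendsto_add_atTop_nat 1)
  have := hm.le_of_tendsto ht (n - 1)
  simpa [Nat.sub_add_cancel hn] using this

/-- `∑_{j ≤ m} 1 / (2 j - 1)`. -/
noncomputable def oddHarm (m : ℕ) : ℝ := ∑ j ∈ range m, 1 / (2 * (j : ℝ) + 1)

theorem oddHarm_succ (m : ℕ) : oddHarm (m + 1) = oddHarm m + 1 / (2 * (m : ℝ) + 1) := by
  unfold oddHarm
  rw [Finset.sum_range_succ]

theorem oddHarm_eq (m : ℕ) : oddHarm m = harm (2 * m) - harm m / 2 := by
  induction m with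
  | zero => simp [oddHarm, harm]
  | succ m ih =>
    rw [oddHarm_succ, ih, show 2 * (m + 1) = 2 * m + 1 + 1 by ring, harm_succ, harm_succ,
      harm_succ]
    push_cast
    field_simp
    ring

/-- In `H(2m) - H(m)/2` the terms `1/(4m)` cancel; what is left is half of `1/(12 m²)`. -/
theorem oddHarm_le {m : ℕ} (hm : 1 ≤ m) :
    oddHarm m ≤ 1 / 2 * Real.log m + Real.log 2 + Real.eulerMascheroniConstant / 2
      + 1 / (24 * (m : ℝ) ^ 2) := by
  have h1 := harm_le (n := 2 * m) (by omega)
  have h2 := le_harm hm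
  have hm0 : (0 : ℝ) < m := by exact_mod_cast hm
  rw [oddHarm_eq]
  push_cast at h1
  rw [Real.log_mul (by norm_num) hm0.ne'] at h1
  have h3 : 1 / (2 * (2 * (m : ℝ))) = 1 / (2 * (m : ℝ)) / 2 := by field_simp
  have h4 : 1 / (24 * (m : ℝ) ^ 2) = 1 / (12 * (m : ℝ) ^ 2) / 2 := by field_simp; norm_num
  rw [h3] at h1
  rw [h4]
  linarith

/-- `oddHarm m - (log m)/2` decreases to its limit, by `log (1 + 1/m) ≥ 2/(2m + 1)`, the midpoint
rule. -/
theorem le_oddHarm {m : ℕ} (hm : 1 ≤ m) :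
    1 / 2 * Real.log m + Real.log 2 + Real.eulerMascheroniConstant / 2 ≤ oddHarm m := by
  have ha : Antitone fun k : ℕ => oddHarm (k + 1) - 1 / 2 * Real.log ((k + 1 : ℕ) : ℝ) := by
    apply antitone_nat_of_succ_le
    intro k
    have h1 := log_succ_eq (n := k + 1) (by omega)
    have h2 := Real.le_log_one_add_of_nonneg (x := 1 / ((k + 1 : ℕ) : ℝ)) (by positivity)
    have h3 := oddHarm_succ (k + 1)
    have h4 : 2 * (1 / ((k + 1 : ℕ) : ℝ)) / (1 / ((k + 1 : ℕ) : ℝ) + 2)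
        = 2 * (1 / (2 * ((k + 1 : ℕ) : ℝ) + 1)) := by
      have : (0 : ℝ) < ((k + 1 : ℕ) : ℝ) := by positivity
      field_simp; ring
    rw [h3]
    push_cast at *
    rw [h1]; linarith
  have ht : Tendsto (fun k : ℕ => oddHarm (k + 1) - 1 / 2 * Real.log ((k + 1 : ℕ) : ℝ)) atTop
      (𝓝 (Real.log 2 + Real.eulerMascheroniConstant / 2)) := by
    have h1 : Tendsto (fun n : ℕ => (harm (2 * (n + 1)) - Real.log ((2 * (n + 1) : ℕ) : ℝ))
        - (harm (n + 1) - Real.log ((n + 1 : ℕ) : ℝ)) / 2 + Real.log 2) atTop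
        (𝓝 (Real.eulerMascheroniConstant - Real.eulerMascheroniConstant / 2 + Real.log 2)) := by
      refine Tendsto.add_const _ (Tendsto.sub ?_ (Tendsto.div_const ?_ 2))
      · refine tendsto_harm_sub_log.comp (tendsto_atTop_mono (fun n => ?_) tendsto_id)
        simp only [id]; omega
      · exact tendsto_harm_sub_log.comp (tendsto_add_atTop_nat 1)
    have h2 : Real.eulerMascheroniConstant - Real.eulerMascheroniConstant / 2 + Real.log 2
        = Real.log 2 + Real.eulerMascheroniConstant / 2 := by ring
    rw [h2] at h1
    refine h1.congr fun n => ?_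
    rw [oddHarm_eq, Nat.cast_mul, Real.log_mul (by norm_num) (by positivity)]
    push_cast
    ring
  have := ha.le_of_tendsto ht (m - 1)
  simp only [Nat.sub_add_cancel hm] at this
  linarith

/-- `∑_{n ≤ y, (n, v) = 1} 1 / n`. -/
noncomputable def harmCop (v : ℕ) (y : ℝ) : ℝ :=
  ∑ n ∈ (Icc 1 ⌊y⌋₊).filter (fun n => Nat.Coprime n v), 1 / (n : ℝ)

theorem harmCop_one (y : ℝ) : harmCop 1 y = harm ⌊y⌋₊ := by
  simp [harmCop, harm]

theorem harmCop_two_aux (N : ℕ) :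
    ∑ n ∈ (Icc 1 N).filter (fun n => Nat.Coprime n 2), 1 / (n : ℝ) = oddHarm ((N + 1) / 2) := by
  induction N with
  | zero => simp [oddHarm]
  | succ N ih =>
    rw [Finset.sum_filter, Finset.sum_Icc_succ_top (by omega), ← Finset.sum_filter, ih]
    rcases Nat.even_or_odd' N with ⟨e, rfl | rfl⟩
    · rw [if_pos (by rw [Nat.coprime_two_right]; exact ⟨e, rfl⟩)]
      rw [show (2 * e + 1) / 2 = e by omega, show (2 * e + 1 + 1) / 2 = e + 1 by omega,
        oddHarm_succ]
      push_cast; rfl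
    · rw [if_neg (by rw [Nat.coprime_two_right, Nat.not_odd_iff_even]; exact ⟨e + 1, by ring⟩)]
      rw [show (2 * e + 1 + 1) / 2 = e + 1 by omega, show (2 * e + 1 + 1 + 1) / 2 = e + 1 by omega,
        add_zero]

theorem harmCop_two (y : ℝ) : harmCop 2 y = oddHarm ((⌊y⌋₊ + 1) / 2) := harmCop_two_aux _

/-- For `n ≤ y < n + 1` the upper estimate uses the harmonic expansion at `n`, the lower one the
expansion at `n + 1`, with `log y` moved to that integer by a tangent bound. -/
theorem harmCop_one_error {y : ℝ} (hy : 2 ≤ y) :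
    |harmCop 1 y - 1 * Real.log y - Real.eulerMascheroniConstant|
      ≤ (1 / 2 + 1 / 12 / y) / y := by
  rw [harmCop_one]
  set n := ⌊y⌋₊ with hn
  have hn1 : 1 ≤ n := Nat.le_floor (by push_cast; linarith)
  have hny : (n : ℝ) ≤ y := Nat.floor_le (by linarith)
  have hyn : y < n + 1 := Nat.lt_floor_add_one y
  have hn0 : (1 : ℝ) ≤ n := by exact_mod_cast hn1
  have hy0 : 0 < y := by linarith
  have h1 := harm_le hn1
  have h2 := le_harm (n := n + 1) (by omega)
  rw [harm_succ] at h2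
  push_cast at h2
  have h3 : 1 - (n : ℝ) / y ≤ Real.log y - Real.log n := by
    have := Real.one_sub_inv_le_log_of_pos (x := y / n) (by positivity)
    rwa [Real.log_div hy0.ne' (by positivity), inv_div] at this
  have h4 : Real.log y - Real.log ((n : ℝ) + 1) ≤ y / (n + 1) - 1 := by
    have := Real.log_le_sub_one_of_pos (x := y / ((n : ℝ) + 1)) (by positivity)
    rwa [Real.log_div hy0.ne' (by positivity)] at this
  rw [abs_le]
  constructor
  · have h5 : y / ((n : ℝ) + 1) - 1 + 1 / (2 * ((n : ℝ) + 1)) + 1 / (12 * ((n : ℝ) + 1) ^ 2)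
        ≤ (1 / 2 + 1 / 12 / y) / y := by
      have e1 : (1 / 2 + 1 / 12 / y) / y = 1 / (2 * y) + 1 / (12 * y ^ 2) := by
        field_simp
      have e2 : 1 / (12 * ((n : ℝ) + 1) ^ 2) ≤ 1 / (12 * y ^ 2) := by gcongr
      have e3 : y / ((n : ℝ) + 1) - 1 + 1 / (2 * ((n : ℝ) + 1)) ≤ 1 / (2 * y) := by
        rw [le_div_iff₀ (by positivity)]
        have : (y / ((n : ℝ) + 1) - 1 + 1 / (2 * ((n : ℝ) + 1))) * (2 * y)
          = (2 * y * (y - (n + 1)) + y) / (n + 1) := by field_simp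
        rw [this, div_le_one (by positivity)]
        nlinarith
      linarith
    have h6 : 1 / (2 * ((n : ℝ) + 1)) = 1 / ((n : ℝ) + 1) - 1 / (2 * ((n : ℝ) + 1)) := by
      field_simp; norm_num
    linarith
  · have h5 : 1 / (2 * (n : ℝ)) - (1 - n / y) ≤ 1 / (2 * y) := by
      have : 1 / (2 * (n : ℝ)) - (1 - n / y) - 1 / (2 * y)
        = (y - n) * (1 - 2 * n) / (2 * n * y) := by field_simp; ring
      have h6 : (y - n) * (1 - 2 * n) / (2 * n * y) ≤ 0 := by
        apply div_nonpos_of_nonpos_of_nonneg _ (by positivity)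
        nlinarith
      linarith
    have e1 : (1 / 2 + 1 / 12 / y) / y = 1 / (2 * y) + 1 / (12 * y ^ 2) := by
      field_simp
    have e2 : 0 ≤ 1 / (12 * y ^ 2) := by positivity
    linarith

/-- With `m` odd integers up to `y` one has `2m - 1 ≤ y < 2m + 1`. The odd harmonic sum is `½ log
(2m)` plus the constant, up to `1/(24 m²)`, so the error is essentially `½ |log y - log (2m)|`, of
size about `1/(2y)`. -/
theorem harmCop_two_error {y : ℝ} (hy : 3 ≤ y) :
    |harmCop 2 y - 1 / 2 * Real.log y - (Real.eulerMascheroniConstant + Real.log 2) / 2|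
      ≤ (1 / 2 + 5 / 16 / y) / y := by
  rw [harmCop_two]
  set n := ⌊y⌋₊ with hn
  have hn1 : 3 ≤ n := Nat.le_floor (by push_cast; linarith)
  have hny : (n : ℝ) ≤ y := Nat.floor_le (by linarith)
  have hyn : y < n + 1 := Nat.lt_floor_add_one y
  set m := (n + 1) / 2 with hm
  have hm2 : 2 ≤ m := by omega
  have hm2' : (2 : ℝ) ≤ m := by exact_mod_cast hm2
  have hy1 : 2 * (m : ℝ) - 1 ≤ y := by
    have : 2 * m ≤ n + 1 := by omega
    have : 2 * (m : ℝ) ≤ n + 1 := by exact_mod_cast this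
    linarith
  have hy2 : y < 2 * (m : ℝ) + 1 := by
    have : n + 1 ≤ 2 * m + 1 := by omega
    have : (n : ℝ) + 1 ≤ 2 * m + 1 := by exact_mod_cast this
    linarith
  have hy0 : 0 < y := by linarith
  have h1 := oddHarm_le (m := m) (by omega)
  have h2 := le_oddHarm (m := m) (by omega)
  have hl : Real.log (2 * m) = Real.log 2 + Real.log m :=
    Real.log_mul (by norm_num) (by positivity)
  have e1 : (1 / 2 + 5 / 16 / y) / y = 1 / (2 * y) + 5 / (16 * y ^ 2) := by field_simp
  rw [e1, abs_le]
  constructor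
  · have h3 : Real.log y - Real.log (2 * m) ≤ 1 / y + 5 / (8 * y ^ 2) := by
      by_cases hym : y ≤ 2 * m
      · have : Real.log y ≤ Real.log (2 * m) := Real.log_le_log hy0 hym
        have : 0 ≤ 1 / y + 5 / (8 * y ^ 2) := by positivity
        linarith
      · push Not at hym
        set s := y - 2 * m with hs
        have hs0 : 0 < s := by linarith
        have hs1 : s < 1 := by linarith
        have h4 := log_one_add_le (x := s / (2 * m)) (by positivity)
        have h5 : 1 + s / (2 * (m : ℝ)) = y / (2 * m) := by
          rw [hs]; field_simp; ring
        rw [h5, Real.log_div hy0.ne' (by positivity)] at h4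
        refine h4.trans ?_
        have h6 : 1 / 2 * (s / (2 * (m : ℝ)) + s / (2 * m) / (y / (2 * m)))
          = s / 2 * (y + 2 * m) / (2 * m * y) := by field_simp
        have h7 : 1 / y + 5 / (8 * y ^ 2) = (8 * y + 5) / (8 * y ^ 2) := by field_simp
        rw [h6, h7, div_le_div_iff₀ (by positivity) (by positivity)]
        have h8 : 2 * (m : ℝ) = y - s := by rw [hs]; ring
        rw [h8]
        have hk : 4 * s * (2 * y - s) * y ≤ (8 * y + 5) * (y - s) := by
          have hy4 : 4 ≤ y - s := by linarith
          nlinarith [mul_nonneg hs0.le (sub_nonneg.2 hs1.le), mul_pos hs0 hy0,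
            mul_nonneg (sub_nonneg.2 hs1.le) (sub_nonneg.2 hy4),
            mul_nonneg (mul_nonneg (sub_nonneg.2 hs1.le) (sub_nonneg.2 hy4)) hy0.le,
            mul_nonneg (mul_nonneg hs0.le (sub_nonneg.2 hs1.le)) hy0.le]
        nlinarith [mul_le_mul_of_nonneg_right hk hy0.le]
    have e2 : 1 / (2 * y) + 5 / (16 * y ^ 2) = 1 / 2 * (1 / y + 5 / (8 * y ^ 2)) := by
      field_simp; ring
    rw [e2]
    linarith
  · have h4 : Real.log (2 * m) - Real.log y ≤ 2 * m / y - 1 := by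
      have := Real.log_le_sub_one_of_pos (x := 2 * m / y) (by positivity)
      rwa [Real.log_div (by positivity) hy0.ne'] at this
    have h5 : 2 * (m : ℝ) / y - 1 ≤ 1 / y := by
      rw [← sub_nonneg]
      have : 1 / y - (2 * (m : ℝ) / y - 1) = (1 + y - 2 * m) / y := by field_simp; ring
      rw [this]; apply div_nonneg <;> linarith
    have h6 : 1 / (24 * (m : ℝ) ^ 2) ≤ 5 / (16 * y ^ 2) := by
      rw [div_le_div_iff₀ (by positivity) (by positivity)]
      nlinarith
    have e2 : 1 / (2 * y) = 1 / 2 * (1 / y) := by field_simp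
    rw [e2]
    linarith

end SqfreeAverage


namespace SqfreeAverage

open Finset Filter Topology

/-! ### The constants of the main term -/

/-- `∑ log n / n²`. -/
noncomputable def logSqSum : ℝ := ∑' n : ℕ, Real.log n / (n : ℝ) ^ 2

theorem abscissa_lt_two {f : ℕ → ℂ} (h : LSeries.abscissaOfAbsConv f = 1) :
    LSeries.abscissaOfAbsConv f < ((2 : ℂ).re : EReal) := by
  rw [h]; norm_cast

theorem hasSum_of_LSeriesSummable {f : ℕ → ℝ} (hf : f 0 = 0) {g : ℕ → ℂ}
    (hg : ∀ n ≠ 0, g n = f n) (h : LSeriesSummable g 2) :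
    HasSum (fun n : ℕ => f n / (n : ℝ) ^ 2) (LSeries g 2).re := by
  have h1 := h.LSeriesHasSum
  unfold LSeriesHasSum at h1
  refine (Complex.hasSum_re h1).congr_fun fun n => ?_
  by_cases hn : n = 0
  · subst hn; simp [hf]
  · rw [LSeries.term_of_ne_zero hn, hg n hn]
    have : ((n : ℂ) ^ (2 : ℂ)) = (((n : ℝ) ^ 2 : ℝ) : ℂ) := by
      push_cast
      exact_mod_cast Complex.cpow_natCast (n : ℂ) 2
    rw [this, ← Complex.ofReal_div, Complex.ofReal_re]

open LSeries in
theorem LSeries_one_two : LSeries 1 2 = ((Real.pi ^ 2 / 6 : ℝ) : ℂ) := by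
  rw [LSeries_one_eq_riemannZeta (by norm_num), riemannZeta_two]; push_cast; rfl

theorem hasSum_log_div_sq :
    HasSum (fun n : ℕ => Real.log n / (n : ℝ) ^ 2) logSqSum := by
  have h := hasSum_of_LSeriesSummable (f := fun n => Real.log n) (by simp)
    (g := LSeries.logMul 1) (fun n hn => by simp [LSeries.logMul, Complex.natCast_log])
    (LSeriesSummable_logMul_of_lt_re (abscissa_lt_two LSeries.abscissaOfAbsConv_one))
  exact h.summable.hasSum

theorem deriv_LSeries_one_two : deriv (LSeries 1) 2 = ((-logSqSum : ℝ) : ℂ) := by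
  have h0 := abscissa_lt_two LSeries.abscissaOfAbsConv_one
  rw [LSeries_deriv h0]
  have h1 := (LSeriesSummable_logMul_of_lt_re h0).LSeriesHasSum
  unfold LSeriesHasSum at h1
  have h2 := (Complex.hasSum_ofReal (f := fun n : ℕ => Real.log n / (n : ℝ) ^ 2)).2
    hasSum_log_div_sq
  rw [h1.unique (h2.congr_fun fun n => ?_)]
  · push_cast; rfl
  · by_cases hn : n = 0
    · subst hn; simp
    · rw [LSeries.term_of_ne_zero hn]
      have : ((n : ℂ) ^ (2 : ℂ)) = (((n : ℝ) ^ 2 : ℝ) : ℂ) := by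
        push_cast
        exact_mod_cast Complex.cpow_natCast (n : ℂ) 2
      rw [this, LSeries.logMul, ← Complex.natCast_log]
      push_cast; simp

theorem LSeries_moebius_eq_inv {s : ℂ} (hs : 1 < s.re) :
    LSeries (fun n => (ArithmeticFunction.moebius n : ℂ)) s = (LSeries 1 s)⁻¹ :=
  eq_inv_of_mul_eq_one_right (LSeries_one_mul_Lseries_moebius hs)

theorem hasSum_moebius_div_sq :
    HasSum (fun n : ℕ => (ArithmeticFunction.moebius n : ℝ) / (n : ℝ) ^ 2) (6 / Real.pi ^ 2) := by
  have h := hasSum_of_LSeriesSummable (f := fun n => (ArithmeticFunction.moebius n : ℝ)) (by simp)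
    (g := fun n => (ArithmeticFunction.moebius n : ℂ)) (fun n hn => by push_cast; rfl)
    (ArithmeticFunction.LSeriesSummable_moebius_iff.2 (by norm_num))
  rw [LSeries_moebius_eq_inv (by norm_num), LSeries_one_two, ← Complex.ofReal_inv,
    Complex.ofReal_re, inv_div] at h
  exact h

/-- The series is `-(1/ζ)'(2) = ζ'(2)/ζ(2)²`, and `logSqSum = -ζ'(2)`. -/
theorem hasSum_moebius_mul_log_div_sq :
    HasSum (fun n : ℕ => (ArithmeticFunction.moebius n : ℝ) * Real.log n / (n : ℝ) ^ 2)
      (-(6 / Real.pi ^ 2) ^ 2 * logSqSum) := by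
  have h0 := abscissa_lt_two ArithmeticFunction.abscissaOfAbsConv_moebius
  have h := hasSum_of_LSeriesSummable
    (f := fun n => (ArithmeticFunction.moebius n : ℝ) * Real.log n) (by simp)
    (g := LSeries.logMul (fun n => (ArithmeticFunction.moebius n : ℂ)))
    (fun n hn => by simp [LSeries.logMul, Complex.natCast_log, mul_comm])
    (LSeriesSummable_logMul_of_lt_re h0)
  have h1 := LSeries_deriv h0
  have h2 : (LSeries fun n => (ArithmeticFunction.moebius n : ℂ)) =ᶠ[𝓝 2]
      fun s => (LSeries 1 s)⁻¹ := by
    refine Filter.eventuallyEq_iff_exists_mem.mpr ⟨{z | 1 < z.re},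
      (isOpen_lt continuous_const Complex.continuous_re).mem_nhds (by simp), ?_⟩
    exact fun s hs => LSeries_moebius_eq_inv hs
  have h3 := (LSeries_hasDerivAt (abscissa_lt_two LSeries.abscissaOfAbsConv_one))
  have h4 : LSeries 1 2 ≠ 0 := LSeries_one_ne_zero_of_one_lt_re (by norm_num)
  rw [h2.deriv_eq] at h1
  have h5 := (h3.differentiableAt.hasDerivAt.fun_inv h4).deriv
  rw [h5, deriv_LSeries_one_two, LSeries_one_two] at h1
  have h6 : LSeries (LSeries.logMul fun n => (ArithmeticFunction.moebius n : ℂ)) 2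
      = ((-(6 / Real.pi ^ 2) ^ 2 * logSqSum : ℝ) : ℂ) := by
    rw [← neg_eq_iff_eq_neg.2 h1]
    push_cast
    have : (Real.pi : ℂ) ≠ 0 := by exact_mod_cast Real.pi_ne_zero
    field_simp
    try ring
  rw [h6, Complex.ofReal_re] at h
  exact h

theorem hasSum_vonMangoldt_div_sq :
    HasSum (fun n : ℕ => ArithmeticFunction.vonMangoldt n / (n : ℝ) ^ 2)
      (6 / Real.pi ^ 2 * logSqSum) := by
  have h := hasSum_of_LSeriesSummable (f := fun n => ArithmeticFunction.vonMangoldt n) (by simp)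
    (g := fun n => (ArithmeticFunction.vonMangoldt n : ℂ)) (fun n hn => rfl)
    (ArithmeticFunction.LSeriesSummable_vonMangoldt (by norm_num))
  rw [ArithmeticFunction.LSeries_vonMangoldt_eq (by norm_num), deriv_LSeries_one_two,
    LSeries_one_two, ← Complex.ofReal_neg, ← Complex.ofReal_div, Complex.ofReal_re] at h
  have e : - -logSqSum / (Real.pi ^ 2 / 6) = 6 / Real.pi ^ 2 * logSqSum := by
    have := Real.pi_ne_zero
    field_simp
  rwa [e] at h

/-- Grouping the series of `Λ(n)/n²` by primes, the powers of `p` form a geometric series with sum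
`log p / (p² - 1)`; the total is `-ζ'(2)/ζ(2)`. -/
theorem tsum_prime_log_eq :
    ∑' p : Nat.Primes, 2 * Real.log (p : ℕ) / (((p : ℕ) : ℝ) ^ 2 - 1)
      = 2 * (6 / Real.pi ^ 2) * logSqSum := by
  have h0 := hasSum_vonMangoldt_div_sq
  set f : ℕ → ℝ := fun n => ArithmeticFunction.vonMangoldt n / (n : ℝ) ^ 2 with hf
  have hsupp : Function.support f ⊆ {n | IsPrimePow n} := by
    intro n hn
    by_contra hc
    apply hn
    have : ArithmeticFunction.vonMangoldt n = 0 :=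
      ArithmeticFunction.vonMangoldt_eq_zero_iff.2 hc
    simp [hf, this]
  have h1 := (hasSum_subtype_iff_of_support_subset hsupp).2 h0
  have h2 := (Nat.Primes.prodNatEquiv.hasSum_iff).2 h1
  have h3 : ∀ p : Nat.Primes, HasSum (fun k : ℕ => ((f ∘ Subtype.val) ∘
      Nat.Primes.prodNatEquiv) (p, k)) (Real.log (p : ℕ) / (((p : ℕ) : ℝ) ^ 2 - 1)) := by
    intro p
    have hp : (2 : ℝ) ≤ ((p : ℕ) : ℝ) := by exact_mod_cast p.2.two_le
    set x : ℝ := ((p : ℕ) : ℝ) with hx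
    have hx2 : 1 < x ^ 2 := by nlinarith
    have hg := (hasSum_geometric_of_lt_one (r := (x ^ 2)⁻¹) (by positivity)
      (inv_lt_one_of_one_lt₀ hx2)).mul_left (Real.log x * (x ^ 2)⁻¹)
    have e : Real.log x * (x ^ 2)⁻¹ * (1 - (x ^ 2)⁻¹)⁻¹ = Real.log x / (x ^ 2 - 1) := by
      have : x ^ 2 - 1 ≠ 0 := by linarith
      have hx0 : x ≠ 0 := by linarith
      have h5 : 1 - (x ^ 2)⁻¹ = (x ^ 2 - 1) / x ^ 2 := by field_simp
      rw [h5]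
      field_simp
    rw [e] at hg
    refine hg.congr_fun fun k => ?_
    simp only [Function.comp_apply, Nat.Primes.prodNatEquiv_apply, hf]
    rw [ArithmeticFunction.vonMangoldt_apply_pow (by omega),
      ArithmeticFunction.vonMangoldt_apply_prime p.2]
    push_cast
    rw [← hx, inv_pow, ← pow_mul, ← pow_mul]
    have hx0 : x ≠ 0 := by linarith
    field_simp
    try ring
  have h4 := (h2.prod_fiberwise h3).mul_left 2
  rw [mul_assoc, ← h4.tsum_eq]
  exact tsum_congr fun p => by ring

/-- The coefficient of the main term for `q = v`, `v ∈ {1, 2}`. -/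
noncomputable def beta (v : ℕ) : ℝ := (v : ℝ) / kappa 1 v * (6 / Real.pi ^ 2)

theorem kappa_one_arg (s : ℝ) : kappa s 1 = 1 := by simp [kappa]

theorem kappa_two_arg (s : ℝ) : kappa s 2 = 2 ^ s + 1 := by
  have : (2 : ℝ) ^ s ≠ 0 := by positivity
  simp only [kappa, Nat.Prime.primeFactors Nat.prime_two, Finset.prod_singleton]
  push_cast
  field_simp

theorem beta_one : beta 1 = 6 / Real.pi ^ 2 := by simp [beta, kappa_one_arg]

theorem beta_two : beta 2 = 2 / 3 * (6 / Real.pi ^ 2) := by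
  simp only [beta, kappa_two_arg]; norm_num

theorem bConst_one :
    bConst 1 = Real.eulerMascheroniConstant + 2 * (6 / Real.pi ^ 2) * logSqSum := by
  rw [bConst, tsum_prime_log_eq]; simp [add_comm]

theorem bConst_two : bConst 2 = bConst 1 + Real.log 2 / 3 := by
  simp only [bConst, Nat.Prime.primeFactors Nat.prime_two, Finset.sum_singleton,
    Nat.primeFactors_one, Finset.sum_empty]
  norm_num

/-- Split by parity: the even part of the Möbius series is `-b`, because `μ(2k) = -muCop 2 k`. -/
theorem tsum_moebius_mul {g : ℕ → ℝ} {a : ℝ}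
    (h : HasSum (fun n => (ArithmeticFunction.moebius n : ℝ) * g n) a)
    {b : ℝ} (h2 : HasSum (fun n => muCop 2 n * g (2 * n)) b) :
    HasSum (fun n => muCop 2 n * g n) (a + b) := by
  have h3 : ∀ n, muCop 2 (2 * n) = 0 := fun n => by
    rw [muCop_two, moebiusOdd, if_neg (by omega)]; simp
  have he : HasSum (fun k => (ArithmeticFunction.moebius (2 * k) : ℝ) * g (2 * k)) (-b) := by
    refine h2.neg.congr_fun fun n => ?_
    rw [moebius_two_mul, muCop_two]; push_cast; ring
  have ho : Summable fun k => (ArithmeticFunction.moebius (2 * k + 1) : ℝ) * g (2 * k + 1) :=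
    h.summable.comp_injective (i := fun k => 2 * k + 1) (fun a b hab => by simpa using hab)
  have h4 := (he.even_add_odd (f := fun n => (ArithmeticFunction.moebius n : ℝ) * g n)
    ho.hasSum).unique h
  have h5 : HasSum (fun k => muCop 2 (2 * k + 1) * g (2 * k + 1)) (a + b) := by
    have : a + b = ∑' k, (ArithmeticFunction.moebius (2 * k + 1) : ℝ) * g (2 * k + 1) := by
      linarith
    rw [this]
    refine ho.hasSum.congr_fun fun k => ?_
    rw [muCop_two, moebiusOdd, if_pos (by omega)]
  have h6 : HasSum (fun k => muCop 2 (2 * k) * g (2 * k)) 0 := by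
    simp only [h3, zero_mul]; exact hasSum_zero
  simpa using h6.even_add_odd (f := fun n => muCop 2 n * g n) h5

theorem summable_muCop_mul (v : ℕ) {g : ℕ → ℝ}
    (h : Summable (fun n => (ArithmeticFunction.moebius n : ℝ) * g n)) :
    Summable fun n => muCop v n * g n := by
  refine (h.abs).of_norm_bounded fun n => ?_
  rw [Real.norm_eq_abs, abs_mul, abs_mul]
  refine mul_le_mul_of_nonneg_right ?_ (abs_nonneg _)
  unfold muCop
  split_ifs
  · exact le_rfl
  · simp

/-- Since `g(2n) = g(n)/4`, the unknown sum satisfies `A = 6/π² + A/4`. The logarithmic series below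
is found in the same way. -/
theorem hasSum_muCop_two_div_sq :
    HasSum (fun n : ℕ => muCop 2 n * (1 / (n : ℝ) ^ 2)) (4 / 3 * (6 / Real.pi ^ 2)) := by
  have h := hasSum_moebius_div_sq.congr_fun
    (g := fun n : ℕ => (ArithmeticFunction.moebius n : ℝ) * (1 / (n : ℝ) ^ 2))
    (fun n => by ring)
  have hs := (summable_muCop_mul 2 h.summable).hasSum
  set A := ∑' n : ℕ, muCop 2 n * (1 / (n : ℝ) ^ 2)
  have h2 : HasSum (fun n : ℕ => muCop 2 n * (1 / ((2 * n : ℕ) : ℝ) ^ 2)) (1 / 4 * A) := by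
    refine (hs.mul_left (1 / 4)).congr_fun fun n => ?_
    push_cast
    rw [mul_pow, ← one_div_mul_one_div]; ring
  have h3 := (tsum_moebius_mul h h2).unique hs
  have : A = 4 / 3 * (6 / Real.pi ^ 2) := by linarith
  rwa [this] at hs

theorem hasSum_muCop_two_mul_log_div_sq :
    HasSum (fun n : ℕ => muCop 2 n * (Real.log n / (n : ℝ) ^ 2))
      (4 / 3 * (-(6 / Real.pi ^ 2) ^ 2 * logSqSum + Real.log 2 / 3 * (6 / Real.pi ^ 2))) := by
  have h := hasSum_moebius_mul_log_div_sq.congr_fun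
    (g := fun n : ℕ => (ArithmeticFunction.moebius n : ℝ) * (Real.log n / (n : ℝ) ^ 2))
    (fun n => by ring)
  have hs := (summable_muCop_mul 2 h.summable).hasSum
  set A := ∑' n : ℕ, muCop 2 n * (Real.log n / (n : ℝ) ^ 2)
  have h2 : HasSum (fun n : ℕ => muCop 2 n * (Real.log (2 * n : ℕ) / ((2 * n : ℕ) : ℝ) ^ 2))
      (1 / 4 * A + Real.log 2 / 4 * (4 / 3 * (6 / Real.pi ^ 2))) := by
    refine ((hs.mul_left (1 / 4)).add
      (hasSum_muCop_two_div_sq.mul_left (Real.log 2 / 4))).congr_fun fun n => ?_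
    by_cases hn : n = 0
    · subst hn; simp
    · have : (n : ℝ) ≠ 0 := by exact_mod_cast hn
      push_cast
      rw [Real.log_mul (by norm_num) this]
      field_simp
      ring
  have h3 := (tsum_moebius_mul h h2).unique hs
  have : A = 4 / 3 * (-(6 / Real.pi ^ 2) ^ 2 * logSqSum + Real.log 2 / 3 * (6 / Real.pi ^ 2)) := by
    linarith
  rwa [this] at hs

end SqfreeAverage


namespace SqfreeAverage

open Finset Filter Topology

/-! ### Convolution identity for the squarefree indicator -/

theorem dvd_of_sq_dvd_sq_mul {a b d : ℕ} (ha : Squarefree a) (hb : 0 < b)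
    (h : d ^ 2 ∣ b ^ 2 * a) : d ∣ b := by
  have hg : 0 < Nat.gcd d b := Nat.gcd_pos_of_pos_right _ hb
  obtain ⟨d', hd'⟩ := Nat.gcd_dvd_left d b
  obtain ⟨b', hb'⟩ := Nat.gcd_dvd_right d b
  have hc : Nat.Coprime d' b' := by
    have h1 := Nat.coprime_div_gcd_div_gcd hg
    have e1 : d / Nat.gcd d b = d' := Nat.div_eq_of_eq_mul_right hg hd'
    have e2 : b / Nat.gcd d b = b' := Nat.div_eq_of_eq_mul_right hg hb'
    rwa [e1, e2] at h1
  have h2 : d' ^ 2 ∣ b' ^ 2 * a := by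
    have h3 : Nat.gcd d b ^ 2 * d' ^ 2 ∣ Nat.gcd d b ^ 2 * (b' ^ 2 * a) := by
      have e1 : Nat.gcd d b ^ 2 * d' ^ 2 = d ^ 2 := by rw [← mul_pow, ← hd']
      have e2 : Nat.gcd d b ^ 2 * (b' ^ 2 * a) = b ^ 2 * a := by
        rw [← mul_assoc, ← mul_pow, ← hb']
      rwa [e1, e2]
    exact Nat.dvd_of_mul_dvd_mul_left (by positivity) h3
  have h4 : d' ^ 2 ∣ a := (Nat.Coprime.pow 2 2 hc).dvd_of_dvd_mul_left h2
  have h5 : d' = 1 := Nat.isUnit_iff.1 (ha d' (by rwa [sq] at h4))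
  rw [h5, mul_one] at hd'
  rw [hd']; exact Nat.gcd_dvd_right d b

/-- Write `l = b² a` with `a` squarefree. Then `d² ∣ l` exactly when `d ∣ b`, so the sum is `1` if
`b = 1` and `0` otherwise. -/
theorem sum_moebius_sq_dvd {l N : ℕ} (hl : 0 < l) (hN : l < (N + 1) ^ 2) :
    ∑ d ∈ Icc 1 N, (if d ^ 2 ∣ l then ArithmeticFunction.moebius d else 0)
      = ArithmeticFunction.moebius l ^ 2 := by
  obtain ⟨a, b, ha, hb, hab, has⟩ := Nat.sq_mul_squarefree_of_pos hl
  have h1 : ∑ d ∈ Icc 1 N, (if d ^ 2 ∣ l then ArithmeticFunction.moebius d else 0)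
      = ∑ d ∈ b.divisors, ArithmeticFunction.moebius d := by
    rw [← Finset.sum_filter]
    apply Finset.sum_congr _ (fun _ _ => rfl)
    ext d
    simp only [mem_filter, mem_Icc, Nat.mem_divisors]
    constructor
    · rintro ⟨_, h⟩
      exact ⟨dvd_of_sq_dvd_sq_mul has hb (by rwa [hab]), hb.ne'⟩
    · rintro ⟨h, _⟩
      have h2 : d ^ 2 ∣ l := by
        rw [← hab]; exact Dvd.dvd.mul_right (pow_dvd_pow_of_dvd h 2) a
      refine ⟨⟨Nat.pos_of_dvd_of_pos h hb, ?_⟩, h2⟩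
      have h3 := Nat.le_of_dvd hl h2
      have : d < N + 1 := lt_of_pow_lt_pow_left₀ 2 (by omega) (by omega)
      omega
  have h3 := congrArg (fun f => f b) ArithmeticFunction.moebius_mul_coe_zeta
  simp only [ArithmeticFunction.coe_mul_zeta_apply, ArithmeticFunction.one_apply] at h3
  rw [h1, h3, ArithmeticFunction.moebius_sq]
  congr 1
  apply propext
  constructor
  · intro h; rw [h] at hab; rw [← hab]; simpa using has
  · intro h
    have : b * b ∣ l := by rw [← hab, sq]; exact dvd_mul_right _ _
    exact Nat.isUnit_iff.1 (h b this)

theorem sum_sqfree_eq {f : ℕ → ℝ} (hf : ∀ m n, f (m * n) = f m * f n) (v : ℕ) {X : ℝ}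
    (hX : 0 < X) {N : ℕ} (hN : X < ((N : ℝ) + 1) ^ 2) :
    ∑ l ∈ (Icc 1 ⌊X⌋₊).filter (fun l => Nat.Coprime l v),
        (ArithmeticFunction.moebius l : ℝ) ^ 2 * f l
      = ∑ d ∈ Icc 1 N, muCop v d * f (d ^ 2) *
          ∑ m ∈ (Icc 1 ⌊X / (d : ℝ) ^ 2⌋₊).filter (fun m => Nat.Coprime m v), f m := by
  have h1 : ∀ l ∈ (Icc 1 ⌊X⌋₊).filter (fun l => Nat.Coprime l v),
      (ArithmeticFunction.moebius l : ℝ) ^ 2 * f l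
        = ∑ d ∈ Icc 1 N, if d ^ 2 ∣ l then (ArithmeticFunction.moebius d : ℝ) * f l else 0 := by
    intro l hl
    rw [mem_filter, mem_Icc] at hl
    have hlX : (l : ℝ) ≤ X := (Nat.le_floor_iff hX.le).1 hl.1.2
    have h2 : l < (N + 1) ^ 2 := by
      have : (l : ℝ) < ((N : ℝ) + 1) ^ 2 := by linarith
      exact_mod_cast this
    have h3 := sum_moebius_sq_dvd (by omega) h2
    have h4 : (ArithmeticFunction.moebius l : ℝ) ^ 2
        = ∑ d ∈ Icc 1 N, if d ^ 2 ∣ l then (ArithmeticFunction.moebius d : ℝ) else 0 := by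
      have := congrArg (fun z : ℤ => (z : ℝ)) h3
      push_cast at this
      rw [← this]
    rw [h4, Finset.sum_mul]
    exact Finset.sum_congr rfl fun d _ => by rw [ite_mul, zero_mul]
  rw [Finset.sum_congr rfl h1, Finset.sum_comm]
  refine Finset.sum_congr rfl fun d hd => ?_
  rw [mem_Icc] at hd
  have hd0 : (0 : ℝ) < (d : ℝ) ^ 2 := by
    have : (0 : ℝ) < d := by exact_mod_cast hd.1
    positivity
  rw [← Finset.sum_filter, Finset.mul_sum]
  by_cases hv : d.Coprime v
  · rw [muCop, if_pos hv]
    symm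
    refine Finset.sum_bij (fun m _ => d ^ 2 * m) ?_ ?_ ?_ ?_
    · intro m hm
      rw [mem_filter, mem_Icc] at hm
      rw [mem_filter, mem_filter, mem_Icc]
      refine ⟨⟨⟨?_, ?_⟩, ?_⟩, dvd_mul_right _ _⟩
      · have : 0 < d ^ 2 * m := Nat.mul_pos (pow_pos (by omega) 2) (by omega)
        omega
      · rw [Nat.le_floor_iff hX.le]
        have := (Nat.le_floor_iff (by positivity)).1 hm.1.2
        rw [le_div_iff₀ hd0] at this
        push_cast; linarith
      · exact Nat.Coprime.mul_left (Nat.Coprime.pow_left 2 hv) hm.2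
    · intro m _ m' _ h
      exact Nat.eq_of_mul_eq_mul_left (pow_pos (by omega) 2) h
    · intro l hl
      rw [mem_filter, mem_filter, mem_Icc] at hl
      obtain ⟨m, rfl⟩ := hl.2
      refine ⟨m, ?_, rfl⟩
      rw [mem_filter, mem_Icc]
      refine ⟨⟨?_, ?_⟩, Nat.Coprime.coprime_mul_left hl.1.2⟩
      · by_contra hc
        have : m = 0 := by omega
        rw [this] at hl; simp at hl
      · rw [Nat.le_floor_iff (by positivity), le_div_iff₀ hd0]
        have := (Nat.le_floor_iff hX.le).1 hl.1.1.2
        push_cast at this; linarith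
    · intro m _
      rw [hf]; ring
  · rw [muCop, if_neg hv]
    simp only [zero_mul, Finset.sum_const_zero]
    apply Finset.sum_eq_zero
    intro l hl
    rw [mem_filter, mem_filter] at hl
    exfalso
    apply hv
    have : Nat.Coprime (d ^ 2) v := Nat.Coprime.coprime_dvd_left hl.2 hl.1.2
    exact (Nat.coprime_pow_left_iff (by norm_num) _ _).1 this

/-- The remainder of the sum of `μ²(l) / l`. -/
noncomputable def sqfreeRem (v : ℕ) (X : ℝ) : ℝ :=
  sqfreeSum 1 v X - beta v * (Real.log X + bConst v)

theorem sqfreeSum_one_eq (v : ℕ) {X : ℝ} (hX : 0 < X) {N : ℕ} (hN : X < ((N : ℝ) + 1) ^ 2) :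
    sqfreeSum 1 v X
      = ∑ d ∈ Icc 1 N, muCop v d / (d : ℝ) ^ 2 * harmCop v (X / (d : ℝ) ^ 2) := by
  have h := sum_sqfree_eq (f := fun n => 1 / (n : ℝ)) (fun m n => by push_cast; field_simp) v hX hN
  rw [sqfreeSum]
  simp only [Real.rpow_one, div_eq_mul_inv, one_mul, Nat.cast_pow] at h ⊢
  rw [h]
  simp only [harmCop, div_eq_mul_inv, one_mul]

/-- The leading coefficient of the harmonic sum over integers coprime to `v`, `v ∈ {1, 2}`. -/
noncomputable def harmLead (v : ℕ) : ℝ := if v = 1 then 1 else 1 / 2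

/-- The constant term of the harmonic sum over integers coprime to `v`, `v ∈ {1, 2}`. -/
noncomputable def harmConst (v : ℕ) : ℝ :=
  if v = 1 then Real.eulerMascheroniConstant else (Real.eulerMascheroniConstant + Real.log 2) / 2

/-- The error of the harmonic sum over integers coprime to `v`, `v ∈ {1, 2}`. -/
noncomputable def harmErr (v : ℕ) (y : ℝ) : ℝ :=
  harmCop v y - harmLead v * Real.log y - harmConst v

/-- The reason for the exact shape of `bConst`: the asymptotic parts of the harmonic sums, summed
over all `d`, reproduce the main term without any error. -/
theorem hasSum_muCop_mul_sub_log {v : ℕ} (hv : v = 1 ∨ v = 2) (X : ℝ) (hX : 0 < X) :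
    HasSum (fun d : ℕ => muCop v d / (d : ℝ) ^ 2 *
      (harmLead v * Real.log (X / (d : ℝ) ^ 2) + harmConst v))
      (beta v * (Real.log X + bConst v)) := by
  have key : ∀ A B : ℝ, HasSum (fun n : ℕ => muCop v n * (1 / (n : ℝ) ^ 2)) A →
      HasSum (fun n : ℕ => muCop v n * (Real.log n / (n : ℝ) ^ 2)) B →
      HasSum (fun d : ℕ => muCop v d / (d : ℝ) ^ 2 *
      (harmLead v * Real.log (X / (d : ℝ) ^ 2) + harmConst v))
        ((harmLead v * Real.log X + harmConst v) * A + -2 * harmLead v * B) := by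
    intro A B hA hB
    refine ((hA.mul_left (harmLead v * Real.log X + harmConst v)).add
      (hB.mul_left (-2 * harmLead v))).congr_fun fun n => ?_
    by_cases hn : n = 0
    · subst hn; simp
    · have : (n : ℝ) ≠ 0 := by exact_mod_cast hn
      rw [Real.log_div hX.ne' (by positivity), Real.log_pow]
      push_cast; ring
  rcases hv with rfl | rfl
  · have h := key _ _ (hasSum_moebius_div_sq.congr_fun fun n => by rw [muCop_one]; ring)
      (hasSum_moebius_mul_log_div_sq.congr_fun fun n => by rw [muCop_one]; ring)
    have e : (harmLead 1 * Real.log X + harmConst 1) * (6 / Real.pi ^ 2)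
        + -2 * harmLead 1 * (-(6 / Real.pi ^ 2) ^ 2 * logSqSum)
        = beta 1 * (Real.log X + bConst 1) := by
      rw [beta_one, bConst_one, harmLead, harmConst, if_pos rfl, if_pos rfl]; ring
    rwa [e] at h
  · have h := key _ _ hasSum_muCop_two_div_sq hasSum_muCop_two_mul_log_div_sq
    have e : (harmLead 2 * Real.log X + harmConst 2) * (4 / 3 * (6 / Real.pi ^ 2))
        + -2 * harmLead 2 * (4 / 3 * (-(6 / Real.pi ^ 2) ^ 2 * logSqSum
          + Real.log 2 / 3 * (6 / Real.pi ^ 2)))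
        = beta 2 * (Real.log X + bConst 2) := by
      rw [beta_two, bConst_two, bConst_one, harmLead, harmConst, if_neg (by norm_num),
        if_neg (by norm_num)]; ring
    rwa [e] at h

theorem harmCop_eq_zero {v : ℕ} {y : ℝ} (hy : y < 1) : harmCop v y = 0 := by
  rw [harmCop, Nat.floor_eq_zero.2 hy]; simp

/-- For `d > √X` the harmonic sum is empty but its asymptotic part is not, so the terms do not stop
and the remainder is only a limit of partial sums. -/
theorem tendsto_sum_harmErr {v : ℕ} (hv : v = 1 ∨ v = 2) {X : ℝ} (hX : 0 < X) :
    Tendsto (fun N : ℕ => ∑ d ∈ Icc 1 N, muCop v d / (d : ℝ) ^ 2 * harmErr v (X / (d : ℝ) ^ 2))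
      atTop (𝓝 (sqfreeRem v X)) := by
  have h1 := (hasSum_muCop_mul_sub_log hv X hX).tendsto_sum_nat.comp (tendsto_add_atTop_nat 1)
  have h2 := (tendsto_const_nhds (x := sqfreeSum 1 v X) (f := (atTop : Filter ℕ))).sub h1
  refine h2.congr' ?_
  filter_upwards [eventually_ge_atTop (⌈X⌉₊ + 1)] with N hN
  have hXN : X ≤ N := (Nat.le_ceil X).trans (by exact_mod_cast (by omega : ⌈X⌉₊ ≤ N))
  rw [sqfreeSum_one_eq v hX (N := N) (by nlinarith)]
  simp only [Function.comp_apply]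
  rw [Finset.range_eq_Ico, show Ico 0 (N + 1) = Icc 0 N from rfl,
    sum_Icc_zero_eq (by simp), ← Finset.sum_sub_distrib]
  refine Finset.sum_congr rfl fun d _ => ?_
  rw [harmErr]; ring

end SqfreeAverage


namespace SqfreeAverage

open Finset Filter Topology MeasureTheory

/-! ### Summation by parts against the Möbius function -/

/-- The weight `(P + 2 a log t) / t²`. -/
noncomputable def logWeight (a P t : ℝ) : ℝ := (P + 2 * a * Real.log t) / t ^ 2

/-- An antiderivative of `t` times the derivative of `logWeight a P`. -/
noncomputable def logPrim (a P t : ℝ) : ℝ := (4 * a * Real.log t + 2 * a + 2 * P) / t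

theorem hasDerivAt_logWeight (a P : ℝ) {t : ℝ} (ht : 0 < t) :
    HasDerivAt (logWeight a P) ((2 * a - 2 * P - 4 * a * Real.log t) / t ^ 3) t := by
  have h1 : HasDerivAt (fun t => P + 2 * a * Real.log t) (2 * a * t⁻¹) t :=
    ((Real.hasDerivAt_log ht.ne').const_mul (2 * a)).const_add P
  have h2 := h1.fun_div (hasDerivAt_pow 2 t) (by positivity)
  convert! h2 using 1
  push_cast
  field_simp
  ring

theorem hasDerivAt_logPrim (a P : ℝ) {t : ℝ} (ht : 0 < t) :
    HasDerivAt (logPrim a P) (t * ((2 * a - 2 * P - 4 * a * Real.log t) / t ^ 3)) t := by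
  have h1 : HasDerivAt (fun t => 4 * a * Real.log t + 2 * a + 2 * P) (4 * a * t⁻¹) t :=
    (((Real.hasDerivAt_log ht.ne').const_mul (4 * a)).add_const (2 * a)).add_const (2 * P)
  have h2 := h1.fun_div (hasDerivAt_id' t) ht.ne'
  convert! h2 using 1
  field_simp
  ring

/-- Abel summation on an interval where the derivative of the weight has the constant sign `σ`. The
integral of `ε t` times its absolute value is then evaluated exactly by `logPrim`. Boundary terms
are kept aside so that they can cancel between adjacent intervals. -/
theorem abs_sum_logWeight_sub_le (v : ℕ) {a P A B ε σ : ℝ} (hA : 0 < A) (hAB : A ≤ B)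
    (hM : ∀ t, A ≤ t → |mertens v t| ≤ ε * t)
    (hσ : |σ| = 1)
    (hs : ∀ t ∈ Set.Icc A B, 0 ≤ σ * (2 * a - 2 * P - 4 * a * Real.log t)) :
    |∑ d ∈ Ioc ⌊A⌋₊ ⌊B⌋₊, logWeight a P d * muCop v d
        - (logWeight a P B * mertens v B - logWeight a P A * mertens v A)|
      ≤ ε * (σ * (logPrim a P B - logPrim a P A)) := by
  have hd : ∀ t ∈ Set.Icc A B, HasDerivAt (logWeight a P)
      ((2 * a - 2 * P - 4 * a * Real.log t) / t ^ 3) t := fun t ht =>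
    hasDerivAt_logWeight a P (hA.trans_le ht.1)
  have hc : ContinuousOn (fun t : ℝ => (2 * a - 2 * P - 4 * a * Real.log t) / t ^ 3)
      (Set.Icc A B) := by
    intro t ht
    have ht0 : 0 < t := hA.trans_le ht.1
    have h1 : ContinuousAt Real.log t := Real.continuousAt_log ht0.ne'
    exact (ContinuousAt.div (by fun_prop) (by fun_prop) (by positivity)).continuousWithinAt
  have hint : IntegrableOn (deriv (logWeight a P)) (Set.Icc A B) := by
    refine (hc.integrableOn_Icc).congr_fun (fun t ht => ((hd t ht).deriv).symm) measurableSet_Icc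
  have habel := sum_mul_eq_sub_sub_integral_mul (muCop v) (f := logWeight a P) hA.le hAB
    (fun t ht => (hd t ht).differentiableAt) hint
  rw [habel]
  have e1 : logWeight a P B * ∑ k ∈ Icc 0 ⌊B⌋₊, muCop v k
      - logWeight a P A * ∑ k ∈ Icc 0 ⌊A⌋₊, muCop v k
      - (∫ t in Set.Ioc A B, deriv (logWeight a P) t * ∑ k ∈ Icc 0 ⌊t⌋₊, muCop v k)
      - (logWeight a P B * mertens v B - logWeight a P A * mertens v A)
      = -∫ t in Set.Ioc A B, deriv (logWeight a P) t * ∑ k ∈ Icc 0 ⌊t⌋₊, muCop v k := by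
    unfold mertens; ring
  rw [e1, abs_neg, ← Real.norm_eq_abs]
  have hc2 : ContinuousOn (fun t : ℝ => ε * (σ * (t * ((2 * a - 2 * P - 4 * a * Real.log t)
      / t ^ 3)))) (Set.Icc A B) :=
    continuousOn_const.mul (continuousOn_const.mul (continuousOn_id.mul hc))
  have hi2 := (hc2.integrableOn_Icc (μ := volume)).mono_set (Set.Ioc_subset_Icc_self)
  refine (norm_integral_le_of_norm_le hi2 ?_).trans ?_
  · refine (ae_restrict_iff' measurableSet_Ioc).2 (Eventually.of_forall fun t ht => ?_)
    have ht' := Set.Ioc_subset_Icc_self ht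
    have ht0 : 0 < t := hA.trans ht.1
    rw [(hd t ht').deriv, norm_mul, Real.norm_eq_abs, Real.norm_eq_abs]
    have h1 := hM t ht'.1
    unfold mertens at h1
    have h2 : |(2 * a - 2 * P - 4 * a * Real.log t) / t ^ 3|
        = σ * ((2 * a - 2 * P - 4 * a * Real.log t) / t ^ 3) := by
      have h3 : 0 ≤ σ * ((2 * a - 2 * P - 4 * a * Real.log t) / t ^ 3) := by
        rw [← mul_div_assoc]; exact div_nonneg (hs t ht') (by positivity)
      rw [← abs_of_nonneg h3, abs_mul, hσ, one_mul]
    rw [h2]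
    have h3 : 0 ≤ σ * ((2 * a - 2 * P - 4 * a * Real.log t) / t ^ 3) := by
      rw [← h2]; exact abs_nonneg _
    calc _ ≤ σ * ((2 * a - 2 * P - 4 * a * Real.log t) / t ^ 3) * (ε * t) :=
          mul_le_mul_of_nonneg_left h1 h3
      _ = _ := by ring
  · rw [← intervalIntegral.integral_of_le hAB, intervalIntegral.integral_const_mul,
      intervalIntegral.integral_const_mul,
      intervalIntegral.integral_eq_sub_of_hasDerivAt (f := logPrim a P)]
    · intro t ht
      rw [Set.uIcc_of_le hAB] at ht
      exact hasDerivAt_logPrim a P (hA.trans_le ht.1)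
    · rw [intervalIntegrable_iff_integrableOn_Icc_of_le hAB]
      exact (continuousOn_id.mul hc).integrableOn_Icc

/-- The coefficient of the bound for the contribution of the large divisors. -/
noncomputable def tailCoeff (v : ℕ) (w : ℝ) : ℝ :=
  √w * (3 * harmConst v + 3 * harmLead v * Real.log w - 3 - 2 * harmLead v) + 3
    + 8 * harmLead v * Real.exp (-(harmLead v + harmConst v) / (2 * harmLead v))

theorem harmLead_pos (v : ℕ) : 0 < harmLead v := by unfold harmLead; split_ifs <;> norm_num

/-- For `X / d² < w` the harmonic sum is `1` if `d ≤ √X` and `0` beyond, so the summand is a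
`logWeight` whose constant `P` drops by `1` at `√X`. -/
theorem abs_sum_harmErr_large_le {v : ℕ} {w ε X : ℝ} (hw : 1 ≤ w) (hε : 0 ≤ ε)
    (hX : 0 < X) (hM : ∀ t, √X / √w ≤ t → |mertens v t| ≤ ε * t)
    (hone : ∀ y, 1 ≤ y → y < w → harmCop v y = 1)
    (hc1 : 1 ≤ harmLead v + harmConst v)
    (hc2 : 1 ≤ harmConst v + harmLead v * Real.log w) :
    ∀ᶠ N : ℕ in atTop, |∑ d ∈ Ioc ⌊√X / √w⌋₊ N, muCop v d / (d : ℝ) ^ 2 *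
      harmErr v (X / (d : ℝ) ^ 2)| ≤ ε * (tailCoeff v w / √X) := by
  set a := harmLead v with ha
  set c := harmConst v with hc
  have ha0 : 0 < a := harmLead_pos v
  set D := √X with hD
  have hD0 : 0 < D := Real.sqrt_pos.2 hX
  have hw0 : 0 < √w := Real.sqrt_pos.2 (by linarith)
  have hw1 : 1 ≤ √w := Real.one_le_sqrt.2 hw
  have hDX : D ^ 2 = X := Real.sq_sqrt hX.le
  have hww : √w ^ 2 = w := Real.sq_sqrt (by linarith)
  have hlD : Real.log X = 2 * Real.log D := by rw [← hDX, Real.log_pow]; push_cast; ring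
  set z := D / √w with hz
  have hz0 : 0 < z := by positivity
  have hzD : z ≤ D := div_le_self hD0.le hw1
  have hlz : Real.log z = Real.log D - Real.log w / 2 := by
    rw [hz, Real.log_div hD0.ne' hw0.ne', Real.log_sqrt (x := w) (by linarith)]
  set P0 := -c - a * Real.log X with hP0
  set P1 := 1 - c - a * Real.log X with hP1
  -- The zero of the derivative of the weight with constant `P0`; the ranges `(z, D]`, `(D, T]` and
  -- `(T, N]` therefore each have a constant sign.
  set T := D * Real.exp ((a + c) / (2 * a)) with hT
  have hT0 : 0 < T := by positivity
  have hDT : D ≤ T := by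
    rw [hT]; exact le_mul_of_one_le_right hD0.le (Real.one_le_exp (by positivity))
  have hlT : Real.log T = Real.log D + (a + c) / (2 * a) := by
    rw [hT, Real.log_mul hD0.ne' (Real.exp_pos _).ne', Real.log_exp]
  have hlT' : 2 * a * Real.log T = 2 * a * Real.log D + (a + c) := by
    rw [hlT]; field_simp
  -- the three ranges
  have r1 := abs_sum_logWeight_sub_le v (a := a) (P := P1) (A := z) (B := D) (σ := 1) hz0 hzD hM
    (by simp) (by
      intro t ht
      have h1 : Real.log t ≤ Real.log D := Real.log_le_log (hz0.trans_le ht.1) ht.2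
      rw [hP1, hlD]
      nlinarith)
  have r2 := abs_sum_logWeight_sub_le v (a := a) (P := P0) (A := D) (B := T) (σ := 1) hD0 hDT
    (fun t ht => hM t (hzD.trans ht)) (by simp) (by
      intro t ht
      have h1 : Real.log t ≤ Real.log T := Real.log_le_log (hD0.trans_le ht.1) ht.2
      rw [hP0, hlD]
      nlinarith)
  -- eventual inequality at the upper end
  have hev : ∀ᶠ N : ℕ in atTop, T ≤ (N : ℝ) ∧ 0 ≤ P0 + 2 * a * Real.log N ∧
      0 ≤ 2 * a * Real.log N + 2 * a + P0 := by
    have t1 : Tendsto (fun N : ℕ => (N : ℝ)) atTop atTop := tendsto_natCast_atTop_atTop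
    have t2 : Tendsto (fun N : ℕ => P0 + 2 * a * Real.log N) atTop atTop :=
      tendsto_atTop_add_const_left _ _
        ((Real.tendsto_log_atTop.comp t1).const_mul_atTop (by positivity))
    filter_upwards [t1.eventually_ge_atTop T, t2.eventually_ge_atTop 0] with N h1 h2
    exact ⟨h1, h2, by linarith⟩
  filter_upwards [hev] with N ⟨hN1, hN2, hN3⟩
  have r3 := abs_sum_logWeight_sub_le v (a := a) (P := P0) (A := T) (B := N) (σ := -1) hT0 hN1
    (fun t ht => hM t (hzD.trans (hDT.trans ht))) (by simp) (by
      intro t ht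
      have h1 : Real.log T ≤ Real.log t := Real.log_le_log hT0 ht.1
      rw [hP0, hlD]
      nlinarith)
  rw [Nat.floor_natCast] at r3
  -- the sums
  have hN0 : (0 : ℝ) < N := hT0.trans_le hN1
  have f1 : ⌊z⌋₊ ≤ ⌊D⌋₊ := Nat.floor_le_floor hzD
  have f2 : ⌊D⌋₊ ≤ ⌊T⌋₊ := Nat.floor_le_floor hDT
  have f3 : ⌊T⌋₊ ≤ N := by
    have := Nat.floor_le_floor hN1; rwa [Nat.floor_natCast] at this
  have hsplit : ∑ d ∈ Ioc ⌊z⌋₊ N, muCop v d / (d : ℝ) ^ 2 * harmErr v (X / (d : ℝ) ^ 2)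
      = ∑ d ∈ Ioc ⌊z⌋₊ ⌊D⌋₊, logWeight a P1 d * muCop v d
        + ∑ d ∈ Ioc ⌊D⌋₊ ⌊T⌋₊, logWeight a P0 d * muCop v d
        + ∑ d ∈ Ioc ⌊T⌋₊ N, logWeight a P0 d * muCop v d := by
    have e2 : ∀ d : ℕ, D < d → muCop v d / (d : ℝ) ^ 2 * harmErr v (X / (d : ℝ) ^ 2)
        = logWeight a P0 d * muCop v d := by
      intro d hd
      have hd0 : (0 : ℝ) < d := hD0.trans hd
      have : X / (d : ℝ) ^ 2 < 1 := by
        rw [div_lt_one (by positivity), ← hDX]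
        exact pow_lt_pow_left₀ hd hD0.le (by norm_num)
      rw [harmErr, harmCop_eq_zero this, Real.log_div hX.ne' (by positivity), Real.log_pow,
        logWeight, hP0]
      push_cast; ring
    have e1 : ∀ d ∈ Ioc ⌊z⌋₊ ⌊D⌋₊, muCop v d / (d : ℝ) ^ 2 * harmErr v (X / (d : ℝ) ^ 2)
        = logWeight a P1 d * muCop v d := by
      intro d hd
      rw [mem_Ioc] at hd
      have hzd : z < d := (Nat.floor_lt hz0.le).1 hd.1
      have hdD : (d : ℝ) ≤ D := (Nat.le_floor_iff hD0.le).1 hd.2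
      have hd0 : (0 : ℝ) < d := hz0.trans hzd
      have h1 : 1 ≤ X / (d : ℝ) ^ 2 := by
        rw [one_le_div (by positivity), ← hDX]
        exact pow_le_pow_left₀ hd0.le hdD 2
      have h2 : X / (d : ℝ) ^ 2 < w := by
        rw [div_lt_iff₀ (by positivity), ← hDX]
        have h3 : D < √w * d := by
          rw [hz, div_lt_iff₀ hw0] at hzd; linarith
        have h4 := pow_lt_pow_left₀ h3 hD0.le (n := 2) (by norm_num)
        rwa [mul_pow, hww] at h4
      rw [harmErr, hone _ h1 h2, Real.log_div hX.ne' (by positivity), Real.log_pow,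
        logWeight, hP1]
      push_cast; ring
    rw [← Finset.sum_Ioc_consecutive _ (f1.trans f2) f3, ← Finset.sum_Ioc_consecutive _ f1 f2]
    congr 1
    · congr 1
      · exact Finset.sum_congr rfl e1
      · refine Finset.sum_congr rfl fun d hd => e2 d ?_
        rw [mem_Ioc] at hd
        exact (Nat.floor_lt hD0.le).1 hd.1
    · refine Finset.sum_congr rfl fun d hd => e2 d ?_
      rw [mem_Ioc] at hd
      exact hDT.trans_lt ((Nat.floor_lt hT0.le).1 hd.1)
  rw [hsplit]
  -- boundary terms
  have b1 : |logWeight a P1 D * mertens v D - logWeight a P0 D * mertens v D| ≤ ε * (1 / D) := by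
    rw [← sub_mul, abs_mul]
    have h1 : logWeight a P1 D - logWeight a P0 D = 1 / D ^ 2 := by
      rw [logWeight, logWeight, hP1, hP0]; ring
    rw [h1, abs_of_pos (by positivity)]
    calc 1 / D ^ 2 * |mertens v D| ≤ 1 / D ^ 2 * (ε * D) :=
          mul_le_mul_of_nonneg_left (hM D hzD) (by positivity)
      _ = _ := by field_simp
  have hzz : z = D / √w := rfl
  have b2 : |logWeight a P1 z * mertens v z| ≤ ε * ((c + a * Real.log w - 1) * √w / D) := by
    rw [abs_mul]
    have h1 : logWeight a P1 z = -(c + a * Real.log w - 1) / z ^ 2 := by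
      rw [logWeight, hP1, hlD, hlz]; ring
    rw [h1, neg_div, abs_neg, abs_of_nonneg (div_nonneg (by linarith) (by positivity))]
    calc (c + a * Real.log w - 1) / z ^ 2 * |mertens v z|
          ≤ (c + a * Real.log w - 1) / z ^ 2 * (ε * z) :=
          mul_le_mul_of_nonneg_left (hM z le_rfl) (div_nonneg (by linarith) (by positivity))
      _ = _ := by rw [hzz]; field_simp
  have b3 : |logWeight a P0 N * mertens v N| ≤ ε * ((P0 + 2 * a * Real.log N) / N) := by
    rw [abs_mul, logWeight, abs_of_nonneg (div_nonneg hN2 (by positivity))]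
    calc (P0 + 2 * a * Real.log N) / (N : ℝ) ^ 2 * |mertens v N|
          ≤ (P0 + 2 * a * Real.log N) / (N : ℝ) ^ 2 * (ε * N) :=
          mul_le_mul_of_nonneg_left (hM N (hzD.trans (hDT.trans hN1)))
            (div_nonneg hN2 (by positivity))
      _ = _ := by field_simp
  -- On the last range the integral contributes `-logPrim a P0 N`, which absorbs the boundary term
  -- at `N`, so the bound does not depend on `N`.
  have b4 : (P0 + 2 * a * Real.log N) / N - logPrim a P0 N ≤ 0 := by
    rw [logPrim, ← sub_div]
    exact div_nonpos_of_nonpos_of_nonneg (by linarith) hN0.le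
  have p1 : logPrim a P1 D = (2 * a - 2 * c + 2) / D := by
    rw [logPrim, hP1, hlD]; ring
  have p2 : logPrim a P1 z = (2 * a - 2 * c + 2 - 2 * a * Real.log w) * √w / D := by
    rw [logPrim, hP1, hlD, hlz, hzz]; field_simp; ring
  have p3 : logPrim a P0 D = (2 * a - 2 * c) / D := by
    rw [logPrim, hP0, hlD]; ring
  have p4 : logPrim a P0 T = 4 * a * Real.exp (-(a + c) / (2 * a)) / D := by
    rw [logPrim]
    have : 4 * a * Real.log T + 2 * a + 2 * P0 = 4 * a := by
      rw [hP0, hlD]; linarith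
    rw [this, hT, neg_div, Real.exp_neg]
    field_simp
  -- In order: the jump of the weight at `D`, the boundary term at `z`, and the variations on the
  -- three ranges, `T` being the end of two of them.
  have htot : tailCoeff v w / D = 1 / D + (c + a * Real.log w - 1) * √w / D
      + (logPrim a P1 D - logPrim a P1 z) + (2 * logPrim a P0 T - logPrim a P0 D) := by
    rw [p1, p2, p3, p4, tailCoeff]; ring
  rw [htot]
  have hb4 := mul_le_mul_of_nonneg_left b4 hε
  rw [abs_le] at *
  constructor <;> linarith

/-- With `y = X / d²` the factor `d²` cancels and each term is at most `(|μ_v(d)|/2 + κ d²/X) / X`.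
The density of the support of `μ_v` is used only in the dominant first part. -/
theorem abs_sum_harmErr_small_le {v : ℕ} {w κ ρ c₀ X : ℝ} (hw : 1 ≤ w) (hκ : 0 ≤ κ)
    (hX : 0 < X)
    (hQ : ∀ n : ℕ, ∑ d ∈ Icc 1 n, |muCop v d| ≤ ρ * n + c₀) (hρ : 0 ≤ ρ)
    (he : ∀ y, w ≤ y → |harmErr v y| ≤ (1 / 2 + κ / y) / y) :
    |∑ d ∈ Icc 1 ⌊√X / √w⌋₊, muCop v d / (d : ℝ) ^ 2 * harmErr v (X / (d : ℝ) ^ 2)|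
      ≤ (1 / 2 * (ρ * (√X / √w) + c₀) + κ / X * ((√X / √w) ^ 3 / 3 + (√X / √w) ^ 2 / 2
          + (√X / √w) / 6)) / X := by
  have hw0 : 0 < √w := Real.sqrt_pos.2 (by linarith)
  have hww : √w ^ 2 = w := Real.sq_sqrt (by linarith)
  have hDX : √X ^ 2 = X := Real.sq_sqrt hX.le
  set z := √X / √w with hz
  have hz0 : 0 ≤ z := by positivity
  have hzX : z ^ 2 * w = X := by rw [hz, div_pow, hww, hDX]; field_simp
  have hfl : (⌊z⌋₊ : ℝ) ≤ z := Nat.floor_le hz0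
  have h1 : ∀ d ∈ Icc 1 ⌊z⌋₊, |muCop v d / (d : ℝ) ^ 2 * harmErr v (X / (d : ℝ) ^ 2)|
      ≤ (1 / 2 * |muCop v d| + κ / X * (d : ℝ) ^ 2) / X := by
    intro d hd
    rw [mem_Icc] at hd
    have hd0 : (0 : ℝ) < d := by exact_mod_cast hd.1
    have hdz : (d : ℝ) ≤ z := (Nat.le_floor_iff hz0).1 hd.2
    have hy : w ≤ X / (d : ℝ) ^ 2 := by
      rw [le_div_iff₀ (by positivity), ← hzX]
      have := pow_le_pow_left₀ hd0.le hdz 2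
      nlinarith
    have h2 := he _ hy
    have hmu := abs_muCop_le_one v d
    rw [abs_mul, abs_div, abs_of_pos (show (0 : ℝ) < (d : ℝ) ^ 2 by positivity)]
    calc |muCop v d| / (d : ℝ) ^ 2 * |harmErr v (X / (d : ℝ) ^ 2)|
        ≤ |muCop v d| / (d : ℝ) ^ 2 * ((1 / 2 + κ / (X / (d : ℝ) ^ 2)) / (X / (d : ℝ) ^ 2)) :=
          mul_le_mul_of_nonneg_left h2 (by positivity)
      _ = (1 / 2 * |muCop v d| + |muCop v d| * (κ / X * (d : ℝ) ^ 2)) / X := by field_simp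
      _ ≤ _ := by
          have h3 : |muCop v d| * (κ / X * (d : ℝ) ^ 2) ≤ κ / X * (d : ℝ) ^ 2 :=
            mul_le_of_le_one_left (by positivity) hmu
          gcongr
  refine (Finset.abs_sum_le_sum_abs _ _).trans ((Finset.sum_le_sum h1).trans ?_)
  rw [← Finset.sum_div, Finset.sum_add_distrib, ← Finset.mul_sum, ← Finset.mul_sum]
  have h4 : ∀ n : ℕ, ∑ d ∈ Icc 1 n, (d : ℝ) ^ 2 = (n : ℝ) ^ 3 / 3 + (n : ℝ) ^ 2 / 2 + n / 6 := by
    intro n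
    induction n with
    | zero => simp
    | succ n ih => rw [Finset.sum_Icc_succ_top (by omega), ih]; push_cast; ring
  have h5 := hQ ⌊z⌋₊
  rw [h4]
  have h6 : ρ * (⌊z⌋₊ : ℝ) ≤ ρ * z := mul_le_mul_of_nonneg_left hfl hρ
  have h7 : ∑ d ∈ Icc 1 ⌊z⌋₊, |muCop v d| ≤ ρ * z + c₀ := by linarith
  gcongr

theorem abs_sqfreeRem_le {v : ℕ} (hv : v = 1 ∨ v = 2) {w ε κ ρ c₀ X : ℝ} (hw : 1 ≤ w)
    (hε : 0 ≤ ε) (hκ : 0 ≤ κ) (hρ : 0 ≤ ρ) (hX : 0 < X)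
    (hM : ∀ t, √X / √w ≤ t → |mertens v t| ≤ ε * t)
    (hone : ∀ y, 1 ≤ y → y < w → harmCop v y = 1)
    (hc1 : 1 ≤ harmLead v + harmConst v)
    (hc2 : 1 ≤ harmConst v + harmLead v * Real.log w)
    (hQ : ∀ n : ℕ, ∑ d ∈ Icc 1 n, |muCop v d| ≤ ρ * n + c₀)
    (he : ∀ y, w ≤ y → |harmErr v y| ≤ (1 / 2 + κ / y) / y) :
    |sqfreeRem v X| ≤ (1 / 2 * (ρ * (√X / √w) + c₀) + κ / X * ((√X / √w) ^ 3 / 3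
      + (√X / √w) ^ 2 / 2 + (√X / √w) / 6)) / X + ε * (tailCoeff v w / √X) := by
  refine le_of_tendsto ((tendsto_sum_harmErr hv hX).abs) ?_
  filter_upwards [abs_sum_harmErr_large_le hw hε hX hM hone hc1 hc2,
    eventually_ge_atTop ⌊√X / √w⌋₊] with N h1 h2
  have h3 := abs_sum_harmErr_small_le hw hκ hX hQ hρ he
  have h4 : ∑ d ∈ Icc 1 N, muCop v d / (d : ℝ) ^ 2 * harmErr v (X / (d : ℝ) ^ 2)
      = ∑ d ∈ Icc 1 ⌊√X / √w⌋₊, muCop v d / (d : ℝ) ^ 2 * harmErr v (X / (d : ℝ) ^ 2)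
        + ∑ d ∈ Ioc ⌊√X / √w⌋₊ N, muCop v d / (d : ℝ) ^ 2 * harmErr v (X / (d : ℝ) ^ 2) :=
    (Finset.sum_Ioc_consecutive (fun d : ℕ => muCop v d / (d : ℝ) ^ 2
      * harmErr v (X / (d : ℝ) ^ 2)) (Nat.zero_le _) h2).symm
  rw [h4]
  exact (abs_add_le _ _).trans (add_le_add h3 h1)

end SqfreeAverage


namespace SqfreeAverage

open Finset Filter Topology

/-! ### Numerical values of the constants -/

/-- The square of the prime is one more than a product of smaller primes: `49 = 48 + 1`, and below
`121 = 120 + 1`, `169 = 168 + 1`, `289 = 288 + 1`. -/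
theorem log_seven_bounds : 1.9459085 < Real.log 7 ∧ Real.log 7 < 1.945911 := by
  have h : 2 * Real.log 7 = 4 * Real.log 2 + Real.log 3 + Real.log (1 + 1 / 48) := by
    have e1 : 2 * Real.log 7 = Real.log (7 ^ 2) := by rw [Real.log_pow]; norm_num
    have e2 : 4 * Real.log 2 = Real.log (2 ^ 4) := by rw [Real.log_pow]; norm_num
    rw [e1, e2, ← Real.log_mul (by norm_num) (by norm_num),
      ← Real.log_mul (by norm_num) (by norm_num)]
    norm_num
  have h1 := log_one_add_le (x := 1 / 48) (by norm_num)
  have h2 := le_log_one_add (x := 1 / 48) (by norm_num)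
  have := Real.log_two_gt_d9
  have := Real.log_two_lt_d9
  have := Real.log_three_gt_d9
  have := Real.log_three_lt_d9
  norm_num at h1 h2
  constructor <;> linarith

theorem log_eleven_bounds : 2.3978945 < Real.log 11 ∧ Real.log 11 < 2.3978955 := by
  have h : 2 * Real.log 11 = 3 * Real.log 2 + Real.log 3 + Real.log 5
      + Real.log (1 + 1 / 120) := by
    have e1 : 2 * Real.log 11 = Real.log (11 ^ 2) := by rw [Real.log_pow]; norm_num
    have e2 : 3 * Real.log 2 = Real.log (2 ^ 3) := by rw [Real.log_pow]; norm_num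
    rw [e1, e2, ← Real.log_mul (by norm_num) (by norm_num),
      ← Real.log_mul (by norm_num) (by norm_num), ← Real.log_mul (by norm_num) (by norm_num)]
    norm_num
  have h1 := log_one_add_le (x := 1 / 120) (by norm_num)
  have h2 := le_log_one_add (x := 1 / 120) (by norm_num)
  have := Real.log_two_gt_d9
  have := Real.log_two_lt_d9
  have := Real.log_three_gt_d9
  have := Real.log_three_lt_d9
  have := Real.log_five_gt_d9
  have := Real.log_five_lt_d9
  norm_num at h1 h2
  constructor <;> linarith

theorem log_thirteen_bounds : 2.5649485 < Real.log 13 ∧ Real.log 13 < 2.564951 := by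
  have h : 2 * Real.log 13 = 3 * Real.log 2 + Real.log 3 + Real.log 7
      + Real.log (1 + 1 / 168) := by
    have e1 : 2 * Real.log 13 = Real.log (13 ^ 2) := by rw [Real.log_pow]; norm_num
    have e2 : 3 * Real.log 2 = Real.log (2 ^ 3) := by rw [Real.log_pow]; norm_num
    rw [e1, e2, ← Real.log_mul (by norm_num) (by norm_num),
      ← Real.log_mul (by norm_num) (by norm_num), ← Real.log_mul (by norm_num) (by norm_num)]
    norm_num
  have h1 := log_one_add_le (x := 1 / 168) (by norm_num)
  have h2 := le_log_one_add (x := 1 / 168) (by norm_num)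
  have := Real.log_two_gt_d9
  have := Real.log_two_lt_d9
  have := Real.log_three_gt_d9
  have := Real.log_three_lt_d9
  have := log_seven_bounds
  norm_num at h1 h2
  constructor <;> linarith

theorem log_seventeen_gt : 2.8332 < Real.log 17 := by
  have h : 2 * Real.log 17 = 5 * Real.log 2 + 2 * Real.log 3 + Real.log (1 + 1 / 288) := by
    have e1 : 2 * Real.log 17 = Real.log (17 ^ 2) := by rw [Real.log_pow]; norm_num
    have e2 : 5 * Real.log 2 = Real.log (2 ^ 5) := by rw [Real.log_pow]; norm_num
    have e3 : 2 * Real.log 3 = Real.log (3 ^ 2) := by rw [Real.log_pow]; norm_num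
    rw [e1, e2, e3, ← Real.log_mul (by norm_num) (by norm_num),
      ← Real.log_mul (by norm_num) (by norm_num)]
    norm_num
  have h2 := le_log_one_add (x := 1 / 288) (by norm_num)
  have := Real.log_two_gt_d9
  have := Real.log_three_gt_d9
  norm_num at h2
  linarith

theorem eulerMascheroni_bounds :
    0.577195 < Real.eulerMascheroniConstant ∧ Real.eulerMascheroniConstant < 0.577216 := by
  have h1 := harm_le (n := 64) (by norm_num)
  have h2 := le_harm (n := 64) (by norm_num)
  have e2 : Real.log (64 : ℕ) = 6 * Real.log 2 := by
    rw [show ((64 : ℕ) : ℝ) = 2 ^ 6 by norm_num, Real.log_pow]; norm_num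
  have h3 : harm 64 = ((harmonic 64 : ℚ) : ℝ) := by
    rw [harmonic_eq_sum_Icc, harm]; push_cast; simp
  have h4 : (4.743890903 : ℚ) < harmonic 64 ∧ harmonic 64 < (4.743890905 : ℚ) := by
    decide +kernel
  have h5 : (4.743890903 : ℝ) < harm 64 := by
    have := (Rat.cast_lt (K := ℝ)).2 h4.1
    rw [h3]; refine lt_of_eq_of_lt ?_ this; norm_num
  have h6 : harm 64 < (4.743890905 : ℝ) := by
    have := (Rat.cast_lt (K := ℝ)).2 h4.2
    rw [h3]; refine lt_of_lt_of_eq this ?_; norm_num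
  rw [e2] at h1 h2
  have := Real.log_two_gt_d9
  have := Real.log_two_lt_d9
  norm_num at h1 h2
  constructor <;> linarith

/-- The function `log x / x²`. -/
noncomputable def logSq (x : ℝ) : ℝ := Real.log x / x ^ 2

/-- Minus an antiderivative of `logSq`. -/
noncomputable def logSqPrim (x : ℝ) : ℝ := (Real.log x + 1) / x

theorem hasDerivAt_logSq {x : ℝ} (hx : 0 < x) :
    HasDerivAt logSq ((1 - 2 * Real.log x) / x ^ 3) x := by
  have h2 := (Real.hasDerivAt_log hx.ne').fun_div (hasDerivAt_pow 2 x) (by positivity)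
  convert! h2 using 1
  push_cast; field_simp

theorem hasDerivAt_logSqPrim {x : ℝ} (hx : 0 < x) :
    HasDerivAt logSqPrim (-logSq x) x := by
  have h2 := ((Real.hasDerivAt_log hx.ne').add_const 1).fun_div (hasDerivAt_id' x) hx.ne'
  convert! h2 using 1
  rw [logSq]; field_simp; ring

/-- The second derivative is `(6 log x - 5) / x⁴`, and `log x ≥ 1` for `x ≥ 3`. -/
theorem convexOn_logSq : ConvexOn ℝ (Set.Ici 3) logSq := by
  have hl : ∀ x : ℝ, 3 ≤ x → 1 ≤ Real.log x := fun x hx => by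
    rw [Real.le_log_iff_exp_le (by linarith)]
    linarith [Real.exp_one_lt_three]
  apply convexOn_of_hasDerivWithinAt2_nonneg (convex_Ici 3)
    (f' := fun x => (1 - 2 * Real.log x) / x ^ 3)
    (f'' := fun x => (6 * Real.log x - 5) / x ^ 4)
  · intro x hx
    exact (hasDerivAt_logSq (by linarith [Set.mem_Ici.1 hx])).continuousAt.continuousWithinAt
  · intro x hx
    have := Set.mem_Ici.1 (interior_subset hx)
    exact (hasDerivAt_logSq (by linarith)).hasDerivWithinAt
  · intro x hx
    have := Set.mem_Ici.1 (interior_subset hx)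
    have hx0 : 0 < x := by linarith
    apply HasDerivAt.hasDerivWithinAt
    have h2 := (((Real.hasDerivAt_log hx0.ne').const_mul 2).const_sub 1).fun_div
      (hasDerivAt_pow 3 x) (by positivity)
    convert! h2 using 1
    push_cast; field_simp; ring
  · intro x hx
    have := Set.mem_Ici.1 (interior_subset hx)
    have := hl x this
    exact div_nonneg (by linarith) (by positivity)

/-- Midpoint rule for a convex function, proved by monotonicity in the half-width `h` of the
interval. -/
theorem logSq_le_midpoint {n : ℝ} (hn : 4 ≤ n) :
    logSq n ≤ logSqPrim (n - 1 / 2) - logSqPrim (n + 1 / 2) := by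
  have hd : ∀ h ∈ Set.Icc (0 : ℝ) (1 / 2), HasDerivAt
      (fun h => logSqPrim (n - h) - logSqPrim (n + h) - 2 * logSq n * h)
      (logSq (n - h) + logSq (n + h) - 2 * logSq n) h := by
    intro h hh
    have h1 : HasDerivAt (fun h => logSqPrim (n - h)) (-logSq (n - h) * (-1)) h :=
      (hasDerivAt_logSqPrim (by linarith [hh.2])).comp h ((hasDerivAt_id h).const_sub n)
    have h2 : HasDerivAt (fun h => logSqPrim (n + h)) (-logSq (n + h) * 1) h :=
      (hasDerivAt_logSqPrim (by linarith [hh.1])).comp h ((hasDerivAt_id h).const_add n)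
    have h3 : HasDerivAt (fun h => 2 * logSq n * h) (2 * logSq n * 1) h :=
      (hasDerivAt_id h).const_mul _
    convert! (h1.sub h2).sub h3 using 1
    ring
  have hm : MonotoneOn (fun h => logSqPrim (n - h) - logSqPrim (n + h) - 2 * logSq n * h)
      (Set.Icc 0 (1 / 2)) := by
    apply monotoneOn_of_deriv_nonneg (convex_Icc _ _)
      (fun y hy => (hd y hy).continuousAt.continuousWithinAt)
    · exact fun y hy => (hd y (interior_subset hy)).differentiableAt.differentiableWithinAt
    · intro h hh
      have hh' := interior_subset hh
      rw [(hd h hh').deriv]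
      have h1 := convexOn_logSq.2 (show n - h ∈ Set.Ici 3 from Set.mem_Ici.2 (by linarith [hh'.2]))
        (show n + h ∈ Set.Ici 3 from Set.mem_Ici.2 (by linarith [hh'.1]))
        (show (0 : ℝ) ≤ 1 / 2 by norm_num) (show (0 : ℝ) ≤ 1 / 2 by norm_num) (by norm_num)
      simp only [smul_eq_mul] at h1
      rw [show 1 / 2 * (n - h) + 1 / 2 * (n + h) = n by ring] at h1
      linarith
  have := hm (Set.mem_Icc.2 ⟨le_rfl, by norm_num⟩) (Set.mem_Icc.2 ⟨by norm_num, le_rfl⟩)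
    (by norm_num : (0 : ℝ) ≤ 1 / 2)
  simp only [sub_zero, add_zero, mul_zero, sub_self] at this
  linarith

theorem trapezoid_le_logSq {n : ℝ} (hn : 3 ≤ n) :
    logSqPrim n - logSqPrim (n + 1) ≤ (logSq n + logSq (n + 1)) / 2 := by
  have hd : ∀ h ∈ Set.Icc (0 : ℝ) 1, HasDerivAt
      (fun h => h * logSq n + h ^ 2 * ((logSq (n + 1) - logSq n) / 2) + logSqPrim (n + h))
      (logSq n + 2 * h * ((logSq (n + 1) - logSq n) / 2) - logSq (n + h)) h := by
    intro h hh
    have h2 : HasDerivAt (fun h => logSqPrim (n + h)) (-logSq (n + h) * 1) h :=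
      (hasDerivAt_logSqPrim (by linarith [hh.1])).comp h ((hasDerivAt_id h).const_add n)
    have h3 := (((hasDerivAt_id h).mul_const (logSq n)).add
      ((hasDerivAt_pow 2 h).mul_const ((logSq (n + 1) - logSq n) / 2))).add h2
    convert! h3 using 1
    push_cast; ring
  have hm : MonotoneOn
      (fun h => h * logSq n + h ^ 2 * ((logSq (n + 1) - logSq n) / 2) + logSqPrim (n + h))
      (Set.Icc 0 1) := by
    apply monotoneOn_of_deriv_nonneg (convex_Icc _ _)
      (fun y hy => (hd y hy).continuousAt.continuousWithinAt)
    · exact fun y hy => (hd y (interior_subset hy)).differentiableAt.differentiableWithinAt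
    · intro h hh
      have hh' := interior_subset hh
      rw [(hd h hh').deriv]
      have h1 := convexOn_logSq.2 (Set.mem_Ici.2 hn)
        (show n + 1 ∈ Set.Ici 3 from Set.mem_Ici.2 (by linarith))
        (show 0 ≤ 1 - h by linarith [hh'.2]) hh'.1 (by ring)
      simp only [smul_eq_mul] at h1
      rw [show (1 - h) * n + h * (n + 1) = n + h by ring] at h1
      linarith
  have := hm (Set.mem_Icc.2 ⟨le_rfl, by norm_num⟩) (Set.mem_Icc.2 ⟨by norm_num, le_rfl⟩)
    (by norm_num : (0 : ℝ) ≤ 1)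
  norm_num at this
  linarith

theorem tendsto_logSqPrim {c : ℝ} : Tendsto (fun n : ℕ => logSqPrim (n + c)) atTop (𝓝 0) := by
  have h1 : Tendsto logSqPrim atTop (𝓝 0) := by
    have h2 : Tendsto (fun x : ℝ => Real.log x / x + x⁻¹) atTop (𝓝 (0 + 0)) := by
      refine Tendsto.add ?_ tendsto_inv_atTop_zero
      exact Real.isLittleO_log_id_atTop.tendsto_div_nhds_zero
    rw [add_zero] at h2
    refine h2.congr fun x => ?_
    rw [logSqPrim]; ring
  exact h1.comp (tendsto_atTop_add_const_right _ _ tendsto_natCast_atTop_atTop)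

theorem tendsto_logSq {c : ℝ} : Tendsto (fun n : ℕ => logSq (n + c)) atTop (𝓝 0) := by
  have h1 : Tendsto logSq atTop (𝓝 0) := by
    have h2 : Tendsto (fun x : ℝ => Real.log x / x * x⁻¹) atTop (𝓝 (0 * 0)) := by
      refine Tendsto.mul ?_ tendsto_inv_atTop_zero
      exact Real.isLittleO_log_id_atTop.tendsto_div_nhds_zero
    rw [mul_zero] at h2
    refine h2.congr fun x => ?_
    rw [logSq, sq]
    rw [← div_eq_mul_inv, div_div]
  exact h1.comp (tendsto_atTop_add_const_right _ _ tendsto_natCast_atTop_atTop)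

/-- The terms up to `16` are kept and the midpoint rule bounds the tail by an integral from `16.5 =
3 · 11 / 2`, whose logarithm is already under control. The lower bound uses the trapezoid rule from
`17`. -/
theorem logSqSum_le : logSqSum ≤ ∑ n ∈ range 17, logSq n + logSqPrim 16.5 := by
  have h1 : ∀ N : ℕ, ∑ n ∈ range (17 + N), logSq n ≤
      ∑ n ∈ range 17, logSq n + logSqPrim 16.5 - logSqPrim (N + 16.5) := by
    intro N
    induction N with
    | zero => simp
    | succ N ih =>
      rw [← add_assoc, Finset.sum_range_succ _ (17 + N)]
      have := logSq_le_midpoint (n := ((17 + N : ℕ) : ℝ)) (by push_cast; linarith [N.cast_nonneg (α := ℝ)])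
      have e1 : (((17 + N : ℕ) : ℝ) - 1 / 2) = N + 16.5 := by push_cast; ring
      have e2 : (((17 + N : ℕ) : ℝ) + 1 / 2) = (N + 1 : ℕ) + 16.5 := by push_cast; ring
      rw [e1, e2] at this
      linarith
  have h2 := (hasSum_log_div_sq.tendsto_sum_nat.comp (tendsto_add_atTop_nat 17))
  have h3 := (tendsto_const_nhds (x := ∑ n ∈ range 17, logSq n + logSqPrim 16.5)
    (f := (atTop : Filter ℕ))).sub (tendsto_logSqPrim (c := 16.5))
  rw [sub_zero] at h3
  refine le_of_tendsto_of_tendsto' h2 h3 fun N => ?_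
  have := h1 N
  rw [add_comm 17 N] at this
  exact this

theorem le_logSqSum : ∑ n ∈ range 17, logSq n + logSqPrim 17 + logSq 17 / 2 ≤ logSqSum := by
  have h1 : ∀ N : ℕ, ∑ n ∈ range 17, logSq n + logSqPrim 17 + logSq 17 / 2
      - logSqPrim (N + 17) - logSq (N + 17) / 2 ≤ ∑ n ∈ range (17 + N), logSq n := by
    intro N
    induction N with
    | zero => simp; apply le_of_eq; ring
    | succ N ih =>
      rw [← add_assoc, Finset.sum_range_succ _ (17 + N)]
      have := trapezoid_le_logSq (n := (N : ℝ) + 17) (by linarith [N.cast_nonneg (α := ℝ)])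
      have e1 : ((17 + N : ℕ) : ℝ) = N + 17 := by push_cast; ring
      have e2 : ((N + 1 : ℕ) : ℝ) + 17 = N + 17 + 1 := by push_cast; ring
      rw [e1, e2]
      linarith
  have h2 := (hasSum_log_div_sq.tendsto_sum_nat.comp (tendsto_add_atTop_nat 17))
  have h3 := ((tendsto_const_nhds (x := ∑ n ∈ range 17, logSq n + logSqPrim 17 + logSq 17 / 2)
    (f := (atTop : Filter ℕ))).sub (tendsto_logSqPrim (c := 17))).sub
      ((tendsto_logSq (c := 17)).div_const 2)
  rw [sub_zero, zero_div, sub_zero] at h3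
  refine le_of_tendsto_of_tendsto' h3 h2 fun N => ?_
  have := h1 N
  rw [add_comm 17 N] at this
  exact this

theorem beta_one_bounds : 0.60792 < beta 1 ∧ beta 1 < 0.607928 := by
  have h1 := Real.pi_gt_d6
  have h2 := Real.pi_lt_d6
  rw [beta_one]
  constructor
  · rw [lt_div_iff₀ (by positivity)]; nlinarith
  · rw [div_lt_iff₀ (by positivity)]; nlinarith

theorem sum_logSq_eq : ∑ n ∈ range 17, logSq n =
    Real.log 2 * (1 / 4 + 2 / 16 + 1 / 36 + 3 / 64 + 1 / 100 + 2 / 144 + 1 / 196 + 4 / 256)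
    + Real.log 3 * (1 / 9 + 1 / 36 + 2 / 81 + 1 / 144 + 1 / 225)
    + Real.log 5 * (1 / 25 + 1 / 100 + 1 / 225) + Real.log 7 * (1 / 49 + 1 / 196)
    + Real.log 11 / 121 + Real.log 13 / 169 := by
  have h4 : Real.log 4 = 2 * Real.log 2 := Real.log_four_eq
  have h6 : Real.log 6 = Real.log 2 + Real.log 3 := by
    rw [← Real.log_mul (by norm_num) (by norm_num)]; norm_num
  have h8 : Real.log 8 = 3 * Real.log 2 := by
    rw [show (8 : ℝ) = 2 ^ 3 by norm_num, Real.log_pow]; norm_num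
  have h9 : Real.log 9 = 2 * Real.log 3 := by
    rw [show (9 : ℝ) = 3 ^ 2 by norm_num, Real.log_pow]; norm_num
  have h10 : Real.log 10 = Real.log 2 + Real.log 5 := Real.log_ten_eq
  have h12 : Real.log 12 = 2 * Real.log 2 + Real.log 3 := by
    rw [← h4, ← Real.log_mul (by norm_num) (by norm_num)]; norm_num
  have h14 : Real.log 14 = Real.log 2 + Real.log 7 := by
    rw [← Real.log_mul (by norm_num) (by norm_num)]; norm_num
  have h15 : Real.log 15 = Real.log 3 + Real.log 5 := by
    rw [← Real.log_mul (by norm_num) (by norm_num)]; norm_num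
  have h16 : Real.log 16 = 4 * Real.log 2 := by
    rw [show (16 : ℝ) = 2 ^ 4 by norm_num, Real.log_pow]; norm_num
  simp only [Finset.sum_range_succ, Finset.sum_range_zero, logSq]
  push_cast
  rw [h4, h6, h8, h9, h10, h12, h14, h15, h16, Real.log_one, Real.log_zero]
  ring

theorem logSqSum_bounds : 0.93745 < logSqSum ∧ logSqSum < 0.9376 := by
  have h1 := logSqSum_le
  have h2 := le_logSqSum
  rw [sum_logSq_eq] at h1 h2
  have := Real.log_two_gt_d9
  have := Real.log_two_lt_d9
  have := Real.log_three_gt_d9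
  have := Real.log_three_lt_d9
  have := Real.log_five_gt_d9
  have := Real.log_five_lt_d9
  have := log_seven_bounds
  have := log_eleven_bounds
  have := log_thirteen_bounds
  have := log_seventeen_gt
  have e1 : Real.log 16.5 = Real.log 3 + Real.log 11 - Real.log 2 := by
    rw [← Real.log_mul (by norm_num) (by norm_num), ← Real.log_div (by norm_num) (by norm_num)]
    norm_num
  rw [logSqPrim, e1] at h1
  rw [logSqPrim, logSq] at h2
  norm_num at h1 h2
  constructor <;> linarith

theorem bConst_one_bounds : 1.71698 < bConst 1 ∧ bConst 1 < 1.71725 := by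
  rw [bConst_one, ← beta_one]
  have h1 := logSqSum_bounds
  have h2 := beta_one_bounds
  have h3 := eulerMascheroni_bounds
  constructor <;> nlinarith

end SqfreeAverage


namespace SqfreeAverage

open Finset Filter Topology

/-! ### The remainder for large arguments -/

theorem harmCop_one_eq_one {y : ℝ} (h1 : 1 ≤ y) (h2 : y < 2) : harmCop 1 y = 1 := by
  have : ⌊y⌋₊ = 1 := by rw [Nat.floor_eq_iff (by linarith)]; norm_num; exact ⟨h1, by linarith⟩
  rw [harmCop_one, this]; simp [harm]

theorem harmCop_two_eq_one {y : ℝ} (h1 : 1 ≤ y) (h2 : y < 3) : harmCop 2 y = 1 := by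
  have h3 : 1 ≤ ⌊y⌋₊ := Nat.le_floor (by simpa using h1)
  have h4 : ⌊y⌋₊ < 3 := (Nat.floor_lt (by linarith)).2 (by simpa using h2)
  rw [harmCop_two, show (⌊y⌋₊ + 1) / 2 = 1 by omega]; simp [oddHarm]

theorem sum_abs_muCop_one_le (n : ℕ) :
    ∑ d ∈ Icc 1 n, |muCop 1 d| ≤ 2 / 3 * (n : ℝ) + 4 / 3 := by
  have h1 : ∑ d ∈ Icc 1 n, |muCop 1 d| ≤ (sieveCount n : ℝ) := by
    unfold sieveCount
    push_cast
    refine sum_le_sum fun d _ => ?_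
    rw [muCop_one]
    exact_mod_cast abs_moebius_le_sieveInd d
  have h2 : (3 * sieveCount n : ℝ) ≤ 2 * n + 4 := by exact_mod_cast (sieveCount_bounds n).1
  linarith

/-- The indicator of the odd integers not divisible by `9`. -/
def oddSieveInd (n : ℕ) : ℕ := if n % 2 = 0 ∨ n % 9 = 0 then 0 else 1

theorem abs_muCop_two_le (n : ℕ) : |muCop 2 n| ≤ (oddSieveInd n : ℝ) := by
  rw [muCop_two]
  unfold moebiusOdd oddSieveInd
  by_cases h : n % 2 = 1
  · rw [if_pos h]
    by_cases h9 : n % 9 = 0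
    · rw [sq_dvd_moebius_eq_zero (p := 3) (by norm_num) (Nat.dvd_of_mod_eq_zero h9)]
      simp [h9]
    · rw [if_neg (by omega)]
      exact_mod_cast ArithmeticFunction.abs_moebius_le_one (n := n)
  · rw [if_neg h, if_pos (by omega)]; simp

theorem sum_oddSieveInd_le (n : ℕ) : 9 * ∑ d ∈ Icc 1 n, oddSieveInd d ≤ 4 * n + 8 := by
  have hp : ∀ N, ∑ d ∈ Icc 1 (N + 18), oddSieveInd d = ∑ d ∈ Icc 1 N, oddSieveInd d + 8 := by
    intro N
    induction N with
    | zero => decide +kernel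
    | succ N ih =>
      rw [show N + 1 + 18 = N + 18 + 1 by ring, Finset.sum_Icc_succ_top (by omega), ih,
        Finset.sum_Icc_succ_top (by omega)]
      have : oddSieveInd (N + 18 + 1) = oddSieveInd (N + 1) := by
        unfold oddSieveInd
        rw [show (N + 18 + 1) % 2 = (N + 1) % 2 by omega,
          show (N + 18 + 1) % 9 = (N + 1) % 9 by omega]
      omega
  have h0 : ∀ m < 18, 9 * ∑ d ∈ Icc 1 m, oddSieveInd d ≤ 4 * m + 8 := by decide +kernel
  induction n using Nat.strong_induction_on with
  | _ n ih =>
    by_cases h : n < 18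
    · exact h0 n h
    · obtain ⟨m, rfl⟩ := Nat.exists_eq_add_of_le' (not_lt.1 h)
      rw [hp]
      have := ih m (by omega)
      omega

theorem sum_abs_muCop_two_le (n : ℕ) :
    ∑ d ∈ Icc 1 n, |muCop 2 d| ≤ 4 / 9 * (n : ℝ) + 8 / 9 := by
  have h1 : ∑ d ∈ Icc 1 n, |muCop 2 d| ≤ ((∑ d ∈ Icc 1 n, oddSieveInd d : ℕ) : ℝ) := by
    push_cast
    exact sum_le_sum fun d _ => abs_muCop_two_le d
  have h2 : (9 * (∑ d ∈ Icc 1 n, oddSieveInd d : ℕ) : ℝ) ≤ 4 * n + 8 := by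
    exact_mod_cast sum_oddSieveInd_le n
  linarith

theorem exp_neg_le {x y : ℝ} (hx : 0 ≤ x)
    (h : 1 ≤ y * (1 + x + x ^ 2 / 2 + x ^ 3 / 6 + x ^ 4 / 24)) : Real.exp (-x) ≤ y := by
  have h1 := Real.sum_le_exp_of_nonneg hx 5
  simp only [sum_range_succ, sum_range_zero, Nat.factorial] at h1
  norm_num at h1
  have hy : 0 < y := by
    by_contra hc
    have : 0 ≤ 1 + x + x ^ 2 / 2 + x ^ 3 / 6 + x ^ 4 / 24 := by positivity
    nlinarith
  rw [Real.exp_neg, inv_le_comm₀ (Real.exp_pos _) hy, inv_eq_one_div, div_le_iff₀ hy]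
  nlinarith

theorem tailCoeff_one_le : tailCoeff 1 2 ≤ 4.97 := by
  have h1 := eulerMascheroni_bounds
  have h2 := Real.log_two_lt_d9
  have h3 : 1.414 ≤ √2 := Real.le_sqrt_of_sq_le (by norm_num)
  have he : Real.exp (-(1 + Real.eulerMascheroniConstant) / (2 * 1)) ≤ 0.456 := by
    refine le_trans (Real.exp_le_exp.2 (show _ ≤ -(0.788 : ℝ) by linarith)) ?_
    exact exp_neg_le (by norm_num) (by norm_num)
  simp only [tailCoeff, harmLead, harmConst, if_true]
  nlinarith

theorem tailCoeff_two_le : tailCoeff 2 3 ≤ 3.53 := by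
  have h1 := eulerMascheroni_bounds
  have h2 := Real.log_two_lt_d9
  have h2' := Real.log_two_gt_d9
  have h4 := Real.log_three_lt_d9
  have h3 : 1.732 ≤ √3 := Real.le_sqrt_of_sq_le (by norm_num)
  have he : Real.exp (-(1 / 2 + (Real.eulerMascheroniConstant + Real.log 2) / 2) / (2 * (1 / 2)))
      ≤ 0.324 := by
    refine le_trans (Real.exp_le_exp.2 (show _ ≤ -(1.135 : ℝ) by linarith)) ?_
    exact exp_neg_le (by norm_num) (by norm_num)
  have e : (2 : ℕ) ≠ 1 := by norm_num
  simp only [tailCoeff, harmLead, harmConst, if_neg e]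
  nlinarith

/-- With `s = √X` and `r = √w` the bound is `1/s` times an expression increasing in `1/r` and `1/s`,
so it may be evaluated at numerical upper bounds `u` and `S`. -/
theorem large_bound_le {s r ρ c₀ κ T D S u : ℝ} (hs : 0 < s) (hr : 0 < r)
    (hρ : 0 ≤ ρ) (hc : 0 ≤ c₀) (hκ : 0 ≤ κ) (hu : r⁻¹ ≤ u) (hS : s⁻¹ ≤ S)
    (h : ρ * u / 2 + c₀ * S / 2 + κ * (u ^ 3 / 3 + u ^ 2 * S / 2 + u * S ^ 2 / 6) + T ≤ D) :
    (1 / 2 * (ρ * (s / r) + c₀) + κ / s ^ 2 * ((s / r) ^ 3 / 3 + (s / r) ^ 2 / 2 + (s / r) / 6))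
      / s ^ 2 + T / s ≤ D / s := by
  have hr' : 0 < r⁻¹ := inv_pos.2 hr
  have hs' : 0 < s⁻¹ := inv_pos.2 hs
  have e : (1 / 2 * (ρ * (s / r) + c₀) + κ / s ^ 2 *
      ((s / r) ^ 3 / 3 + (s / r) ^ 2 / 2 + (s / r) / 6)) / s ^ 2 + T / s
      = (ρ * r⁻¹ / 2 + c₀ * s⁻¹ / 2 + κ * (r⁻¹ ^ 3 / 3 + r⁻¹ ^ 2 * s⁻¹ / 2 + r⁻¹ * s⁻¹ ^ 2 / 6) + T)
        / s := by
    field_simp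
  rw [e]
  gcongr
  refine le_trans ?_ h
  have hu0 : 0 ≤ u := hr'.le.trans hu
  have hS0 : 0 ≤ S := hs'.le.trans hS
  gcongr

/-- `80802 = 2 · 201²` makes `√X / √2 ≥ 201`, where the Möbius bound is available. The large
divisors contribute `0.036 · 4.97 < 0.179`, the small ones mainly `(2/3) / (2√2) < 0.236`. -/
theorem abs_sqfreeRem_one_large {X : ℝ} (hX : 80802 ≤ X) : |sqfreeRem 1 X| ≤ 0.43 / √X := by
  have hX0 : 0 < X := by linarith
  have h1 := eulerMascheroni_bounds
  have h2 := Real.log_two_gt_d9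
  have hr : 1.4142 ≤ √2 := Real.le_sqrt_of_sq_le (by norm_num)
  have hs : 284 ≤ √X := Real.le_sqrt_of_sq_le (by norm_num; linarith)
  have hs2 : 201 * √2 ≤ √X := by
    apply Real.le_sqrt_of_sq_le
    rw [mul_pow, Real.sq_sqrt (by norm_num)]; linarith
  have hl1 : harmLead 1 = 1 := by simp [harmLead]
  have hc1 : harmConst 1 = Real.eulerMascheroniConstant := by simp [harmConst]
  have h := abs_sqfreeRem_le (v := 1) (Or.inl rfl) (w := 2) (ε := 0.036) (κ := 1 / 12) (ρ := 2 / 3)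
    (c₀ := 4 / 3) (by norm_num) (by norm_num) (by norm_num) (by norm_num) hX0
    (fun t ht => abs_mertens_one_le (le_trans (by rw [le_div_iff₀ (by linarith)]; exact hs2) ht))
    (fun y => harmCop_one_eq_one) (by rw [hl1, hc1]; linarith) (by rw [hl1, hc1]; linarith)
    sum_abs_muCop_one_le
    (fun y hy => by
      rw [harmErr, hl1, hc1]
      exact harmCop_one_error hy)
  refine h.trans ?_
  have hT := tailCoeff_one_le
  have hh := large_bound_le (s := √X) (r := √2) (ρ := 2 / 3) (c₀ := 4 / 3) (κ := 1 / 12)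
    (T := 0.036 * tailCoeff 1 2) (D := 0.43) (S := 1 / 284) (u := 1 / 1.4142) (by linarith)
    (by linarith) (by norm_num) (by norm_num) (by norm_num)
    (by rw [inv_eq_one_div]; gcongr) (by rw [inv_eq_one_div]; gcongr)
    (by norm_num at hT ⊢; linarith)
  rwa [Real.sq_sqrt hX0.le, mul_div_assoc (0.036 : ℝ)] at hh

/-- As before with `w = 3` and `121203 = 3 · 201²`. The target `0.409` lies just below `0.12 ·
sqrtFactor 2`. -/
theorem abs_sqfreeRem_two_large {X : ℝ} (hX : 121203 ≤ X) : |sqfreeRem 2 X| ≤ 0.409 / √X := by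
  have hX0 : 0 < X := by linarith
  have h1 := eulerMascheroni_bounds
  have h2 := Real.log_two_gt_d9
  have h3 := Real.log_three_gt_d9
  have hr : 1.732 ≤ √3 := Real.le_sqrt_of_sq_le (by norm_num)
  have hs : 348 ≤ √X := Real.le_sqrt_of_sq_le (by norm_num; linarith)
  have hs2 : 201 * √3 ≤ √X := by
    apply Real.le_sqrt_of_sq_le
    rw [mul_pow, Real.sq_sqrt (by norm_num)]; linarith
  have hl1 : harmLead 2 = 1 / 2 := by simp [harmLead]
  have hc1 : harmConst 2 = (Real.eulerMascheroniConstant + Real.log 2) / 2 := by simp [harmConst]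
  have h := abs_sqfreeRem_le (v := 2) (Or.inr rfl) (w := 3) (ε := 0.072) (κ := 5 / 16) (ρ := 4 / 9)
    (c₀ := 8 / 9) (by norm_num) (by norm_num) (by norm_num) (by norm_num) hX0
    (fun t ht => abs_mertens_two_le (le_trans (by rw [le_div_iff₀ (by linarith)]; exact hs2) ht))
    (fun y => harmCop_two_eq_one) (by rw [hl1, hc1]; linarith) (by rw [hl1, hc1]; linarith)
    sum_abs_muCop_two_le
    (fun y hy => by
      rw [harmErr, hl1, hc1]
      exact harmCop_two_error hy)
  refine h.trans ?_
  have hT := tailCoeff_two_le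
  have hh := large_bound_le (s := √X) (r := √3) (ρ := 4 / 9) (c₀ := 8 / 9) (κ := 5 / 16)
    (T := 0.072 * tailCoeff 2 3) (D := 0.409) (S := 1 / 348) (u := 1 / 1.732) (by linarith)
    (by linarith) (by norm_num) (by norm_num) (by norm_num)
    (by rw [inv_eq_one_div]; gcongr) (by rw [inv_eq_one_div]; gcongr)
    (by norm_num at hT ⊢; linarith)
  rwa [Real.sq_sqrt hX0.le, mul_div_assoc (0.072 : ℝ)] at hh

end SqfreeAverage


namespace SqfreeAverage

open Finset Filter Topology

/-! ### The remainder on a finite range -/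

/-- The product of the primes below `353`. -/
def primeProd : ℕ :=
  261546705642188677527611215060743478325487449257450867559845540208082579687704696223087912212929304531286298200244292923511657074872113330370

theorem primeProd_spec : ∀ p < 353, p.Prime → p ∣ primeProd ∧ ¬ p * p ∣ primeProd := by
  decide +kernel

/-- A test for squarefreeness, valid below `353 ^ 2`. -/
def sqfreeTest (n : ℕ) : Bool := Nat.beq (Nat.gcd (n / Nat.gcd n primeProd) primeProd) 1

/-- The gcd with `primeProd` takes each small prime of `n` once, so a small prime left in the
quotient is a repeated factor. Below `353²` every repeated prime is small. -/
theorem sqfreeTest_iff {n : ℕ} (hn : 0 < n) (hn' : n < 353 * 353) :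
    sqfreeTest n = true ↔ Squarefree n := by
  have hm : Nat.gcd n primeProd * (n / Nat.gcd n primeProd) = n :=
    Nat.mul_div_cancel' (Nat.gcd_dvd_left _ _)
  unfold sqfreeTest
  rw [Nat.beq_eq]
  constructor
  · intro h
    rw [Nat.squarefree_iff_prime_squarefree]
    intro p hp hpn
    have hlt : p < 353 := by
      have := Nat.le_of_dvd hn hpn
      by_contra hc
      nlinarith
    obtain ⟨h1, h2⟩ := primeProd_spec p hlt hp
    have h3 : p ∣ n / Nat.gcd n primeProd := by
      by_contra hc
      rw [← hm] at hpn
      have hco : Nat.Coprime (p * p) (n / Nat.gcd n primeProd) :=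
        Nat.Coprime.mul_left ((Nat.Prime.coprime_iff_not_dvd hp).2 hc)
          ((Nat.Prime.coprime_iff_not_dvd hp).2 hc)
      exact h2 ((hco.dvd_of_dvd_mul_right hpn).trans (Nat.gcd_dvd_right _ _))
    have := Nat.dvd_gcd h3 h1
    rw [h] at this
    exact hp.one_lt.ne' (Nat.dvd_one.1 this)
  · intro h
    by_contra hc
    obtain ⟨p, hp, hpd⟩ := Nat.exists_prime_and_dvd hc
    have h1 := hpd.trans (Nat.gcd_dvd_left _ _)
    have h2 := hpd.trans (Nat.gcd_dvd_right _ _)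
    have h3 : p ∣ Nat.gcd n primeProd :=
      Nat.dvd_gcd (h1.trans (Nat.div_dvd_of_dvd (Nat.gcd_dvd_left _ _))) h2
    have h4 := mul_dvd_mul h3 h1
    rw [hm] at h4
    exact (Nat.squarefree_iff_prime_squarefree.1 h) p hp h4

/-- Data for the verification of `|sqfreeRem v X| √X ≤ D` in fixed point arithmetic, with unit
`10 ^ (-12)`. -/
structure RemData where
  /-- only odd integers are counted -/
  odd : Bool
  /-- lower bound for the density -/
  lo : ℕ
  /-- upper bound for the density -/
  hi : ℕ
  /-- lower bound for the constant term -/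
  cLo : ℕ
  /-- upper bound for the constant term -/
  cHi : ℕ
  /-- the square of the bound -/
  bd : ℕ

/-- The verification step; the state holds the two truncated sums. -/
def remStep (r : RemData) (n : ℕ) : ℕ × ℕ → Option (ℕ × ℕ)
  | (s, h) =>
    let s' := bif (Nat.beq (n % 2) 1 || !r.odd) && sqfreeTest n then s + 10 ^ 12 / n else s
    let h' := h + r.lo / n
    let u := (s' + n + r.hi / (2 * n) + 1) - (h' + r.cLo)
    let l := (h' + n + 13 * (r.hi - r.lo) + r.hi * (6 * n + 7) / (12 * ((n + 1) * (n + 1))) + 1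
      + r.cHi) - s'
    bif Nat.ble (u * u * (n + 1)) r.bd && Nat.ble (l * l * (n + 1)) r.bd then some (s', h')
      else none

/-- The truncation of `sqfreeSum 1 v` at an integer. -/
noncomputable def sqfreeHarm (v N : ℕ) : ℝ :=
  ∑ l ∈ (Icc 1 N).filter (fun l => Nat.Coprime l v), (ArithmeticFunction.moebius l : ℝ) ^ 2 / l

theorem sqfreeSum_one_eq_sqfreeHarm (v : ℕ) (X : ℝ) :
    sqfreeSum 1 v X = sqfreeHarm v ⌊X⌋₊ := by simp [sqfreeSum, sqfreeHarm]

theorem sqfreeHarm_succ (v N : ℕ) : sqfreeHarm v (N + 1) = sqfreeHarm v N +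
    (if Nat.Coprime (N + 1) v ∧ Squarefree (N + 1) then 1 / ((N + 1 : ℕ) : ℝ) else 0) := by
  unfold sqfreeHarm
  rw [← Finset.insert_Icc_right_eq_Icc_add_one (show 1 ≤ N + 1 by omega), filter_insert]
  split_ifs with h1 h2 h2
  · rw [sum_insert (by simp), add_comm]
    congr 1
    have := ArithmeticFunction.moebius_sq_eq_one_of_squarefree h2.2
    have : (ArithmeticFunction.moebius (N + 1) : ℝ) ^ 2 = 1 := by exact_mod_cast this
    rw [this]
  · rw [sum_insert (by simp),
      ArithmeticFunction.moebius_eq_zero_of_not_squarefree fun h => h2 ⟨h1, h⟩]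
    simp
  · exact absurd h2.1 h1
  · simp

theorem div_lt_natDiv_add_one (a : ℕ) {b : ℕ} (hb : 0 < b) :
    (a : ℝ) / b < (a / b : ℕ) + 1 := by
  have hb' : (0 : ℝ) < b := by exact_mod_cast hb
  rw [div_lt_iff₀ hb']
  have h := Nat.lt_div_mul_add (a := a) hb
  have : (a : ℝ) < (a / b : ℕ) * b + b := by exact_mod_cast h
  linarith

theorem harm_le_thirteen {n : ℕ} (hn : n ≤ 353 * 353) : harm n ≤ 13 := by
  rcases Nat.eq_zero_or_pos n with rfl | hn0
  · simp [harm]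
  have h1 := harm_le (n := n) hn0
  have h2 := eulerMascheroni_bounds
  have h3 : (1 : ℝ) ≤ n := by exact_mod_cast hn0
  have h4 : Real.log n ≤ Real.log (2 ^ 17) := by
    apply Real.log_le_log (by linarith)
    have : (n : ℝ) ≤ 353 * 353 := by exact_mod_cast hn
    linarith
  rw [Real.log_pow] at h4
  have h5 := Real.log_two_lt_d9
  have h6 : 1 / (2 * (n : ℝ)) ≤ 1 / 2 := by
    apply one_div_le_one_div_of_le <;> linarith
  push_cast at h4
  linarith

/-- One integer comparison at the right end `n + 1` covers all `X < n + 1`; squaring removes the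
root. -/
theorem mul_sqrt_le_of_sq {R u D X : ℝ} {n : ℕ} (hX : 0 < X) (hXn : X < n + 1) (hD : 0 ≤ D)
    (hR : 10 ^ 12 * R ≤ u) (hu : 0 ≤ u) (h : u * u * (n + 1) ≤ (10 ^ 12 * D) ^ 2) :
    R ≤ D / √X := by
  have hs : 0 < √X := Real.sqrt_pos.2 hX
  rw [le_div_iff₀ hs]
  have h1 : (u * √X) ^ 2 ≤ (10 ^ 12 * D) ^ 2 := by
    rw [mul_pow, Real.sq_sqrt hX.le, sq u]
    refine le_trans ?_ h
    gcongr
  have h2 := (sq_le_sq₀ (by positivity) (by positivity)).1 h1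
  nlinarith

/-- The hypotheses under which the verification data are valid. -/
structure RemData.Valid (r : RemData) (v : ℕ) (D : ℝ) : Prop where
  odd : ∀ n, Nat.Coprime n v ↔ (Nat.beq (n % 2) 1 || !r.odd) = true
  lo : (r.lo : ℝ) ≤ 10 ^ 12 * beta v
  hi : 10 ^ 12 * beta v ≤ r.hi
  cLo : (r.cLo : ℝ) ≤ 10 ^ 12 * (beta v * (bConst v - Real.eulerMascheroniConstant))
  cHi : 10 ^ 12 * (beta v * (bConst v - Real.eulerMascheroniConstant)) ≤ r.cHi
  bd : (r.bd : ℝ) = (10 ^ 12 * D) ^ 2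
  nonneg : 0 ≤ D

/-- The state underestimates the scaled sums, by less than one unit for each term. Replacing `log X`
by the harmonic number up to explicit corrections cancels `γ`, so only `beta v * (bConst v - γ)` has
to be bounded and no logarithm is evaluated. The integers `u` and `l` bound the scaled remainder
from above and its negative; truncated subtraction only enlarges them. -/
theorem remStep_spec {r : RemData} {v : ℕ} {D : ℝ} (hr : r.Valid v D) (n : ℕ) (t t' : ℕ × ℕ)
    (h : 1 ≤ n ∧ (n ≤ 353 * 353 → ((t.1 : ℝ) ≤ 10 ^ 12 * sqfreeHarm v (n - 1) ∧
      10 ^ 12 * sqfreeHarm v (n - 1) ≤ t.1 + (n - 1 : ℕ)) ∧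
      ((t.2 : ℝ) ≤ r.lo * harm (n - 1) ∧ r.lo * harm (n - 1) ≤ t.2 + (n - 1 : ℕ))))
    (hs : remStep r n t = some t') :
    (1 ≤ n + 1 ∧ (n + 1 ≤ 353 * 353 → ((t'.1 : ℝ) ≤ 10 ^ 12 * sqfreeHarm v (n + 1 - 1) ∧
      10 ^ 12 * sqfreeHarm v (n + 1 - 1) ≤ t'.1 + (n + 1 - 1 : ℕ)) ∧
      ((t'.2 : ℝ) ≤ r.lo * harm (n + 1 - 1) ∧
        r.lo * harm (n + 1 - 1) ≤ t'.2 + (n + 1 - 1 : ℕ)))) ∧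
    (n < 353 * 353 → ∀ X : ℝ, n ≤ X → X < n + 1 → |sqfreeRem v X| ≤ D / √X) := by
  obtain ⟨s, h₀⟩ := t
  obtain ⟨hn, hinv⟩ := h
  simp only [remStep] at hs
  set s' := bif (Nat.beq (n % 2) 1 || !r.odd) && sqfreeTest n then s + 10 ^ 12 / n else s with hs'
  set h' := h₀ + r.lo / n with hh'
  set u := (s' + n + r.hi / (2 * n) + 1) - (h' + r.cLo) with hu
  set l := (h' + n + 13 * (r.hi - r.lo) + r.hi * (6 * n + 7) / (12 * ((n + 1) * (n + 1))) + 1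
      + r.cHi) - s' with hl
  cases hc : (Nat.ble (u * u * (n + 1)) r.bd && Nat.ble (l * l * (n + 1)) r.bd)
  · rw [hc] at hs; simp at hs
  rw [hc, cond_true, Option.some.injEq] at hs
  subst hs
  have key : n < 353 * 353 → (((s' : ℝ) ≤ 10 ^ 12 * sqfreeHarm v n ∧
      10 ^ 12 * sqfreeHarm v n ≤ s' + n) ∧
      ((h' : ℝ) ≤ r.lo * harm n ∧ r.lo * harm n ≤ h' + n)) := by
    intro hlt
    obtain ⟨⟨h1, h2⟩, h3, h4⟩ := hinv hlt.le
    obtain ⟨m, rfl⟩ := Nat.exists_eq_add_of_le' hn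
    rw [Nat.add_sub_cancel] at h1 h2 h3 h4
    refine ⟨?_, ?_⟩
    · rw [sqfreeHarm_succ]
      by_cases hcs : Nat.Coprime (m + 1) v ∧ Squarefree (m + 1)
      · rw [if_pos hcs]
        have e : s' = s + 10 ^ 12 / (m + 1) := by
          rw [hs', (hr.odd _).1 hcs.1, (sqfreeTest_iff (by omega) hlt).2 hcs.2]; rfl
        rw [e]
        have g1 := div_lt_natDiv_add_one (10 ^ 12) (b := m + 1) (by omega)
        have g2 := Nat.cast_div_le (α := ℝ) (m := 10 ^ 12) (n := m + 1)
        push_cast at h1 h2 g1 g2 ⊢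
        constructor
        · rw [mul_add, mul_one_div]; linarith
        · rw [mul_add, mul_one_div]; linarith
      · rw [if_neg hcs]
        have e : s' = s := by
          have : ((Nat.beq ((m + 1) % 2) 1 || !r.odd) && sqfreeTest (m + 1)) = false := by
            rw [← Bool.not_eq_true, Bool.and_eq_true, ← hr.odd,
              sqfreeTest_iff (by omega) hlt]
            exact hcs
          rw [hs', this]; rfl
        rw [e]
        push_cast at h1 h2 ⊢
        constructor <;> linarith
    · rw [harm_succ, hh']
      have g1 := div_lt_natDiv_add_one r.lo (b := m + 1) (by omega)
      have g2 := Nat.cast_div_le (α := ℝ) (m := r.lo) (n := m + 1)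
      push_cast at h3 h4 g1 g2 ⊢
      constructor
      · rw [mul_add, mul_one_div]; linarith
      · rw [mul_add, mul_one_div]; linarith
  refine ⟨⟨by omega, fun hlt => by simpa using key (by omega)⟩, fun hlt X hX hX' => ?_⟩
  obtain ⟨⟨h1, h2⟩, h3, h4⟩ := key hlt
  simp only [Bool.and_eq_true, Nat.ble_eq] at hc
  have hn1 : (1 : ℝ) ≤ n := by exact_mod_cast hn
  have hX0 : 0 < X := by linarith
  have hfl : ⌊X⌋₊ = n := by rw [Nat.floor_eq_iff hX0.le]; exact ⟨hX, hX'⟩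
  have hbnn : 0 ≤ beta v := by
    have := (Nat.cast_nonneg r.lo).trans hr.lo
    linarith
  have hlh : r.lo ≤ r.hi := by exact_mod_cast hr.lo.trans hr.hi
  have hH0 : 0 ≤ harm n := sum_nonneg fun i _ => by positivity
  have hH13 := harm_le_thirteen hlt.le
  have hRe : sqfreeRem v X = sqfreeHarm v n - beta v * (Real.log X + bConst v) := by
    rw [sqfreeRem, sqfreeSum_one_eq_sqfreeHarm, hfl]
  rw [hRe, abs_le']
  constructor
  · refine mul_sqrt_le_of_sq (u := u) hX0 hX' hr.nonneg ?_ (by positivity) ?_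
    · have hlog : harm n - 1 / (2 * (n : ℝ)) - Real.eulerMascheroniConstant ≤ Real.log X := by
        have := harm_le hn
        have := Real.log_le_log (by linarith) hX
        linarith
      have g1 := div_lt_natDiv_add_one r.hi (b := 2 * n) (by omega)
      have g2 : 10 ^ 12 * beta v * (1 / (2 * (n : ℝ))) ≤ r.hi / ((2 * n : ℕ) : ℝ) := by
        push_cast
        rw [mul_one_div]
        have := hr.hi
        gcongr
      have g3 : r.lo * harm n ≤ 10 ^ 12 * beta v * harm n := mul_le_mul_of_nonneg_right hr.lo hH0
      have g4 : beta v * (harm n - 1 / (2 * (n : ℝ)) - Real.eulerMascheroniConstant)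
        ≤ beta v * Real.log X := mul_le_mul_of_nonneg_left hlog hbnn
      have g5 : ((s' + n + r.hi / (2 * n) + 1 : ℕ) : ℝ) ≤ u + ((h' + r.cLo : ℕ) : ℝ) := by
        exact_mod_cast (by omega : _ ≤ u + (h' + r.cLo))
      have g6 := hr.cLo
      push_cast at g5
      linarith
    · rw [← hr.bd]; exact_mod_cast hc.1
  · refine mul_sqrt_le_of_sq (u := l) hX0 hX' hr.nonneg ?_ (by positivity) ?_
    · have hlog : Real.log X ≤ harm n + (6 * n + 7) / (12 * ((n + 1) * (n + 1)) : ℝ)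
          - Real.eulerMascheroniConstant := by
        have k1 := le_harm (n := n + 1) (by omega)
        rw [harm_succ] at k1
        have k2 := Real.log_le_log hX0 hX'.le
        have k3 : 1 / ((n : ℝ) + 1) - 1 / (2 * ((n : ℝ) + 1)) + 1 / (12 * ((n : ℝ) + 1) ^ 2)
            = (6 * n + 7) / (12 * ((n + 1) * (n + 1)) : ℝ) := by field_simp; ring
        push_cast at k1
        linarith
      have g1 := div_lt_natDiv_add_one (r.hi * (6 * n + 7)) (b := 12 * ((n + 1) * (n + 1)))
        (by positivity)
      have g2 : 10 ^ 12 * beta v * ((6 * n + 7) / (12 * ((n + 1) * (n + 1)) : ℝ)) ≤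
          ((r.hi * (6 * n + 7) : ℕ) : ℝ) / ((12 * ((n + 1) * (n + 1)) : ℕ) : ℝ) := by
        push_cast
        rw [← mul_div_assoc]
        have := hr.hi
        gcongr
      -- The state uses the lower density; `harm n ≤ 13` bounds what this loses on the other side.
      have g3 : 10 ^ 12 * beta v * harm n ≤ r.lo * harm n + 13 * ((r.hi - r.lo : ℕ) : ℝ) := by
        rw [Nat.cast_sub hlh]
        have k1 : 10 ^ 12 * beta v * harm n ≤ r.hi * harm n :=
          mul_le_mul_of_nonneg_right hr.hi hH0
        have k2 : ((r.lo : ℝ)) ≤ r.hi := by exact_mod_cast hlh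
        nlinarith
      have g4 := mul_le_mul_of_nonneg_left hlog hbnn
      have g5 : ((h' + n + 13 * (r.hi - r.lo) + r.hi * (6 * n + 7) / (12 * ((n + 1) * (n + 1))) + 1
          + r.cHi : ℕ) : ℝ) ≤ l + (s' : ℝ) := by
        exact_mod_cast (by omega : _ ≤ l + s')
      have g6 := hr.cHi
      push_cast at g5 g1 g2 g3
      linarith
    · rw [← hr.bd]; exact_mod_cast hc.2

end SqfreeAverage


/-! ### Data and kernel runs for the finite range. -/

namespace SqfreeAverage

open Finset Filter Topology

/-- Verification data for `v = 1`, with bound `0.43`. -/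
def remDataOne : RemData where
  odd := false
  lo := 607920000000
  hi := 607928000000
  cLo := 692880000000
  cHi := 693080000000
  bd := 430000000000 * 430000000000

/-- Verification data for `v = 2`, with bound `0.409`. -/
def remDataTwo : RemData where
  odd := true
  lo := 405280000000
  hi := 405285500000
  cLo := 555560000000
  cHi := 555692000000
  bd := 409000000000 * 409000000000

theorem beta_two_eq : beta 2 = 2 / 3 * beta 1 := by rw [beta_two, beta_one]

theorem remDataOne_valid : remDataOne.Valid 1 0.43 := by
  have h1 := beta_one_bounds
  have h2 := bConst_one_bounds
  have h3 := eulerMascheroni_bounds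
  refine ⟨fun n => by simp [remDataOne], ?_, ?_, ?_, ?_, ?_, by norm_num⟩ <;>
    simp only [remDataOne] <;> push_cast
  · linarith
  · linarith
  · nlinarith
  · nlinarith
  · norm_num

theorem remDataTwo_valid : remDataTwo.Valid 2 0.409 := by
  have h1 := beta_one_bounds
  have h2 := bConst_one_bounds
  have h3 := eulerMascheroni_bounds
  have h4 := Real.log_two_gt_d9
  have h5 := Real.log_two_lt_d9
  refine ⟨fun n => by simp [remDataTwo, Nat.odd_iff], ?_, ?_, ?_, ?_, ?_, by norm_num⟩ <;>
    simp only [remDataTwo, beta_two_eq, bConst_two] <;> push_cast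
  · linarith
  · linarith
  · nlinarith
  · nlinarith
  · norm_num

/-- The run starts at `2`, from the two sums at `1`, because `0.43` fails just below `2`. It reaches
`81921`, past `80802`. -/
theorem binRun_remDataOne :
    ((binRun (remStep remDataOne) 16 2 (1000000000000, 607920000000)).bind fun t =>
      binRun (remStep remDataOne) 14 65538 t).isSome = true := by
  decide +kernel

/-- Four dyadic runs from `1` to `122880`, past `121203`. -/
theorem binRun_remDataTwo :
    ((binRun (remStep remDataTwo) 16 1 (0, 0)).bind fun t =>
      (binRun (remStep remDataTwo) 15 65537 t).bind fun t =>
        (binRun (remStep remDataTwo) 14 98305 t).bind fun t =>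
          binRun (remStep remDataTwo) 13 114689 t).isSome = true := by
  decide +kernel

theorem abs_sqfreeRem_one_le {X : ℝ} (hX : 2 ≤ X) : |sqfreeRem 1 X| ≤ 0.43 / √X := by
  by_cases hl : 80802 ≤ X
  · exact abs_sqfreeRem_one_large hl
  have h0 := binRun_remDataOne
  have hf1 : 2 ≤ ⌊X⌋₊ := Nat.le_floor (by simpa using hX)
  have hf2 : ⌊X⌋₊ < 80802 := (Nat.floor_lt (by linarith)).2 (by simpa using hl)
  have hf3 := Nat.floor_le (by linarith : 0 ≤ X)
  have hf4 := Nat.lt_floor_add_one X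
  have spec := binRun_spec (remStep_spec remDataOne_valid)
  cases h1 : binRun (remStep remDataOne) 16 2 (1000000000000, 607920000000) with
  | none => rw [h1] at h0; simp at h0
  | some m =>
    rw [h1, Option.bind_some] at h0
    obtain ⟨h2, h3⟩ := spec 16 2 _ m ⟨by norm_num, fun _ => by
      simp [sqfreeHarm, harm, remDataOne]; norm_num⟩ h1
    cases h4 : binRun (remStep remDataOne) 14 65538 m with
    | none => rw [h4] at h0; simp at h0
    | some m' =>
      obtain ⟨_, h5⟩ := spec 14 65538 m m' h2 h4
      by_cases h6 : ⌊X⌋₊ < 65538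
      · exact h3 ⌊X⌋₊ (by omega) (by omega) (by omega) X hf3 hf4
      · exact h5 ⌊X⌋₊ (by omega) (by omega) (by omega) X hf3 hf4

theorem abs_sqfreeRem_two_le {X : ℝ} (hX : 1 ≤ X) : |sqfreeRem 2 X| ≤ 0.409 / √X := by
  by_cases hl : 121203 ≤ X
  · exact abs_sqfreeRem_two_large hl
  have h0 := binRun_remDataTwo
  have hf1 : 1 ≤ ⌊X⌋₊ := Nat.le_floor (by simpa using hX)
  have hf2 : ⌊X⌋₊ < 121203 := (Nat.floor_lt (by linarith)).2 (by simpa using hl)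
  have hf3 := Nat.floor_le (by linarith : 0 ≤ X)
  have hf4 := Nat.lt_floor_add_one X
  have spec := binRun_spec (remStep_spec remDataTwo_valid)
  cases h1 : binRun (remStep remDataTwo) 16 1 (0, 0) with
  | none => rw [h1] at h0; simp at h0
  | some m₁ =>
    rw [h1, Option.bind_some] at h0
    obtain ⟨g1, k1⟩ := spec 16 1 _ m₁ ⟨le_rfl, fun _ => by simp [sqfreeHarm, harm]⟩ h1
    cases h2 : binRun (remStep remDataTwo) 15 65537 m₁ with
    | none => rw [h2] at h0; simp at h0
    | some m₂ =>
      rw [h2, Option.bind_some] at h0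
      obtain ⟨g2, k2⟩ := spec 15 65537 _ m₂ g1 h2
      cases h3 : binRun (remStep remDataTwo) 14 98305 m₂ with
      | none => rw [h3] at h0; simp at h0
      | some m₃ =>
        rw [h3, Option.bind_some] at h0
        obtain ⟨g3, k3⟩ := spec 14 98305 _ m₃ g2 h3
        cases h4 : binRun (remStep remDataTwo) 13 114689 m₃ with
        | none => rw [h4] at h0; simp at h0
        | some m₄ =>
          obtain ⟨_, k4⟩ := spec 13 114689 _ m₄ g3 h4
          by_cases c1 : ⌊X⌋₊ < 65537
          · exact k1 ⌊X⌋₊ (by omega) (by omega) (by omega) X hf3 hf4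
          by_cases c2 : ⌊X⌋₊ < 98305
          · exact k2 ⌊X⌋₊ (by omega) (by omega) (by omega) X hf3 hf4
          by_cases c3 : ⌊X⌋₊ < 114689
          · exact k3 ⌊X⌋₊ (by omega) (by omega) (by omega) X hf3 hf4
          · exact k4 ⌊X⌋₊ (by omega) (by omega) (by omega) X hf3 hf4

end SqfreeAverage


namespace SqfreeAverage

open Finset Filter Topology

/-! ### Induction on the prime factors of the modulus -/

/-- `∏_{p ∣ q} (1 + p^{-s})⁻¹`. -/
noncomputable def coprimeDensity (s : ℝ) (q : ℕ) : ℝ :=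
  ∏ p ∈ q.primeFactors, (1 + 1 / (p : ℝ) ^ s)⁻¹

/-- `∏_{p ∣ q} (1 - p^{-1/2})⁻¹`. -/
noncomputable def sqrtFactor (q : ℕ) : ℝ :=
  ∏ p ∈ q.primeFactors, (1 - 1 / (p : ℝ) ^ (1 / 2 : ℝ))⁻¹

theorem rpow_div_kappa (s : ℝ) {q : ℕ} (hq : 0 < q) :
    (q : ℝ) ^ s / kappa s q = coprimeDensity s q := by
  have : (0 : ℝ) < (q : ℝ) ^ s := Real.rpow_pos_of_pos (by exact_mod_cast hq) s
  rw [kappa, coprimeDensity, prod_inv_distrib, div_mul_eq_div_div, div_self this.ne', one_div]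

theorem sqrt_div_phi {q : ℕ} (hq : 0 < q) : √(q : ℝ) / phi (1 / 2) q = sqrtFactor q := by
  have h : (0 : ℝ) < (q : ℝ) ^ (1 / 2 : ℝ) := Real.rpow_pos_of_pos (by exact_mod_cast hq) _
  rw [phi, sqrtFactor, prod_inv_distrib, Real.sqrt_eq_rpow, div_mul_eq_div_div, div_self h.ne',
    one_div]

theorem primeFactors_prime_mul {p q : ℕ} (hp : p.Prime) (hq : 0 < q) :
    (p * q).primeFactors = insert p q.primeFactors := by
  rw [Nat.primeFactors_mul hp.ne_zero hq.ne', hp.primeFactors]; rfl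

theorem coprimeDensity_mul (s : ℝ) {p q : ℕ} (hp : p.Prime) (hq : 0 < q) (hpq : ¬ p ∣ q) :
    coprimeDensity s (p * q) = (1 + 1 / (p : ℝ) ^ s)⁻¹ * coprimeDensity s q := by
  rw [coprimeDensity, primeFactors_prime_mul hp hq, prod_insert, coprimeDensity]
  exact fun h => hpq (Nat.dvd_of_mem_primeFactors h)

theorem sqrtFactor_mul {p q : ℕ} (hp : p.Prime) (hq : 0 < q) (hpq : ¬ p ∣ q) :
    sqrtFactor (p * q) = (1 - 1 / (p : ℝ) ^ (1 / 2 : ℝ))⁻¹ * sqrtFactor q := by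
  rw [sqrtFactor, primeFactors_prime_mul hp hq, prod_insert, sqrtFactor]
  exact fun h => hpq (Nat.dvd_of_mem_primeFactors h)

theorem bConst_mul {p q : ℕ} (hp : p.Prime) (hq : 0 < q) (hpq : ¬ p ∣ q) :
    bConst (p * q) = bConst q + Real.log p / ((p : ℝ) + 1) := by
  rw [bConst, primeFactors_prime_mul hp hq, sum_insert, bConst]
  · ring
  · exact fun h => hpq (Nat.dvd_of_mem_primeFactors h)

/-- Multiples of `p` in the sum are `p m`, with `p ∤ m` because otherwise `μ` vanishes. -/
theorem sqfreeSum_eq_add (α : ℝ) {p q : ℕ} (hp : p.Prime) (hpq : ¬ p ∣ q) (X : ℝ) :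
    sqfreeSum α q X = sqfreeSum α (p * q) X + 1 / (p : ℝ) ^ α * sqfreeSum α (p * q) (X / p) := by
  have hcop : ∀ l : ℕ, Nat.Coprime l (p * q) ↔ ¬ p ∣ l ∧ Nat.Coprime l q := fun l => by
    rw [Nat.coprime_mul_iff_right, Nat.coprime_comm, Nat.Prime.coprime_iff_not_dvd hp]
  unfold sqfreeSum
  rw [← sum_filter_not_add_sum_filter _ (fun l => p ∣ l)]
  congr 1
  · rw [filter_filter]
    refine sum_congr (filter_congr fun l _ => ?_) fun _ _ => rfl
    rw [hcop, and_comm]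
  · rw [mul_sum, Nat.floor_div_natCast]
    symm
    have hinj : Set.InjOn (fun m => p * m)
        ((Icc 1 (⌊X⌋₊ / p)).filter fun l => Nat.Coprime l (p * q) : Set ℕ) :=
      fun a _ b _ h => Nat.eq_of_mul_eq_mul_left hp.pos h
    have h1 : ∀ m ∈ (Icc 1 (⌊X⌋₊ / p)).filter fun l => Nat.Coprime l (p * q),
        1 / (p : ℝ) ^ α * ((ArithmeticFunction.moebius m : ℝ) ^ 2 / (m : ℝ) ^ α)
          = (ArithmeticFunction.moebius (p * m) : ℝ) ^ 2 / ((p * m : ℕ) : ℝ) ^ α := by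
      intro m hm
      have hm2 := (hcop m).1 (mem_filter.1 hm).2
      rw [ArithmeticFunction.isMultiplicative_moebius.map_mul_of_coprime
        ((Nat.Prime.coprime_iff_not_dvd hp).2 hm2.1), ArithmeticFunction.moebius_apply_prime hp]
      push_cast
      rw [Real.mul_rpow (by positivity) (by positivity)]
      field_simp
    rw [sum_congr rfl h1, ← sum_image (f := fun l : ℕ =>
      (ArithmeticFunction.moebius l : ℝ) ^ 2 / (l : ℝ) ^ α) hinj]
    apply sum_subset
    · intro l hl
      obtain ⟨m, hm, rfl⟩ := mem_image.1 hl
      obtain ⟨hm1, hm2⟩ := mem_filter.1 hm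
      rw [mem_Icc] at hm1
      simp only [mem_filter, mem_Icc]
      refine ⟨⟨⟨Nat.mul_pos hp.pos hm1.1, ?_⟩, ?_⟩, dvd_mul_right _ _⟩
      · rw [mul_comm]; exact (Nat.le_div_iff_mul_le hp.pos).1 hm1.2
      · exact Nat.Coprime.mul_left ((Nat.Prime.coprime_iff_not_dvd hp).2 hpq) ((hcop m).1 hm2).2
    · intro l hl hl'
      simp only [mem_filter, mem_Icc] at hl
      obtain ⟨m, rfl⟩ := hl.2
      by_cases hpm : p ∣ m
      · rw [sq_dvd_moebius_eq_zero hp.two_le (mul_dvd_mul_left p hpm)]; simp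
      · exfalso
        apply hl'
        refine mem_image.2 ⟨m, ?_, rfl⟩
        simp only [mem_filter, mem_Icc, hcop]
        refine ⟨⟨Nat.pos_of_mul_pos_left hl.1.1.1, ?_⟩, hpm, hl.1.2.coprime_mul_left⟩
        rw [Nat.le_div_iff_mul_le hp.pos, mul_comm]; exact hl.1.1.2

/-- The main term of `sqfreeSum α q X`. -/
noncomputable def sqfreeMain (α : ℝ) (q : ℕ) (X : ℝ) : ℝ :=
  if α = 1 then coprimeDensity 1 q * (6 / Real.pi ^ 2) * (Real.log X + bConst q)
  else coprimeDensity α q * (zetaReal α / zetaReal (2 * α))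
    - coprimeDensity 1 q * (6 / ((α - 1) * Real.pi ^ 2)) * (1 / X ^ (α - 1))

/-- The main term obeys the same relation: the factors `1 + p^(-α)` and `1 + p⁻¹` cancel those in
the densities, and for `α = 1` the shift `log p` is compensated by the summand `log p / (p + 1)` of
`bConst`. -/
theorem sqfreeMain_eq_add (α : ℝ) {p q : ℕ} (hp : p.Prime) (hq : 0 < q) (hpq : ¬ p ∣ q) {X : ℝ}
    (hX : 0 < X) :
    sqfreeMain α q X = sqfreeMain α (p * q) X + 1 / (p : ℝ) ^ α * sqfreeMain α (p * q) (X / p) := by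
  have hp0 : (0 : ℝ) < p := by exact_mod_cast hp.pos
  have hpa : (0 : ℝ) < (p : ℝ) ^ α := Real.rpow_pos_of_pos hp0 _
  unfold sqfreeMain
  rw [coprimeDensity_mul 1 hp hq hpq, coprimeDensity_mul α hp hq hpq, bConst_mul hp hq hpq,
    Real.rpow_one]
  split_ifs with h
  · rw [h, Real.rpow_one, Real.log_div hX.ne' hp0.ne']
    have : (p : ℝ) + 1 ≠ 0 := by positivity
    field_simp
    ring
  · have hXa : (0 : ℝ) < X ^ (α - 1) := Real.rpow_pos_of_pos hX _
    have e : (p : ℝ) ^ α = p * (p : ℝ) ^ (α - 1) := by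
      rw [Real.rpow_sub_one hp0.ne']; field_simp
    have hpb : (0 : ℝ) < (p : ℝ) ^ (α - 1) := Real.rpow_pos_of_pos hp0 _
    have hc : α - 1 ≠ 0 := sub_ne_zero.2 h
    rw [Real.div_rpow hX.le hp0.le, e]
    have h1 : (p : ℝ) + 1 ≠ 0 := by positivity
    have h2 : (p : ℝ) * (p : ℝ) ^ (α - 1) + 1 ≠ 0 := by positivity
    have hπ : Real.pi ≠ 0 := Real.pi_ne_zero
    generalize zetaReal α / zetaReal (2 * α) = Z
    field_simp
    ring

/-- The error term of `sqfreeSum α q X`. -/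
noncomputable def sqfreeErr (α : ℝ) (q : ℕ) (X : ℝ) : ℝ := sqfreeSum α q X - sqfreeMain α q X

theorem sqfreeSum_of_lt_one (α : ℝ) (q : ℕ) {X : ℝ} (hX : X < 1) : sqfreeSum α q X = 0 := by
  rw [sqfreeSum, Nat.floor_eq_zero.2 hX]; simp

/-- On `(0, 1)` the sum is empty and the main term explicit. The value of `M` is irrelevant: it only
starts the recursion below. -/
theorem exists_abs_sqfreeErr_le {α : ℝ} (hα : 1 / 2 < α) (q : ℕ) :
    ∃ M, ∀ X, 0 < X → X < 1 → |sqfreeErr α q X| ≤ M / X ^ (α - 1 / 2) := by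
  by_cases h : α = 1
  · refine ⟨|coprimeDensity 1 q * (6 / Real.pi ^ 2)| * (2 + |bConst q|), fun X hX hX1 => ?_⟩
    have hs : 0 < √X := Real.sqrt_pos.2 hX
    have hs1 : √X ≤ 1 := Real.sqrt_le_one.2 hX1.le
    rw [sqfreeErr, sqfreeSum_of_lt_one _ _ hX1, sqfreeMain, if_pos h, zero_sub, abs_neg, abs_mul,
      mul_div_assoc]
    gcongr
    rw [h, show (1 : ℝ) - 1 / 2 = 1 / 2 by norm_num, ← Real.sqrt_eq_rpow, le_div_iff₀ hs]
    have h1 : Real.log X = -2 * Real.log (√X)⁻¹ := by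
      rw [Real.log_inv, Real.log_sqrt hX.le]; ring
    have h2 : Real.log (√X)⁻¹ ≤ (√X)⁻¹ - 1 := Real.log_le_sub_one_of_pos (by positivity)
    have h3 : Real.log X ≤ 0 := Real.log_nonpos hX.le hX1.le
    have h4 : |Real.log X| ≤ 2 * (√X)⁻¹ := by rw [abs_of_nonpos h3]; linarith
    calc |Real.log X + bConst q| * √X ≤ (|Real.log X| + |bConst q|) * √X := by
          gcongr; exact abs_add_le _ _
      _ ≤ (2 * (√X)⁻¹ + |bConst q|) * √X := by gcongr
      _ = 2 + |bConst q| * √X := by field_simp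
      _ ≤ 2 + |bConst q| * 1 := by gcongr
      _ = _ := by ring
  · refine ⟨|coprimeDensity α q * (zetaReal α / zetaReal (2 * α))|
      + |coprimeDensity 1 q * (6 / ((α - 1) * Real.pi ^ 2))|, fun X hX hX1 => ?_⟩
    rw [sqfreeErr, sqfreeSum_of_lt_one _ _ hX1, sqfreeMain, if_neg h, zero_sub, abs_neg, add_div]
    have hXa : 0 < X ^ (α - 1 / 2) := Real.rpow_pos_of_pos hX _
    have hXb : 0 < X ^ (α - 1) := Real.rpow_pos_of_pos hX _
    have h1 : X ^ (α - 1 / 2) ≤ 1 := Real.rpow_le_one hX.le hX1.le (by linarith)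
    have h2 : X ^ (α - 1 / 2) ≤ X ^ (α - 1) :=
      Real.rpow_le_rpow_of_exponent_ge hX hX1.le (by linarith)
    refine (abs_sub _ _).trans (add_le_add ?_ ?_)
    · rw [le_div_iff₀ hXa]
      exact mul_le_of_le_one_right (abs_nonneg _) h1
    · rw [abs_mul, abs_of_pos (show 0 < 1 / X ^ (α - 1) by positivity), mul_one_div]
      gcongr

/-- Iterate `E_{pq}(Y) = E_q(Y) - p^(-α) E_{pq}(Y / p)`. In units of `Y^(-(α - 1/2))` each step
multiplies by `r = p^(-1/2)`, and the argument eventually drops below `1`. -/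
theorem abs_sqfreeErr_mul_le {α : ℝ} (hα : 1 / 2 < α) {p q : ℕ} (hp : p.Prime) (hq : 0 < q)
    (hpq : ¬ p ∣ q) {C : ℝ}
    (h : ∀ X, 0 < X → |sqfreeErr α q X| ≤ C / X ^ (α - 1 / 2)) {X : ℝ} (hX : 0 < X) :
    |sqfreeErr α (p * q) X| ≤ (1 - 1 / (p : ℝ) ^ (1 / 2 : ℝ))⁻¹ * C / X ^ (α - 1 / 2) := by
  obtain ⟨M, hM⟩ := exists_abs_sqfreeErr_le hα (p * q)
  have hp1 : (1 : ℝ) < p := by exact_mod_cast hp.one_lt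
  have hp0 : (0 : ℝ) < p := by linarith
  set r : ℝ := 1 / (p : ℝ) ^ (1 / 2 : ℝ) with hr
  have hr0 : 0 < r := by positivity
  have hr1 : r < 1 := by
    rw [hr, div_lt_one (by positivity)]
    exact Real.one_lt_rpow hp1 (by norm_num)
  -- The bound solves `B ↦ C + r B` from `B = M`: its fixed point is `(1 - r)⁻¹ C`. Larger `K` is
  -- allowed for the same `Y`, and `K → ∞` removes `M`.
  have hstep : ∀ K : ℕ, ∀ Y : ℝ, 0 < Y → Y < (p : ℝ) ^ K →
      |sqfreeErr α (p * q) Y| ≤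
        ((1 - r)⁻¹ * C + (M - (1 - r)⁻¹ * C) * r ^ K) / Y ^ (α - 1 / 2) := by
    intro K
    induction K with
    | zero =>
      intro Y hY hY1
      have := hM Y hY (by simpa using hY1)
      simpa using this
    | succ K ih =>
      intro Y hY hYK
      have hYa : 0 < Y ^ (α - 1 / 2) := Real.rpow_pos_of_pos hY _
      have h1 := ih (Y / p) (by positivity) (by rw [div_lt_iff₀ hp0, ← pow_succ]; exact hYK)
      have h2 := h Y hY
      have h3 : sqfreeErr α (p * q) Y
          = sqfreeErr α q Y - 1 / (p : ℝ) ^ α * sqfreeErr α (p * q) (Y / p) := by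
        rw [sqfreeErr, sqfreeErr, sqfreeErr, sqfreeSum_eq_add α hp hpq,
          sqfreeMain_eq_add α hp hq hpq hY]
        ring
      have h4 : 1 / (p : ℝ) ^ α * (((1 - r)⁻¹ * C + (M - (1 - r)⁻¹ * C) * r ^ K) /
          (Y / p) ^ (α - 1 / 2)) = r * ((1 - r)⁻¹ * C + (M - (1 - r)⁻¹ * C) * r ^ K)
            / Y ^ (α - 1 / 2) := by
        have e : (p : ℝ) ^ α = (p : ℝ) ^ (1 / 2 : ℝ) * (p : ℝ) ^ (α - 1 / 2) := by
          rw [← Real.rpow_add hp0]; congr 1; ring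
        rw [Real.div_rpow hY.le hp0.le, e, hr]
        field_simp
      have h1r : 1 - r ≠ 0 := by linarith
      calc |sqfreeErr α (p * q) Y|
          ≤ |sqfreeErr α q Y| + |1 / (p : ℝ) ^ α * sqfreeErr α (p * q) (Y / p)| := by
            rw [h3]; exact abs_sub _ _
        _ ≤ C / Y ^ (α - 1 / 2) + 1 / (p : ℝ) ^ α *
            (((1 - r)⁻¹ * C + (M - (1 - r)⁻¹ * C) * r ^ K) / (Y / p) ^ (α - 1 / 2)) := by
            rw [abs_mul, abs_of_pos (show 0 < 1 / (p : ℝ) ^ α by positivity)]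
            gcongr
        _ = _ := by
            rw [h4, ← add_div]
            congr 1
            field_simp
            ring
  have ht : Tendsto (fun K : ℕ => ((1 - r)⁻¹ * C + (M - (1 - r)⁻¹ * C) * r ^ K) / X ^ (α - 1 / 2))
      atTop (𝓝 (((1 - r)⁻¹ * C + (M - (1 - r)⁻¹ * C) * 0) / X ^ (α - 1 / 2))) :=
    (((tendsto_pow_atTop_nhds_zero_of_lt_one hr0.le hr1).const_mul _).const_add _).div_const _
  rw [mul_zero, add_zero] at ht
  refine ge_of_tendsto ht ?_
  filter_upwards [(tendsto_pow_atTop_atTop_of_one_lt hp1).eventually_gt_atTop X] with K hK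
  exact hstep K X hX hK

theorem sqfreeErr_congr (α : ℝ) {q q' : ℕ} (hq : 0 < q) (hq' : 0 < q')
    (h : q.primeFactors = q'.primeFactors) (X : ℝ) : sqfreeErr α q X = sqfreeErr α q' X := by
  have hc : ∀ l : ℕ, Nat.Coprime l q ↔ Nat.Coprime l q' := by
    intro l
    rcases Nat.eq_zero_or_pos l with rfl | hl
    · have h1 : q = 1 ↔ q.primeFactors = ∅ := by rw [Nat.primeFactors_eq_empty]; omega
      have h2 : q' = 1 ↔ q'.primeFactors = ∅ := by rw [Nat.primeFactors_eq_empty]; omega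
      rw [Nat.coprime_zero_left, Nat.coprime_zero_left, h1, h2, h]
    · rw [← Nat.disjoint_primeFactors hl.ne' hq.ne', ← Nat.disjoint_primeFactors hl.ne' hq'.ne', h]
  have hm : sqfreeMain α q X = sqfreeMain α q' X := by
    simp only [sqfreeMain, coprimeDensity, bConst, h]
  simp only [sqfreeErr, sqfreeSum, hm, hc]

theorem sqrtFactor_congr {q q' : ℕ} (h : q.primeFactors = q'.primeFactors) :
    sqrtFactor q = sqrtFactor q' := by rw [sqrtFactor, sqrtFactor, h]

/-- Primes are adjoined one at a time; a repeated prime changes neither side, since both depend only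
on the set of prime divisors. -/
theorem abs_sqfreeErr_le_of_odd {α : ℝ} (hα : 1 / 2 < α) {v : ℕ} (hv : v = 1 ∨ v = 2) {C : ℝ}
    (h : ∀ X, 0 < X → |sqfreeErr α v X| ≤ sqrtFactor v * C / X ^ (α - 1 / 2)) (q : ℕ) :
    0 < q → ¬ 2 ∣ q → ∀ X, 0 < X →
      |sqfreeErr α (q * v) X| ≤ sqrtFactor (q * v) * C / X ^ (α - 1 / 2) := by
  have hv0 : 0 < v := by omega
  induction q using induction_on_primes with
  | zero => omega
  | one => intro _ _; simpa using h
  | prime_mul p a hp ih =>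
    intro h0 h2 X hX
    have ha : 0 < a := Nat.pos_of_mul_pos_left h0
    have ih' := ih ha fun h => h2 (dvd_mul_of_dvd_right h p)
    rw [mul_assoc]
    by_cases hpa : p ∣ a * v
    · have e : (p * (a * v)).primeFactors = (a * v).primeFactors := by
        rw [primeFactors_prime_mul hp (by positivity), insert_eq_self]
        exact Nat.mem_primeFactors.2 ⟨hp, hpa, by positivity⟩
      rw [sqfreeErr_congr α (Nat.mul_pos hp.pos (by positivity)) (by positivity) e,
        sqrtFactor_congr e]
      exact ih' X hX
    · rw [sqrtFactor_mul hp (by positivity) hpa, mul_assoc]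
      exact abs_sqfreeErr_mul_le hα hp (by positivity) hpa ih' hX

theorem abs_sqfreeErr_le {α C₁ C₂ : ℝ} (hα : 1 / 2 < α)
    (h1 : ∀ X, 0 < X → |sqfreeErr α 1 X| ≤ C₁ / X ^ (α - 1 / 2))
    (h2 : ∀ X, 0 < X → |sqfreeErr α 2 X| ≤ sqrtFactor 2 * C₂ / X ^ (α - 1 / 2)) {q : ℕ} (hq : 0 < q)
    {X : ℝ} (hX : 0 < X) :
    |sqfreeErr α q X| ≤ sqrtFactor q * (if 2 ∣ q then C₂ else C₁) / X ^ (α - 1 / 2) := by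
  by_cases hq2 : 2 ∣ q
  · rw [if_pos hq2]
    obtain ⟨k, m, hm, rfl⟩ := Nat.exists_eq_two_pow_mul_odd hq.ne'
    have hm0 : 0 < m := hm.pos
    have hk : k ≠ 0 := by
      rintro rfl
      rw [pow_zero, one_mul] at hq2
      have := Nat.odd_iff.1 hm
      omega
    have e : (2 ^ k * m).primeFactors = (m * 2).primeFactors := by
      rw [Nat.primeFactors_mul (by positivity) hm0.ne', Nat.primeFactors_mul hm0.ne' (by norm_num),
        Nat.primeFactors_prime_pow hk Nat.prime_two, Nat.prime_two.primeFactors, union_comm]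
    rw [sqfreeErr_congr α hq (by positivity) e, sqrtFactor_congr e]
    refine abs_sqfreeErr_le_of_odd hα (Or.inr rfl) h2 m hm0 ?_ X hX
    rw [Nat.two_dvd_ne_zero]; exact Nat.odd_iff.1 hm
  · rw [if_neg hq2]
    have := abs_sqfreeErr_le_of_odd hα (v := 1) (C := C₁) (Or.inl rfl)
      (by simpa [sqrtFactor] using h1) q hq hq2 X hX
    simpa using this

end SqfreeAverage


namespace SqfreeAverage

open Finset Filter Topology

/-! ### The zeta function on the positive real axis -/

/-- The terms of the series representing `(s - 1) ζ(s) - 1` for `0 < Re s`. -/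
noncomputable def zetaTerm (n : ℕ) (s : ℂ) : ℂ :=
  (s - 1) * (((n : ℝ) + 1 : ℝ) : ℂ) ^ (-s) + (((n : ℝ) + 1 + 1 : ℝ) : ℂ) ^ (1 - s)
    - (((n : ℝ) + 1 : ℝ) : ℂ) ^ (1 - s)

theorem hasDerivAt_ofReal_cpow (s : ℂ) {t : ℝ} (ht : 0 < t) :
    HasDerivAt (fun t : ℝ => (t : ℂ) ^ s) (s * (t : ℂ) ^ (s - 1)) t := by
  have h := ((hasDerivAt_id (t : ℂ)).cpow_const (c := s)
    (Or.inl (by simpa using ht))).comp_ofReal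
  simpa using h

theorem norm_cpow_neg_sub_le {s : ℂ} (hs : 0 < s.re) {x y : ℝ} (hx : 0 < x) (hxy : x ≤ y) :
    ‖(y : ℂ) ^ (-s) - (x : ℂ) ^ (-s)‖ ≤ ‖s‖ * x ^ (-s.re - 1) * (y - x) := by
  refine norm_image_sub_le_of_norm_deriv_le_segment' (f := fun t : ℝ => (t : ℂ) ^ (-s))
    (f' := fun t : ℝ => -s * (t : ℂ) ^ (-s - 1)) (fun t ht => ?_) (fun t ht => ?_) y
    (Set.mem_Icc.2 ⟨hxy, le_rfl⟩)
  · exact (hasDerivAt_ofReal_cpow _ (hx.trans_le ht.1)).hasDerivWithinAt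
  · rw [norm_mul, norm_neg, Complex.norm_cpow_eq_rpow_re_of_pos (hx.trans_le ht.1)]
    simp only [Complex.sub_re, Complex.neg_re, Complex.one_re]
    refine mul_le_mul_of_nonneg_left ?_ (norm_nonneg _)
    exact Real.rpow_le_rpow_of_nonpos hx ht.1 (by linarith)

/-- With `x = n + 1` the term is `(s - 1) ∫ (x^(-s) - t^(-s)) dt` over `[x, x + 1]`, and the
integrand is `O(x^(-Re s - 1))`. The mean value inequality replaces the integral. -/
theorem norm_zetaTerm_le {s : ℂ} (hs : 0 < s.re) (n : ℕ) :
    ‖zetaTerm n s‖ ≤ ‖s - 1‖ * ‖s‖ * ((n : ℝ) + 1) ^ (-s.re - 1) := by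
  set x : ℝ := (n : ℝ) + 1 with hx
  have hx0 : 0 < x := by positivity
  have h := norm_image_sub_le_of_norm_deriv_le_segment' (a := x) (b := x + 1)
    (C := ‖s - 1‖ * ‖s‖ * x ^ (-s.re - 1))
    (f := fun t : ℝ => (s - 1) * (x : ℂ) ^ (-s) * (t : ℂ) + (t : ℂ) ^ (1 - s))
    (f' := fun t : ℝ => (s - 1) * (x : ℂ) ^ (-s) * 1 + (1 - s) * (t : ℂ) ^ (1 - s - 1))
    (fun t ht => ?_) (fun t ht => ?_) (x + 1) (Set.mem_Icc.2 ⟨by linarith, le_rfl⟩)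
  · rw [add_sub_cancel_left, mul_one] at h
    refine le_trans (le_of_eq ?_) h
    rw [zetaTerm, ← hx]
    congr 1
    push_cast
    ring
  · exact (((hasDerivAt_id (t : ℂ)).const_mul _).comp_ofReal.add
      (hasDerivAt_ofReal_cpow _ (hx0.trans_le ht.1))).hasDerivWithinAt
  · have e : (s - 1) * (x : ℂ) ^ (-s) * 1 + (1 - s) * (t : ℂ) ^ (1 - s - 1)
        = -((s - 1) * ((t : ℂ) ^ (-s) - (x : ℂ) ^ (-s))) := by
      rw [show (1 : ℂ) - s - 1 = -s by ring]; ring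
    rw [e, norm_neg, norm_mul, mul_assoc]
    refine mul_le_mul_of_nonneg_left ?_ (norm_nonneg _)
    refine (norm_cpow_neg_sub_le hs hx0 ht.1).trans ?_
    exact mul_le_of_le_one_right (by positivity) (by linarith [ht.2])

theorem sum_zetaTerm (N : ℕ) (s : ℂ) :
    ∑ n ∈ range N, zetaTerm n s = (s - 1) * ∑ n ∈ range N, (((n : ℝ) + 1 : ℝ) : ℂ) ^ (-s)
      + (((N : ℝ) + 1 : ℝ) : ℂ) ^ (1 - s) - 1 := by
  induction N with
  | zero => simp
  | succ N ih => rw [sum_range_succ, ih, sum_range_succ, zetaTerm]; push_cast; ring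

theorem tsum_zetaTerm_of_one_lt {s : ℂ} (hs : 1 < s.re) :
    ∑' n, zetaTerm n s = (s - 1) * riemannZeta s - 1 := by
  have hsum : Summable fun n => zetaTerm n s := by
    refine Summable.of_norm_bounded (g := fun n : ℕ => ‖s - 1‖ * ‖s‖ * ((n : ℝ) + 1) ^ (-s.re - 1))
      (Summable.mul_left _ ?_) (norm_zetaTerm_le (by linarith))
    have h := (summable_nat_add_iff 1).2
      (Real.summable_nat_rpow (p := -s.re - 1) |>.2 (by linarith))
    simpa using h
  have h1 := hsum.hasSum.tendsto_sum_nat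
  simp_rw [sum_zetaTerm] at h1
  have h2 : Tendsto (fun N : ℕ => ∑ n ∈ range N, (((n : ℝ) + 1 : ℝ) : ℂ) ^ (-s)) atTop
      (𝓝 (riemannZeta s)) := by
    have h3 : Summable fun n : ℕ => 1 / ((n : ℂ) + 1) ^ s := by
      have := (summable_nat_add_iff 1).2 (Complex.summable_one_div_nat_cpow.2 hs)
      simpa using this
    have h4 := h3.hasSum.tendsto_sum_nat
    rw [← zeta_eq_tsum_one_div_nat_add_one_cpow hs] at h4
    refine h4.congr fun N => sum_congr rfl fun n _ => ?_
    rw [Complex.cpow_neg, one_div]; push_cast; rfl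
  have h5 : Tendsto (fun N : ℕ => (((N : ℝ) + 1 : ℝ) : ℂ) ^ (1 - s)) atTop (𝓝 0) := by
    rw [tendsto_zero_iff_norm_tendsto_zero]
    have h6 : Tendsto (fun N : ℕ => ((N : ℝ) + 1) ^ (-(s.re - 1))) atTop (𝓝 0) :=
      (tendsto_rpow_neg_atTop (by linarith)).comp
        (tendsto_atTop_add_const_right _ _ tendsto_natCast_atTop_atTop)
    refine h6.congr fun N => ?_
    rw [Complex.norm_cpow_eq_rpow_re_of_pos (by positivity)]
    simp
  have h7 := ((h2.const_mul (s - 1)).add h5).sub_const 1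
  rw [add_zero] at h7
  exact tendsto_nhds_unique h1 h7

/-- Analytic continuation by the identity theorem, from a neighbourhood of `max α 2`. The half-plane
is cut by a ball so that one summable majorant serves on all of `U`; the comparison function
`riemannZeta₁` is entire, so the pole at `1` is harmless. -/
theorem hasSum_zetaTerm {α : ℝ} (hα : 0 < α) (hα1 : α ≠ 1) :
    HasSum (fun n => zetaTerm n α) ((α - 1) * riemannZeta α - 1) := by
  set U : Set ℂ := {s | α / 2 < s.re} ∩ Metric.ball 0 (α + 3) with hU
  have hUo : IsOpen U := (isOpen_lt continuous_const Complex.continuous_re).inter Metric.isOpen_ball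
  have hUc : IsPreconnected U :=
    ((convex_halfSpace_re_gt _).inter (convex_ball _ _)).isPreconnected
  have hαU : (α : ℂ) ∈ U := by
    refine ⟨by simp; linarith, ?_⟩
    rw [mem_ball_zero_iff, Complex.norm_real, Real.norm_of_nonneg hα.le]; linarith
  have h2U : ((max α 2 : ℝ) : ℂ) ∈ U := by
    refine ⟨by simp [hα], ?_⟩
    rw [mem_ball_zero_iff, Complex.norm_real, Real.norm_of_nonneg (by positivity)]
    exact max_lt (by linarith) (by linarith)
  have hu : Summable fun n : ℕ => (α + 4) * (α + 3) * ((n : ℝ) + 1) ^ (-(α / 2) - 1) := by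
    refine Summable.mul_left _ ?_
    have h := (summable_nat_add_iff 1).2
      (Real.summable_nat_rpow (p := -(α / 2) - 1) |>.2 (by linarith))
    simpa using h
  have hle : ∀ n : ℕ, ∀ s ∈ U, ‖zetaTerm n s‖ ≤
      (α + 4) * (α + 3) * ((n : ℝ) + 1) ^ (-(α / 2) - 1) := by
    intro n s hs
    have hs1 : α / 2 < s.re := hs.1
    have hs2 : ‖s‖ < α + 3 := by simpa using hs.2
    refine (norm_zetaTerm_le (by linarith) n).trans ?_
    have hs3 : ‖s - 1‖ ≤ α + 4 := by
      refine (norm_sub_le _ _).trans ?_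
      rw [norm_one]; linarith
    have h4 : ((n : ℝ) + 1) ^ (-s.re - 1) ≤ ((n : ℝ) + 1) ^ (-(α / 2) - 1) :=
      Real.rpow_le_rpow_of_exponent_le (by linarith [n.cast_nonneg (α := ℝ)]) (by linarith)
    gcongr
  have hd1 : DifferentiableOn ℂ (fun s => ∑' n, zetaTerm n s) U := by
    refine Complex.differentiableOn_tsum_of_summable_norm hu (fun n => ?_) hUo hle
    intro s _
    have hne : (((n : ℝ) + 1 : ℝ) : ℂ) ≠ 0 := Complex.ofReal_ne_zero.2 (by positivity)
    have hne2 : (((n : ℝ) + 1 + 1 : ℝ) : ℂ) ≠ 0 := Complex.ofReal_ne_zero.2 (by positivity)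
    unfold zetaTerm
    have d1 : DifferentiableAt ℂ (fun s : ℂ => (((n : ℝ) + 1 : ℝ) : ℂ) ^ (-s)) s :=
      differentiableAt_id.neg.const_cpow (Or.inl hne)
    have d2 : DifferentiableAt ℂ (fun s : ℂ => (((n : ℝ) + 1 + 1 : ℝ) : ℂ) ^ (1 - s)) s :=
      (differentiableAt_id.const_sub 1).const_cpow (Or.inl hne2)
    have d3 : DifferentiableAt ℂ (fun s : ℂ => (((n : ℝ) + 1 : ℝ) : ℂ) ^ (1 - s)) s :=
      (differentiableAt_id.const_sub 1).const_cpow (Or.inl hne)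
    exact ((((differentiableAt_id.sub_const 1).mul d1).add d2).sub d3).differentiableWithinAt
  have hd2 : DifferentiableOn ℂ (fun s => riemannZeta₁ s - 1) U :=
    (differentiable_riemannZeta₁.sub_const 1).differentiableOn
  have heq : Set.EqOn (fun s => ∑' n, zetaTerm n s) (fun s => riemannZeta₁ s - 1) U := by
    refine (hd1.analyticOnNhd hUo).eqOn_of_preconnected_of_eventuallyEq
      (hd2.analyticOnNhd hUo) hUc h2U ?_
    have hev : ∀ᶠ s : ℂ in 𝓝 ((max α 2 : ℝ) : ℂ), 1 < s.re := by
      refine (isOpen_lt continuous_const Complex.continuous_re).mem_nhds ?_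
      simp
    filter_upwards [hev] with s hs
    have hs1 : s ≠ 1 := by rintro rfl; simp at hs
    rw [tsum_zetaTerm_of_one_lt hs, riemannZeta_eq_inv_sub_mul hs1,
      mul_inv_cancel_left₀ (sub_ne_zero.2 hs1)]
  have hsum : Summable fun n => zetaTerm n (α : ℂ) :=
    Summable.of_norm_bounded hu fun n => hle n _ hαU
  have hne : (α : ℂ) ≠ 1 := by exact_mod_cast hα1
  have := heq hαU
  simp only at this
  rw [riemannZeta_eq_inv_sub_mul hne, mul_inv_cancel_left₀ (sub_ne_zero.2 hne), ← this]
  exact hsum.hasSum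

/-- The terms of the series representing `(α - 1) ζ(α) - 1` for real `α > 0`. -/
noncomputable def zetaTermReal (α : ℝ) (n : ℕ) : ℝ :=
  (α - 1) * ((n : ℝ) + 1) ^ (-α) + ((n : ℝ) + 1 + 1) ^ (1 - α) - ((n : ℝ) + 1) ^ (1 - α)

theorem hasSum_zetaTermReal {α : ℝ} (hα : 0 < α) (hα1 : α ≠ 1) :
    HasSum (zetaTermReal α) ((α - 1) * zetaReal α - 1) := by
  have h := Complex.hasSum_re (hasSum_zetaTerm hα hα1)
  have e1 : (((α : ℂ) - 1) * riemannZeta α - 1).re = (α - 1) * zetaReal α - 1 := by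
    rw [← ofReal_zetaReal, ← Complex.ofReal_one, ← Complex.ofReal_sub, ← Complex.ofReal_mul,
      ← Complex.ofReal_sub, Complex.ofReal_re]
  rw [e1] at h
  refine h.congr_fun fun n => ?_
  rw [zetaTerm, zetaTermReal]
  have e2 : -(α : ℂ) = ((-α : ℝ) : ℂ) := by push_cast; rfl
  have e3 : 1 - (α : ℂ) = ((1 - α : ℝ) : ℂ) := by push_cast; rfl
  have e4 : (α : ℂ) - 1 = ((α - 1 : ℝ) : ℂ) := by push_cast; rfl
  rw [e2, e3, e4, ← Complex.ofReal_cpow (by positivity), ← Complex.ofReal_cpow (by positivity),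
    ← Complex.ofReal_cpow (by positivity), ← Complex.ofReal_mul, ← Complex.ofReal_add,
    ← Complex.ofReal_sub, Complex.ofReal_re]

/-- The terms lie between `0` and a telescoping difference. -/
theorem exists_zetaTermReal_eq {α : ℝ} (hα : 0 < α) (n : ℕ) :
    ∃ c, 0 ≤ c ∧ c ≤ ((n : ℝ) + 1) ^ (-α) - ((n : ℝ) + 1 + 1) ^ (-α) ∧
      zetaTermReal α n = (α - 1) * c := by
  have hx0 : (0 : ℝ) < (n : ℝ) + 1 := by positivity
  set x : ℝ := (n : ℝ) + 1 with hx
  obtain ⟨ξ, hξ, h⟩ := exists_hasDerivAt_eq_slope (fun t : ℝ => t ^ (1 - α))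
    (fun t => (1 - α) * t ^ (1 - α - 1)) (show x < x + 1 by linarith)
    (fun t ht => (Real.hasDerivAt_rpow_const
      (Or.inl (by linarith [ht.1] : (0 : ℝ) < t).ne')).continuousAt.continuousWithinAt)
    (fun t ht => Real.hasDerivAt_rpow_const (Or.inl (by linarith [ht.1] : (0 : ℝ) < t).ne'))
  refine ⟨x ^ (-α) - ξ ^ (-α), ?_, ?_, ?_⟩
  · exact sub_nonneg.2 (Real.rpow_le_rpow_of_nonpos hx0 hξ.1.le (by linarith))
  · exact sub_le_sub_left (Real.rpow_le_rpow_of_nonpos (by linarith [hξ.1]) hξ.2.le (by linarith)) _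
  · rw [zetaTermReal, ← hx]
    rw [add_sub_cancel_left, div_one, show 1 - α - 1 = -α by ring] at h
    linarith

end SqfreeAverage


/-! ### Power sums, and decay of the error term along squares. -/

namespace SqfreeAverage

open Finset Filter Topology

theorem exists_rpow_sub_eq {α x y : ℝ} (hα : 0 < α) (hx : 0 < x) (hxy : x ≤ y) :
    ∃ c, 0 ≤ c ∧ c ≤ x ^ (-α) * (y - x) ∧ y ^ (1 - α) - x ^ (1 - α) = (1 - α) * c := by
  rcases hxy.eq_or_lt with rfl | hlt
  · exact ⟨0, by simp⟩
  obtain ⟨ξ, hξ, h⟩ := exists_hasDerivAt_eq_slope (fun t : ℝ => t ^ (1 - α))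
    (fun t => (1 - α) * t ^ (1 - α - 1)) hlt
    (fun t ht => (Real.hasDerivAt_rpow_const
      (Or.inl (by linarith [ht.1] : (0 : ℝ) < t).ne')).continuousAt.continuousWithinAt)
    (fun t ht => Real.hasDerivAt_rpow_const (Or.inl (by linarith [ht.1] : (0 : ℝ) < t).ne'))
  have hd : 0 < y - x := by linarith
  have hξ0 : 0 < ξ := hx.trans hξ.1
  refine ⟨ξ ^ (-α) * (y - x), by positivity, ?_, ?_⟩
  · exact mul_le_mul_of_nonneg_right
      (Real.rpow_le_rpow_of_nonpos hx hξ.1.le (by linarith)) hd.le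
  · rw [show 1 - α - 1 = -α by ring, eq_div_iff hd.ne'] at h
    linarith

theorem sum_zetaTermReal (α : ℝ) (N : ℕ) :
    ∑ n ∈ range N, zetaTermReal α n = (α - 1) * ∑ n ∈ range N, ((n : ℝ) + 1) ^ (-α)
      + ((N : ℝ) + 1) ^ (1 - α) - 1 := by
  induction N with
  | zero => simp
  | succ N ih => rw [sum_range_succ, ih, sum_range_succ, zetaTermReal]; push_cast; ring

/-- Each term of the series beyond `N` is `α - 1` times a number between `0` and a telescoping
difference, so the whole tail is `(α - 1) C`. -/
theorem exists_zetaReal_eq {α : ℝ} (hα : 0 < α) (hα1 : α ≠ 1) (N : ℕ) :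
    ∃ C, 0 ≤ C ∧ C ≤ ((N : ℝ) + 1) ^ (-α) ∧ (α - 1) * zetaReal α =
      (α - 1) * ∑ n ∈ range N, ((n : ℝ) + 1) ^ (-α) + ((N : ℝ) + 1) ^ (1 - α) + (α - 1) * C := by
  have h0 : α - 1 ≠ 0 := sub_ne_zero.2 hα1
  have hK : ∀ K : ℕ, 0 ≤ (∑ n ∈ range (K + N), zetaTermReal α n
        - ∑ n ∈ range N, zetaTermReal α n) / (α - 1) ∧
      (∑ n ∈ range (K + N), zetaTermReal α n - ∑ n ∈ range N, zetaTermReal α n) / (α - 1)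
        ≤ ((N : ℝ) + 1) ^ (-α) - (((K + N : ℕ) : ℝ) + 1) ^ (-α) := by
    intro K
    induction K with
    | zero => simp
    | succ K ih =>
      obtain ⟨c, hc0, hc1, hc⟩ := exists_zetaTermReal_eq hα (K + N)
      rw [show K + 1 + N = K + N + 1 by ring, sum_range_succ, hc, add_sub_right_comm, add_div,
        mul_div_cancel_left₀ _ h0]
      push_cast at hc1 ih ⊢
      exact ⟨by linarith, by linarith⟩
  have ht := (((hasSum_zetaTermReal hα hα1).tendsto_sum_nat.comp
    (tendsto_add_atTop_nat N)).sub_const (∑ n ∈ range N, zetaTermReal α n)).div_const (α - 1)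
  refine ⟨((α - 1) * zetaReal α - 1 - ∑ n ∈ range N, zetaTermReal α n) / (α - 1),
    ge_of_tendsto' ht fun K => (hK K).1, le_of_tendsto' ht fun K => (hK K).2.trans ?_, ?_⟩
  · linarith [show (0 : ℝ) ≤ (((K + N : ℕ) : ℝ) + 1) ^ (-α) by positivity]
  · rw [mul_div_cancel₀ _ h0, sum_zetaTermReal]; ring

/-- The sum of `m ^ (-α)` over the positive integers `m ≤ y`. -/
noncomputable def powSum (α y : ℝ) : ℝ := ∑ m ∈ Icc 1 ⌊y⌋₊, 1 / (m : ℝ) ^ α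

theorem sum_Icc_one_div_rpow (α : ℝ) (N : ℕ) :
    ∑ m ∈ Icc 1 N, 1 / (m : ℝ) ^ α = ∑ n ∈ range N, ((n : ℝ) + 1) ^ (-α) := by
  induction N with
  | zero => simp
  | succ N ih =>
    rw [sum_Icc_succ_top (by omega), sum_range_succ, ih, Real.rpow_neg (by positivity), one_div]
    push_cast; rfl

/-- Two errors of size at most `⌊y⌋^(-α)` enter with opposite signs, the tail of zeta and the move
from `⌊y⌋` to `y`; the factor `2 ^ α` comes from `⌊y⌋ ≥ y / 2`. -/
theorem abs_powSum_sub_le {α y : ℝ} (hα : 0 < α) (hα1 : α ≠ 1) (hy : 1 ≤ y) :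
    |powSum α y - zetaReal α - y ^ (1 - α) / (1 - α)| ≤ 2 ^ α * y ^ (-α) := by
  have h0 : α - 1 ≠ 0 := sub_ne_zero.2 hα1
  have h0' : 1 - α ≠ 0 := sub_ne_zero.2 hα1.symm
  have hN : 1 ≤ ⌊y⌋₊ := Nat.le_floor (by simpa using hy)
  have hf := Nat.floor_le (by linarith : 0 ≤ y)
  have hf2 := Nat.lt_floor_add_one y
  rw [powSum, sum_Icc_one_div_rpow]
  obtain ⟨k, hk⟩ := Nat.exists_eq_add_of_le' hN
  rw [hk] at hf hf2 ⊢
  push_cast at hf hf2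
  obtain ⟨C, hC0, hC1, hC⟩ := exists_zetaReal_eq hα hα1 k
  obtain ⟨c, hc0, hc1, hc⟩ := exists_rpow_sub_eq hα (show (0 : ℝ) < (k : ℝ) + 1 by positivity) hf
  have hkp : (0 : ℝ) ≤ ((k : ℝ) + 1) ^ (-α) := by positivity
  have hc2 : c ≤ ((k : ℝ) + 1) ^ (-α) :=
    hc1.trans (mul_le_of_le_one_right hkp (by linarith))
  have e1 : zetaReal α = ∑ n ∈ range k, ((n : ℝ) + 1) ^ (-α)
      - ((k : ℝ) + 1) ^ (1 - α) / (1 - α) + C := by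
    have : (α - 1) * zetaReal α = (α - 1) * (∑ n ∈ range k, ((n : ℝ) + 1) ^ (-α)
      - ((k : ℝ) + 1) ^ (1 - α) / (1 - α) + C) := by
      rw [hC]; field_simp; ring
    exact mul_left_cancel₀ h0 this
  have e2 : y ^ (1 - α) / (1 - α) = ((k : ℝ) + 1) ^ (1 - α) / (1 - α) + c := by
    rw [← sub_eq_iff_eq_add', ← sub_div, hc, mul_div_cancel_left₀ _ h0']
  have h2 : ((k : ℝ) + 1) ^ (-α) ≤ 2 ^ α * y ^ (-α) := by
    have e : (2 : ℝ) ^ α * y ^ (-α) = (y / 2) ^ (-α) := by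
      rw [Real.div_rpow (by linarith) (by norm_num), Real.rpow_neg (by norm_num : (0 : ℝ) ≤ 2)]
      field_simp
    rw [e]
    exact Real.rpow_le_rpow_of_nonpos (by linarith)
      (by linarith [k.cast_nonneg (α := ℝ)]) (by linarith)
  rw [sum_range_succ, e1, e2, abs_le]
  constructor <;> linarith

theorem hasSum_moebius_div_rpow {s : ℝ} (hs : 1 < s) :
    HasSum (fun n : ℕ => (ArithmeticFunction.moebius n : ℝ) / (n : ℝ) ^ s) (zetaReal s)⁻¹ := by
  have hs' : 1 < (s : ℂ).re := by simpa using hs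
  have h1 := (ArithmeticFunction.LSeriesSummable_moebius_iff.2 hs').LSeriesHasSum
  rw [LSeriesHasSum, LSeries_moebius_eq_inv hs', LSeries_one_eq_riemannZeta hs',
    ← ofReal_zetaReal, ← Complex.ofReal_inv] at h1
  have h2 := Complex.hasSum_re h1
  rw [Complex.ofReal_re] at h2
  refine h2.congr_fun fun n => ?_
  rcases Nat.eq_zero_or_pos n with rfl | hn
  · simp
  · rw [LSeries.term_of_ne_zero hn.ne', ← Complex.ofReal_natCast,
      ← Complex.ofReal_cpow (by positivity), ← Complex.ofReal_intCast, ← Complex.ofReal_div,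
      Complex.ofReal_re]

theorem abs_sum_moebius_div_sq_sub_le {K : ℕ} (hK : 1 ≤ K) :
    |∑ d ∈ Icc 1 K, muCop 1 d / (d : ℝ) ^ 2 - 6 / Real.pi ^ 2| ≤ 1 / (K : ℝ) := by
  have h1 : ∀ m : ℕ, |∑ d ∈ Icc 1 (m + K), muCop 1 d / (d : ℝ) ^ 2
      - ∑ d ∈ Icc 1 K, muCop 1 d / (d : ℝ) ^ 2| ≤ 1 / (K : ℝ) - 1 / ((m + K : ℕ) : ℝ) := by
    intro m
    induction m with
    | zero => simp
    | succ m ih =>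
      rw [show m + 1 + K = m + K + 1 by ring, sum_Icc_succ_top (by omega), add_sub_right_comm]
      refine (abs_add_le _ _).trans ?_
      have h2 : |muCop 1 (m + K + 1) / ((m + K + 1 : ℕ) : ℝ) ^ 2|
          ≤ 1 / ((m + K : ℕ) : ℝ) - 1 / ((m + K + 1 : ℕ) : ℝ) := by
        have hp : (0 : ℝ) < ((m + K : ℕ) : ℝ) := by exact_mod_cast (by omega : 0 < m + K)
        rw [abs_div, abs_of_nonneg (sq_nonneg (((m + K + 1 : ℕ)) : ℝ))]
        calc _ ≤ 1 / ((m + K + 1 : ℕ) : ℝ) ^ 2 := by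
              gcongr; exact abs_muCop_le_one _ _
          _ ≤ _ := by
              rw [Nat.cast_succ, div_sub_div _ _ hp.ne' (by positivity),
                div_le_div_iff₀ (by positivity) (by positivity)]
              nlinarith
      linarith
  have h2 : Tendsto (fun m : ℕ => ∑ d ∈ Icc 1 (m + K), muCop 1 d / (d : ℝ) ^ 2) atTop
      (𝓝 (6 / Real.pi ^ 2)) := by
    have h3 := hasSum_moebius_div_sq.tendsto_sum_nat.comp (tendsto_add_atTop_nat (K + 1))
    refine h3.congr fun m => ?_
    simp only [Function.comp_apply, ← add_assoc]
    rw [Finset.range_eq_Ico, show Ico 0 (m + K + 1) = Icc 0 (m + K) from rfl,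
      sum_Icc_zero_eq (by simp)]
    simp only [muCop_one]
  have h4 := (h2.sub_const (∑ d ∈ Icc 1 K, muCop 1 d / (d : ℝ) ^ 2)).abs
  rw [abs_sub_comm (∑ d ∈ Icc 1 K, muCop 1 d / (d : ℝ) ^ 2)]
  refine le_of_tendsto' h4 fun m => (h1 m).trans ?_
  linarith [show (0 : ℝ) ≤ 1 / ((m + K : ℕ) : ℝ) by positivity]

/-- At `X = K²` the convolution runs over `d ≤ K`. Each inner sum costs `O(K^(-2α))`, in total
`O(K^(1 - 2α))`; the tail of `∑ μ(d)/d²` costs `K^(2 - 2α) / K`, the same order. What remains is the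
convergence of `∑ μ(d)/d^(2α)` to `1/ζ(2α)`. -/
theorem tendsto_sqfreeErr_one {α : ℝ} (hα : 1 / 2 < α) (hα1 : α ≠ 1) :
    Tendsto (fun K : ℕ => sqfreeErr α 1 ((K : ℝ) ^ 2)) atTop (𝓝 0) := by
  have h0 : 0 < α := by linarith
  have h1a : 1 - α ≠ 0 := sub_ne_zero.2 hα1.symm
  have ha1 : α - 1 ≠ 0 := sub_ne_zero.2 hα1
  have hS : ∀ K : ℕ, 1 ≤ K → sqfreeSum α 1 ((K : ℝ) ^ 2) =
      ∑ d ∈ Icc 1 K, muCop 1 d / (d : ℝ) ^ (2 * α) * powSum α ((K : ℝ) ^ 2 / (d : ℝ) ^ 2) := by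
    intro K hK
    have hK0 : (0 : ℝ) < K := by exact_mod_cast hK
    have h := sum_sqfree_eq (f := fun n => 1 / (n : ℝ) ^ α) (fun m n => by
      push_cast; rw [Real.mul_rpow (by positivity) (by positivity)]; field_simp) 1
      (X := (K : ℝ) ^ 2) (by positivity) (N := K) (by nlinarith)
    simp only [mul_one_div] at h
    rw [sqfreeSum, h]
    refine sum_congr rfl fun d _ => ?_
    have e : ((d ^ 2 : ℕ) : ℝ) ^ α = (d : ℝ) ^ (2 * α) := by
      push_cast
      rw [Real.rpow_mul (by positivity)]; norm_num
    rw [e, powSum]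
    simp
  set W : ℕ → ℝ := fun K => ∑ d ∈ Icc 1 K, muCop 1 d / (d : ℝ) ^ (2 * α) with hW
  have hWt : Tendsto W atTop (𝓝 (zetaReal (2 * α))⁻¹) := by
    have h3 := (hasSum_moebius_div_rpow (s := 2 * α) (by linarith)).tendsto_sum_nat.comp
      (tendsto_add_atTop_nat 1)
    refine h3.congr fun K => ?_
    simp only [Function.comp_apply, hW]
    rw [Finset.range_eq_Ico, show Ico 0 (K + 1) = Icc 0 K from rfl, sum_Icc_zero_eq (by simp)]
    simp only [muCop_one]
  have hbd : ∀ K : ℕ, 1 ≤ K → |sqfreeErr α 1 ((K : ℝ) ^ 2)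
      - (zetaReal α * W K - zetaReal α / zetaReal (2 * α))|
      ≤ (1 / |1 - α| + 2 ^ α) * (K : ℝ) ^ (-(2 * α - 1)) := by
    intro K hK
    have hK0 : (0 : ℝ) < K := by exact_mod_cast hK
    have e1 : ((K : ℝ) ^ 2) ^ (α - 1) = (K : ℝ) ^ (2 * (α - 1)) := by
      rw [Real.rpow_mul hK0.le]; norm_num
    have hterm : ∀ d ∈ Icc 1 K, |muCop 1 d / (d : ℝ) ^ (2 * α) *
        powSum α ((K : ℝ) ^ 2 / (d : ℝ) ^ 2) - (zetaReal α * (muCop 1 d / (d : ℝ) ^ (2 * α))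
          + (K : ℝ) ^ (2 * (1 - α)) / (1 - α) * (muCop 1 d / (d : ℝ) ^ 2))|
        ≤ 2 ^ α * (K : ℝ) ^ (-(2 * α)) := by
      intro d hd
      obtain ⟨hd1, hdK⟩ := mem_Icc.1 hd
      have hd0 : (0 : ℝ) < d := by exact_mod_cast hd1
      have hdK' : (d : ℝ) ≤ K := by exact_mod_cast hdK
      have hp := abs_powSum_sub_le h0 hα1 (y := (K : ℝ) ^ 2 / (d : ℝ) ^ 2)
        (by rw [one_le_div (by positivity)]; gcongr)
      have e2 : ∀ s : ℝ, ((K : ℝ) ^ 2 / (d : ℝ) ^ 2) ^ s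
          = (K : ℝ) ^ (2 * s) / (d : ℝ) ^ (2 * s) := fun s => by
        rw [Real.div_rpow (by positivity) (by positivity), Real.rpow_mul hK0.le,
          Real.rpow_mul hd0.le]; norm_num
      rw [e2, e2] at hp
      have e3 : (d : ℝ) ^ (2 * (1 - α)) = (d : ℝ) ^ 2 / (d : ℝ) ^ (2 * α) := by
        rw [show 2 * (1 - α) = 2 - 2 * α by ring, Real.rpow_sub hd0]; norm_num
      have e4 : (d : ℝ) ^ (2 * -α) = 1 / (d : ℝ) ^ (2 * α) := by
        rw [show 2 * -α = -(2 * α) by ring, Real.rpow_neg hd0.le, one_div]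
      have hda : (0 : ℝ) < (d : ℝ) ^ (2 * α) := by positivity
      rw [e3, e4, show 2 * -α = -(2 * α) by ring] at hp
      have e5 : muCop 1 d / (d : ℝ) ^ (2 * α) * powSum α ((K : ℝ) ^ 2 / (d : ℝ) ^ 2)
          - (zetaReal α * (muCop 1 d / (d : ℝ) ^ (2 * α))
          + (K : ℝ) ^ (2 * (1 - α)) / (1 - α) * (muCop 1 d / (d : ℝ) ^ 2))
          = muCop 1 d / (d : ℝ) ^ (2 * α) * (powSum α ((K : ℝ) ^ 2 / (d : ℝ) ^ 2) - zetaReal α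
            - (K : ℝ) ^ (2 * (1 - α)) / ((d : ℝ) ^ 2 / (d : ℝ) ^ (2 * α)) / (1 - α)) := by
        field_simp
        ring
      rw [e5, abs_mul, abs_div, abs_of_pos hda]
      calc |muCop 1 d| / (d : ℝ) ^ (2 * α) * _
          ≤ 1 / (d : ℝ) ^ (2 * α) *
            (2 ^ α * ((K : ℝ) ^ (-(2 * α)) / (1 / (d : ℝ) ^ (2 * α)))) := by
            gcongr
            exact abs_muCop_le_one 1 d
        _ = _ := by field_simp
    have hsum : |sqfreeSum α 1 ((K : ℝ) ^ 2) - (zetaReal α * W K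
        + (K : ℝ) ^ (2 * (1 - α)) / (1 - α) * ∑ d ∈ Icc 1 K, muCop 1 d / (d : ℝ) ^ 2)|
        ≤ 2 ^ α * (K : ℝ) ^ (-(2 * α - 1)) := by
      rw [hS K hK, hW, mul_sum, mul_sum, ← sum_add_distrib, ← sum_sub_distrib]
      refine (abs_sum_le_sum_abs _ _).trans ((sum_le_sum hterm).trans (le_of_eq ?_))
      rw [sum_const, Nat.card_Icc, nsmul_eq_mul, Nat.add_sub_cancel,
        show -(2 * α - 1) = 1 + -(2 * α) by ring, Real.rpow_add hK0, Real.rpow_one]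
      ring
    have hb := abs_sum_moebius_div_sq_sub_le hK
    have hb2 : |(K : ℝ) ^ (2 * (1 - α)) / (1 - α) *
        (∑ d ∈ Icc 1 K, muCop 1 d / (d : ℝ) ^ 2 - 6 / Real.pi ^ 2)|
        ≤ 1 / |1 - α| * (K : ℝ) ^ (-(2 * α - 1)) := by
      have hKp : (0 : ℝ) < (K : ℝ) ^ (2 * (1 - α)) := by positivity
      rw [abs_mul, abs_div, abs_of_pos hKp]
      calc _ ≤ (K : ℝ) ^ (2 * (1 - α)) / |1 - α| * (1 / (K : ℝ)) := by gcongr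
        _ = _ := by
          rw [show -(2 * α - 1) = 2 * (1 - α) - 1 by ring, Real.rpow_sub_one hK0.ne']
          field_simp
    have e6 : (K : ℝ) ^ (2 * (1 - α)) = 1 / (K : ℝ) ^ (2 * (α - 1)) := by
      rw [show 2 * (1 - α) = -(2 * (α - 1)) by ring, Real.rpow_neg hK0.le, one_div]
    have e7 : sqfreeErr α 1 ((K : ℝ) ^ 2)
        - (zetaReal α * W K - zetaReal α / zetaReal (2 * α))
        = (sqfreeSum α 1 ((K : ℝ) ^ 2) - (zetaReal α * W K
          + (K : ℝ) ^ (2 * (1 - α)) / (1 - α) * ∑ d ∈ Icc 1 K, muCop 1 d / (d : ℝ) ^ 2))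
          + (K : ℝ) ^ (2 * (1 - α)) / (1 - α) *
          (∑ d ∈ Icc 1 K, muCop 1 d / (d : ℝ) ^ 2 - 6 / Real.pi ^ 2) := by
      rw [sqfreeErr, sqfreeMain, if_neg hα1, e1, e6]
      have e8 : 6 / ((α - 1) * Real.pi ^ 2) = -(6 / Real.pi ^ 2 / (1 - α)) := by
        rw [← neg_sub 1 α]; field_simp
      rw [e8]
      simp only [coprimeDensity, Nat.primeFactors_one, prod_empty, one_mul]
      ring
    rw [e7, add_mul]
    refine (abs_add_le _ _).trans ?_
    linarith
  have hz : Tendsto (fun K : ℕ => (1 / |1 - α| + 2 ^ α) * (K : ℝ) ^ (-(2 * α - 1))) atTop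
      (𝓝 0) := by
    have := ((tendsto_rpow_neg_atTop (show 0 < 2 * α - 1 by linarith)).comp
      tendsto_natCast_atTop_atTop).const_mul (1 / |1 - α| + (2 : ℝ) ^ α)
    simpa using this
  have h5 : Tendsto (fun K : ℕ => sqfreeErr α 1 ((K : ℝ) ^ 2)
      - (zetaReal α * W K - zetaReal α / zetaReal (2 * α))) atTop (𝓝 0) := by
    refine squeeze_zero_norm' ?_ hz
    filter_upwards [eventually_ge_atTop 1] with K hK
    exact hbd K hK
  have h6 := h5.add ((hWt.const_mul (zetaReal α)).sub_const (zetaReal α / zetaReal (2 * α)))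
  rw [← div_eq_mul_inv, sub_self, add_zero] at h6
  exact h6.congr fun K => by ring

end SqfreeAverage


namespace SqfreeAverage

open Finset Filter Topology

/-! ### From the logarithmic average to the general exponent -/

theorem sqfreeSum_congr_floor (α : ℝ) (v : ℕ) {X Y : ℝ} (h : ⌊X⌋₊ = ⌊Y⌋₊) :
    sqfreeSum α v X = sqfreeSum α v Y := by rw [sqfreeSum, sqfreeSum, h]

theorem sqfreeSum_succ (α : ℝ) (v n : ℕ) : sqfreeSum α v ((n + 1 : ℕ) : ℝ) = sqfreeSum α v n
    + (if Nat.Coprime (n + 1) v then (ArithmeticFunction.moebius (n + 1) : ℝ) ^ 2 else 0)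
      / ((n + 1 : ℕ) : ℝ) ^ α := by
  unfold sqfreeSum
  rw [Nat.floor_natCast, Nat.floor_natCast,
    ← Finset.insert_Icc_right_eq_Icc_add_one (show 1 ≤ n + 1 by omega), filter_insert]
  split_ifs with h1
  · rw [sum_insert (by simp), add_comm]
  · simp

/-- The error term of exponent `α`, with the contribution of the error term of exponent `1`
removed. -/
noncomputable def sqfreeAdj (α : ℝ) (v : ℕ) (Y : ℝ) : ℝ :=
  sqfreeErr α v Y - Y ^ (1 - α) * sqfreeRem v Y

theorem beta_eq {v : ℕ} (hv : 0 < v) : beta v = coprimeDensity 1 v * (6 / Real.pi ^ 2) := by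
  rw [beta, ← rpow_div_kappa 1 hv, Real.rpow_one]

theorem sqfreeErr_eq {α : ℝ} (hα : α ≠ 1) {v : ℕ} (hv : 0 < v) {X : ℝ} (hX : 0 < X) :
    sqfreeErr α v X = sqfreeSum α v X - coprimeDensity α v * (zetaReal α / zetaReal (2 * α))
      + beta v / (α - 1) * X ^ (1 - α) := by
  rw [sqfreeErr, sqfreeMain, if_neg hα, beta_eq hv, ← neg_sub α 1, Real.rpow_neg hX.le]
  have := sub_ne_zero.2 hα
  field_simp
  ring

/-- The function agreeing with `sqfreeAdj` on a unit interval, when the values of the two sums at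
its left end are prescribed. -/
noncomputable def adjPiece (α A β b s s' t : ℝ) : ℝ :=
  s - A + β / (α - 1) * t ^ (1 - α) - t ^ (1 - α) * (s' - β * (Real.log t + b))

/-- The last factor is the remainder of exponent `1`: this is partial summation written as a
differential equation. -/
theorem hasDerivAt_adjPiece {α : ℝ} (hα : α ≠ 1) (A β b s s' : ℝ) {t : ℝ} (ht : 0 < t) :
    HasDerivAt (adjPiece α A β b s s')
      ((α - 1) * t ^ (-α) * (s' - β * (Real.log t + b))) t := by
  have h1 : HasDerivAt (fun t : ℝ => t ^ (1 - α)) ((1 - α) * t ^ (1 - α - 1)) t :=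
    Real.hasDerivAt_rpow_const (Or.inl ht.ne')
  have h2 : HasDerivAt (fun t : ℝ => s' - β * (Real.log t + b)) (-(β * t⁻¹)) t :=
    (((Real.hasDerivAt_log ht.ne').add_const b).const_mul β).const_sub s'
  have h3 := ((h1.const_mul (β / (α - 1))).const_add (s - A)).sub (h1.mul h2)
  unfold adjPiece
  convert! h3 using 1
  have e : t ^ (1 - α) = t * t ^ (-α) := by
    rw [show 1 - α = 1 + -α by ring, Real.rpow_add ht, Real.rpow_one]
  have := sub_ne_zero.2 hα
  rw [show 1 - α - 1 = -α by ring, e]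
  field_simp
  ring

/-- The right end `n + 1` is included: there the jump `μ²(n+1) (n+1)^(-α)` of the error term equals
that of `t^(1-α)` times the remainder, so `sqfreeAdj` is continuous. -/
theorem sqfreeAdj_eq_adjPiece {α : ℝ} (hα : α ≠ 1) {v n : ℕ} (hv : 0 < v) (hn : 0 < n) {t : ℝ}
    (h1 : n ≤ t) (h2 : t ≤ n + 1) : sqfreeAdj α v t =
      adjPiece α (coprimeDensity α v * (zetaReal α / zetaReal (2 * α))) (beta v) (bConst v)
        (sqfreeSum α v n) (sqfreeSum 1 v n) t := by
  have hn0 : (0 : ℝ) < n := by exact_mod_cast hn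
  have ht : 0 < t := by linarith
  rw [sqfreeAdj, sqfreeErr_eq hα hv ht, sqfreeRem, adjPiece]
  rcases h2.lt_or_eq with h2 | rfl
  · have hf : ⌊t⌋₊ = ⌊(n : ℝ)⌋₊ := by
      rw [Nat.floor_natCast, Nat.floor_eq_iff ht.le]; exact ⟨h1, h2⟩
    rw [sqfreeSum_congr_floor α v hf, sqfreeSum_congr_floor 1 v hf]
  · have e1 := sqfreeSum_succ α v n
    have e2 := sqfreeSum_succ 1 v n
    push_cast at e1 e2
    rw [e1, e2, Real.rpow_one, Real.rpow_sub ht, Real.rpow_one]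
    have : ((n : ℝ) + 1) ^ α ≠ 0 := (Real.rpow_pos_of_pos ht _).ne'
    field_simp
    ring

/-- The derivative is at most `|α - 1| D t^(-α - 1/2)` in absolute value, which is minus the
derivative of the comparison function; so that function plus `±g` is decreasing. -/
theorem abs_sqfreeAdj_sub_le_of_piece {α D : ℝ} (hα : 1 / 2 < α) (hα1 : α ≠ 1) {v n : ℕ}
    (hv : 0 < v) (hn : 0 < n)
    {y z : ℝ} (hD : ∀ t, y ≤ t → |sqfreeRem v t| ≤ D / √t) (hny : n ≤ y) (hyz : y ≤ z)
    (hzn : z ≤ n + 1) :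
    |sqfreeAdj α v z - sqfreeAdj α v y| ≤
      D * (|α - 1| / (α - 1 / 2)) * (y ^ (-(α - 1 / 2)) - z ^ (-(α - 1 / 2))) := by
  have hn0 : (0 : ℝ) < n := by exact_mod_cast hn
  have hy0 : 0 < y := by linarith
  have ha : 0 < α - 1 / 2 := by linarith
  rw [sqfreeAdj_eq_adjPiece hα1 hv hn hny (hyz.trans hzn),
    sqfreeAdj_eq_adjPiece hα1 hv hn (hny.trans hyz) hzn]
  set g := adjPiece α (coprimeDensity α v * (zetaReal α / zetaReal (2 * α))) (beta v) (bConst v)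
    (sqfreeSum α v n) (sqfreeSum 1 v n) with hg
  have hmono : ∀ σ : ℝ, |σ| = 1 → σ * (g z - g y) ≤
      D * (|α - 1| / (α - 1 / 2)) * (y ^ (-(α - 1 / 2)) - z ^ (-(α - 1 / 2))) := by
    intro σ hσ
    have hd : ∀ t, 0 < t → HasDerivAt
        (fun t => D * (|α - 1| / (α - 1 / 2)) * t ^ (-(α - 1 / 2)) + σ * g t)
        (D * (|α - 1| / (α - 1 / 2)) * (-(α - 1 / 2) * t ^ (-(α - 1 / 2) - 1))
          + σ * ((α - 1) * t ^ (-α) * (sqfreeSum 1 v n - beta v * (Real.log t + bConst v)))) t :=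
      fun t ht => ((Real.hasDerivAt_rpow_const (Or.inl ht.ne')).const_mul _).add
        ((hasDerivAt_adjPiece hα1 _ _ _ _ _ ht).const_mul σ)
    have hm : AntitoneOn (fun t => D * (|α - 1| / (α - 1 / 2)) * t ^ (-(α - 1 / 2)) + σ * g t)
        (Set.Icc y z) := by
      apply antitoneOn_of_deriv_nonpos (convex_Icc _ _)
        (fun t ht => (hd t (hy0.trans_le ht.1)).continuousAt.continuousWithinAt)
      · exact fun t ht => (hd t (hy0.trans_le
          (interior_subset ht).1)).differentiableAt.differentiableWithinAt
      · intro t ht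
        rw [interior_Icc] at ht
        have ht0 : 0 < t := hy0.trans ht.1
        rw [(hd t ht0).deriv]
        have hR := hD t ht.1.le
        have hfl : ⌊t⌋₊ = ⌊(n : ℝ)⌋₊ := by
          rw [Nat.floor_natCast, Nat.floor_eq_iff ht0.le]
          exact ⟨by linarith [ht.1], by linarith [ht.2]⟩
        rw [sqfreeRem, sqfreeSum_congr_floor 1 v hfl] at hR
        set r := sqfreeSum 1 v n - beta v * (Real.log t + bConst v) with hr
        have e1 : t ^ (-(α - 1 / 2) - 1) = t ^ (-α) / √t := by
          rw [Real.sqrt_eq_rpow, ← Real.rpow_sub ht0]; congr 1; ring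
        have e2 : D * (|α - 1| / (α - 1 / 2)) * (-(α - 1 / 2) * t ^ (-(α - 1 / 2) - 1))
            = -(|α - 1| * t ^ (-α) * (D / √t)) := by
          rw [e1]
          generalize α - 1 / 2 = a at ha
          field_simp
        have e3 : σ * ((α - 1) * t ^ (-α) * r) ≤ |α - 1| * t ^ (-α) * |r| := by
          refine (le_abs_self _).trans (le_of_eq ?_)
          rw [abs_mul, hσ, one_mul, abs_mul, abs_mul, abs_of_pos (Real.rpow_pos_of_pos ht0 _)]
        have e4 : |α - 1| * t ^ (-α) * |r| ≤ |α - 1| * t ^ (-α) * (D / √t) := by gcongr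
        rw [e2]
        linarith
    have := hm (Set.mem_Icc.2 ⟨le_rfl, hyz⟩) (Set.mem_Icc.2 ⟨hyz, le_rfl⟩) hyz
    simp only at this
    linarith
  rw [abs_le]
  have h1 := hmono 1 (by simp)
  have h2 := hmono (-1) (by simp)
  constructor <;> linarith

theorem abs_sqfreeAdj_sub_le {α D : ℝ} (hα : 1 / 2 < α) (hα1 : α ≠ 1) {v : ℕ}
    (hv : 0 < v) {Y : ℝ} (hY : 1 ≤ Y) (hD : ∀ t, Y ≤ t → |sqfreeRem v t| ≤ D / √t) (m : ℕ) :
    |sqfreeAdj α v ((⌊Y⌋₊ + 1 + m : ℕ) : ℝ) - sqfreeAdj α v Y| ≤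
      D * (|α - 1| / (α - 1 / 2)) *
        (Y ^ (-(α - 1 / 2)) - ((⌊Y⌋₊ + 1 + m : ℕ) : ℝ) ^ (-(α - 1 / 2))) := by
  have hf : 1 ≤ ⌊Y⌋₊ := Nat.le_floor (by simpa using hY)
  have hf2 := Nat.floor_le (by linarith : 0 ≤ Y)
  have hf3 := Nat.lt_floor_add_one Y
  induction m with
  | zero =>
    refine abs_sqfreeAdj_sub_le_of_piece hα hα1 hv hf hD hf2 ?_ ?_ <;> push_cast <;> linarith
  | succ m ih =>
    have h1 := abs_sqfreeAdj_sub_le_of_piece (n := ⌊Y⌋₊ + 1 + m) hα hα1 hv (by omega)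
      (y := ((⌊Y⌋₊ + 1 + m : ℕ) : ℝ)) (z := ((⌊Y⌋₊ + 1 + (m + 1) : ℕ) : ℝ))
      (fun t ht => hD t (le_trans (by push_cast; linarith [m.cast_nonneg (α := ℝ)]) ht)) le_rfl
      (by push_cast; linarith) (by push_cast; linarith)
    have h2 := abs_sub_le (sqfreeAdj α v ((⌊Y⌋₊ + 1 + (m + 1) : ℕ) : ℝ))
      (sqfreeAdj α v ((⌊Y⌋₊ + 1 + m : ℕ) : ℝ)) (sqfreeAdj α v Y)
    linarith

/-- The increments telescope; letting the upper end run to infinity through squares removes the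
value there. -/
theorem abs_sqfreeAdj_le {α D : ℝ} (hα : 1 / 2 < α) (hα1 : α ≠ 1) {v : ℕ} (hv : 0 < v)
    (hlim : Tendsto (fun K : ℕ => sqfreeErr α v ((K : ℝ) ^ 2)) atTop (𝓝 0)) {Y : ℝ} (hY : 1 ≤ Y)
    (hD0 : 0 ≤ D) (hD : ∀ t, Y ≤ t → |sqfreeRem v t| ≤ D / √t) :
    |sqfreeAdj α v Y| ≤ D * (|α - 1| / (α - 1 / 2)) / Y ^ (α - 1 / 2) := by
  have hev : ∀ᶠ K : ℕ in atTop, ⌊Y⌋₊ + 1 ≤ K := eventually_ge_atTop _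
  have hK : ∀ K : ℕ, ⌊Y⌋₊ + 1 ≤ K → |sqfreeAdj α v ((K : ℝ) ^ 2) - sqfreeAdj α v Y| ≤
      D * (|α - 1| / (α - 1 / 2)) / Y ^ (α - 1 / 2) := by
    intro K hK
    obtain ⟨m, hm⟩ := Nat.exists_eq_add_of_le (show ⌊Y⌋₊ + 1 ≤ K ^ 2 by nlinarith)
    have h1 := abs_sqfreeAdj_sub_le hα hα1 hv hY hD m
    rw [← hm] at h1
    push_cast at h1
    refine h1.trans ?_
    rw [div_eq_mul_inv _ (Y ^ (α - 1 / 2)), ← Real.rpow_neg (by linarith)]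
    have hθ : 0 ≤ |α - 1| / (α - 1 / 2) := div_nonneg (abs_nonneg _) (by linarith)
    refine mul_le_mul_of_nonneg_left ?_ (mul_nonneg hD0 hθ)
    linarith [show 0 ≤ ((K : ℝ) ^ 2) ^ (-(α - 1 / 2)) by positivity]
  have hR : Tendsto (fun K : ℕ => ((K : ℝ) ^ 2) ^ (1 - α) * sqfreeRem v ((K : ℝ) ^ 2)) atTop
      (𝓝 0) := by
    have h1 : Tendsto (fun K : ℕ => D * (K : ℝ) ^ (-(2 * α - 1))) atTop (𝓝 0) := by
      have := ((tendsto_rpow_neg_atTop (show 0 < 2 * α - 1 by linarith)).comp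
        tendsto_natCast_atTop_atTop).const_mul D
      simpa using this
    refine squeeze_zero_norm' ?_ h1
    filter_upwards [hev] with K hK
    have hK1 : Y ≤ K := (Nat.lt_floor_add_one Y).le.trans (by exact_mod_cast hK)
    have hK0 : (0 : ℝ) < K := by linarith
    have h2 := hD ((K : ℝ) ^ 2) (by nlinarith)
    rw [Real.sqrt_sq hK0.le] at h2
    rw [Real.norm_eq_abs, abs_mul, abs_of_pos (by positivity)]
    calc _ ≤ ((K : ℝ) ^ 2) ^ (1 - α) * (D / K) := by gcongr
      _ = _ := by
        have e : ((K : ℝ) ^ 2) ^ (1 - α) = (K : ℝ) ^ (2 * (1 - α)) := by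
          rw [Real.rpow_mul hK0.le]; norm_num
        rw [e, show -(2 * α - 1) = 2 * (1 - α) - 1 by ring, Real.rpow_sub_one hK0.ne']
        field_simp
  have hA : Tendsto (fun K : ℕ => |sqfreeAdj α v ((K : ℝ) ^ 2) - sqfreeAdj α v Y|) atTop
      (𝓝 |sqfreeAdj α v Y|) := by
    have h1 := ((hlim.sub hR).sub_const (sqfreeAdj α v Y)).abs
    rwa [sub_zero, zero_sub, abs_neg] at h1
  refine le_of_tendsto hA ?_
  filter_upwards [hev] with K h using hK K h

theorem abs_sqfreeErr_le_of_rem {α D : ℝ} (hα : 1 / 2 < α) (hα1 : α ≠ 1) {v : ℕ} (hv : 0 < v)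
    (hlim : Tendsto (fun K : ℕ => sqfreeErr α v ((K : ℝ) ^ 2)) atTop (𝓝 0)) {Y : ℝ} (hY : 1 ≤ Y)
    (hD0 : 0 ≤ D) (hD : ∀ t, Y ≤ t → |sqfreeRem v t| ≤ D / √t) :
    |sqfreeErr α v Y| ≤ D * (1 + |α - 1| / (α - 1 / 2)) / Y ^ (α - 1 / 2) := by
  have hY0 : 0 < Y := by linarith
  have h1 := abs_sqfreeAdj_le hα hα1 hv hlim hY hD0 hD
  have h2 : |Y ^ (1 - α) * sqfreeRem v Y| ≤ D / Y ^ (α - 1 / 2) := by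
    have h3 := hD Y le_rfl
    have hp : 0 < Y ^ (1 - α) := Real.rpow_pos_of_pos hY0 _
    rw [abs_mul, abs_of_pos hp]
    calc _ ≤ Y ^ (1 - α) * (D / √Y) := by gcongr
      _ = _ := by
        rw [Real.sqrt_eq_rpow, show 1 - α = 1 / 2 - (α - 1 / 2) by ring, Real.rpow_sub hY0]
        have := Real.rpow_pos_of_pos hY0 (1 / 2)
        field_simp
  have h4 : sqfreeErr α v Y = sqfreeAdj α v Y + Y ^ (1 - α) * sqfreeRem v Y := by
    rw [sqfreeAdj]; ring
  rw [h4, mul_add, mul_one, add_div]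
  exact (abs_add_le _ _).trans (by linarith)

end SqfreeAverage


namespace SqfreeAverage

open Finset Filter Topology

/-! ### Small arguments -/

theorem hasSum_one_div_rpow {s : ℝ} (hs : 1 < s) :
    HasSum (fun n : ℕ => 1 / (n : ℝ) ^ s) (zetaReal s) := by
  have hs' : 1 < (s : ℂ).re := by simpa using hs
  have h1 := (Complex.summable_one_div_nat_cpow.2 hs').hasSum
  rw [← zeta_eq_tsum_one_div_nat_cpow hs'] at h1
  refine (Complex.hasSum_re h1).congr_fun fun n => ?_
  rw [← Complex.ofReal_natCast, ← Complex.ofReal_cpow (by positivity), ← Complex.ofReal_one,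
    ← Complex.ofReal_div, Complex.ofReal_re]

theorem zetaReal_pos {s : ℝ} (hs : 1 < s) : 0 < zetaReal s := by
  have h := (hasSum_one_div_rpow hs)
  have h1 := h.summable.le_tsum 1 (fun n _ => by positivity)
  rw [h.tsum_eq] at h1
  norm_num at h1
  linarith

theorem zetaReal_antitone {s t : ℝ} (hs : 1 < s) (hst : s ≤ t) : zetaReal t ≤ zetaReal s := by
  refine hasSum_le (fun n => ?_) (hasSum_one_div_rpow (hs.trans_le hst)) (hasSum_one_div_rpow hs)
  rcases Nat.eq_zero_or_pos n with rfl | hn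
  · have : s ≠ 0 := by linarith
    have : t ≠ 0 := by linarith
    simp [*]
  · have : (1 : ℝ) ≤ n := by exact_mod_cast hn
    gcongr

theorem zetaReal_two : zetaReal 2 = Real.pi ^ 2 / 6 := by
  have h1 := hasSum_one_div_rpow (s := 2) (by norm_num)
  have h2 := hasSum_zeta_two
  refine h1.unique ?_
  convert h2 using 2 with n
  norm_num

theorem zetaReal_mul_bounds {α : ℝ} (hα : 0 < α) (hα1 : α ≠ 1) :
    ∃ C, 0 ≤ C ∧ C ≤ 1 ∧ (α - 1) * zetaReal α = 1 + (α - 1) * C := by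
  obtain ⟨C, h0, h1, h2⟩ := exists_zetaReal_eq hα hα1 0
  refine ⟨C, h0, by simpa using h1, ?_⟩
  rw [h2]; simp

theorem coprimeDensity_pos (s : ℝ) (v : ℕ) : 0 < coprimeDensity s v :=
  prod_pos fun p _ => by positivity

theorem coprimeDensity_mono {s t : ℝ} (h : s ≤ t) (v : ℕ) :
    coprimeDensity s v ≤ coprimeDensity t v := by
  refine prod_le_prod (fun p _ => by positivity) fun p hp => ?_
  have hp1 : (1 : ℝ) ≤ p := by exact_mod_cast (Nat.prime_of_mem_primeFactors hp).one_le
  have : (0 : ℝ) < p := by linarith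
  gcongr

/-- The difference of the two constants in the main term of exponent `α`. -/
noncomputable def mainGap (α : ℝ) (v : ℕ) : ℝ :=
  coprimeDensity α v * (zetaReal α / zetaReal (2 * α)) - beta v / (α - 1)

/-- The gap is a difference quotient: `(α - 1) ζ(α)`, `1 / ζ(2α)` and the density are each at least
their values at `α = 1` (the first continued by `1`) if `α > 1`, and at most if `α < 1`. -/
theorem mainGap_nonneg {α : ℝ} (hα : 1 / 2 < α) (hα1 : α ≠ 1) {v : ℕ} (hv : 0 < v) :
    0 ≤ mainGap α v := by
  obtain ⟨C, hC0, hC1, hC⟩ := zetaReal_mul_bounds (by linarith) hα1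
  have hz := zetaReal_pos (show 1 < 2 * α by linarith)
  have h0 : α - 1 ≠ 0 := sub_ne_zero.2 hα1
  have hg1 := coprimeDensity_pos 1 v
  have hgα := coprimeDensity_pos α v
  have hπ : 6 / Real.pi ^ 2 = (zetaReal 2)⁻¹ := by rw [zetaReal_two, inv_div]
  have e : mainGap α v = (coprimeDensity α v * ((α - 1) * zetaReal α) * (zetaReal (2 * α))⁻¹
      - coprimeDensity 1 v * (zetaReal 2)⁻¹) / (α - 1) := by
    rw [mainGap, beta_eq hv, hπ]
    field_simp
  rw [e, hC]
  rcases lt_or_gt_of_ne hα1 with h | h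
  · apply div_nonneg_of_nonpos _ (by linarith)
    have h1 := zetaReal_antitone (show 1 < 2 * α by linarith) (show 2 * α ≤ 2 by linarith)
    have h2 : (zetaReal (2 * α))⁻¹ ≤ (zetaReal 2)⁻¹ :=
      inv_anti₀ (zetaReal_pos (by norm_num)) h1
    have h3 := coprimeDensity_mono h.le v
    rw [sub_nonpos]
    have h4 : 1 + (α - 1) * C ≤ 1 := by nlinarith
    calc coprimeDensity α v * (1 + (α - 1) * C) * (zetaReal (2 * α))⁻¹
        ≤ coprimeDensity α v * 1 * (zetaReal (2 * α))⁻¹ := by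
          have := inv_nonneg.2 hz.le
          gcongr
      _ ≤ _ := by rw [mul_one]; gcongr
  · apply div_nonneg _ (by linarith)
    have h1 := zetaReal_antitone (show (1 : ℝ) < 2 by norm_num) (show 2 ≤ 2 * α by linarith)
    have h2 : (zetaReal 2)⁻¹ ≤ (zetaReal (2 * α))⁻¹ := inv_anti₀ hz h1
    have h3 := coprimeDensity_mono h.le v
    rw [sub_nonneg]
    have h4 : 1 ≤ 1 + (α - 1) * C := by nlinarith
    calc coprimeDensity 1 v * (zetaReal 2)⁻¹ ≤ coprimeDensity α v * 1 * (zetaReal (2 * α))⁻¹ := by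
          rw [mul_one]
          have := (zetaReal_pos (show (1 : ℝ) < 2 by norm_num)).le
          gcongr
      _ ≤ _ := by
          have := inv_nonneg.2 hz.le
          gcongr

theorem rpow_mul_rpow_one_sub {X : ℝ} (hX : 0 < X) (α : ℝ) :
    X ^ (α - 1 / 2) * X ^ (1 - α) = √X := by
  rw [← Real.rpow_add hX, Real.sqrt_eq_rpow]; congr 1; ring

/-- Separates the two effects for small `X`. For `X ≤ 1` the second summand is nonnegative and for
`X < 1` the first is nonpositive, so each bounds one side. -/
theorem rpow_mul_sqfreeErr {α : ℝ} (hα1 : α ≠ 1) {v : ℕ} (hv : 0 < v) {X : ℝ} (hX : 0 < X) :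
    X ^ (α - 1 / 2) * sqfreeErr α v X = X ^ (α - 1 / 2) * (sqfreeSum α v X - mainGap α v)
      + beta v * ((√X - X ^ (α - 1 / 2)) / (α - 1)) := by
  rw [sqfreeErr_eq hα1 hv hX, mainGap, ← rpow_mul_rpow_one_sub hX α]
  have h0 : α - 1 ≠ 0 := sub_ne_zero.2 hα1
  field_simp
  ring

theorem sqrt_sub_rpow_div_nonneg {α X : ℝ} (hX : 0 < X) (hX1 : X ≤ 1) :
    0 ≤ (√X - X ^ (α - 1 / 2)) / (α - 1) := by
  rw [Real.sqrt_eq_rpow]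
  rcases le_total α 1 with h | h
  · apply div_nonneg_of_nonpos _ (by linarith)
    rw [sub_nonpos]
    exact Real.rpow_le_rpow_of_exponent_ge hX hX1 (by linarith)
  · apply div_nonneg _ (by linarith)
    rw [sub_nonneg]
    exact Real.rpow_le_rpow_of_exponent_ge hX hX1 (by linarith)

/-- The maximum is `2/e`, at `X = e⁻²`. -/
theorem sqrt_mul_neg_log_le {X : ℝ} (hX : 0 < X) : √X * (-Real.log X) ≤ 0.73576 := by
  have hs : 0 < √X := Real.sqrt_pos.2 hX
  have h1 := Real.log_le_sub_one_of_pos (show 0 < Real.exp (-1) * (√X)⁻¹ by positivity)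
  rw [Real.log_mul (Real.exp_pos _).ne' (by positivity), Real.log_exp, Real.log_inv,
    Real.log_sqrt hX.le] at h1
  have h2 : -Real.log X ≤ 2 * (Real.exp (-1) * (√X)⁻¹) := by linarith
  have h3 := Real.exp_neg_one_lt_d9
  calc √X * (-Real.log X) ≤ √X * (2 * (Real.exp (-1) * (√X)⁻¹)) := by gcongr
    _ = 2 * Real.exp (-1) := by field_simp
    _ ≤ 0.73576 := by linarith

theorem sqrt_sub_rpow_div_le_of_one_lt {α X : ℝ} (hα : 1 < α) (hX : 0 < X) :
    (√X - X ^ (α - 1 / 2)) / (α - 1) ≤ 0.73576 := by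
  refine le_trans ?_ (sqrt_mul_neg_log_le hX)
  have hs : 0 < √X := Real.sqrt_pos.2 hX
  have h1 : X ^ (α - 1 / 2) = √X * X ^ (α - 1) := by
    rw [Real.sqrt_eq_rpow, ← Real.rpow_add hX]; congr 1; ring
  have h2 : 1 + Real.log X * (α - 1) ≤ X ^ (α - 1) := by
    rw [Real.rpow_def_of_pos hX]
    linarith [Real.add_one_le_exp (Real.log X * (α - 1))]
  rw [h1, div_le_iff₀ (by linarith)]
  nlinarith

/-- With `a = 1/2 - T` and `y = X^T` this is the maximum of `y^a (1 - y)^T`, attained at `y = 2a`,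
`1 - y = 2T` because `a + T = 1/2`. The logarithms are bounded by their tangents there, and `-log (1
- 2T) ≥ 2T + 2T²` simplifies the value. -/
theorem rpow_sub_sqrt_div_le {T X : ℝ} (hT : 0 < T) (hT1 : T < 1 / 2) (hX : 0 < X) (hX1 : X < 1) :
    (X ^ (1 / 2 - T) - √X) / T ≤ Real.exp (-(1 + T)) / (1 / 2 - T) := by
  have ha : 0 < 1 / 2 - T := by linarith
  set a := 1 / 2 - T with hadef
  set y := X ^ T with hy
  have hy0 : 0 < y := Real.rpow_pos_of_pos hX _
  have hy1 : y < 1 := Real.rpow_lt_one hX.le hX1 hT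
  have e1 : √X = X ^ a * y := by
    rw [hy, Real.sqrt_eq_rpow, ← Real.rpow_add hX, hadef]; congr 1; ring
  have hly : Real.log y = T * Real.log X := by rw [hy, Real.log_rpow hX]
  have hu : 2 * T + 2 * T ^ 2 ≤ -Real.log (2 * a) := by
    have h := Real.hasSum_pow_div_log_of_abs_lt_one (x := 2 * T)
      (by rw [abs_of_pos (by linarith)]; linarith)
    have h2 := sum_le_hasSum (range 2) (fun n _ => by positivity) h
    simp only [sum_range_succ, sum_range_zero] at h2
    rw [show 1 - 2 * T = 2 * a by rw [hadef]; ring] at h2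
    push_cast at h2
    nlinarith
  have h1 := Real.log_le_sub_one_of_pos (show 0 < y / (2 * a) by positivity)
  have h2 := Real.log_le_sub_one_of_pos (show 0 < (1 - y) / (2 * T) by
    apply div_pos <;> linarith)
  rw [Real.log_div hy0.ne' (by linarith), hly] at h1
  rw [Real.log_div (by linarith) (by linarith)] at h2
  have key : Real.log (X ^ a * (1 - y) / T * a) ≤ -(1 + T) := by
    rw [Real.log_mul (by positivity) ha.ne', Real.log_div (by
      have : 0 < 1 - y := by linarith
      positivity) hT.ne', Real.log_mul (by positivity) (by linarith),
      Real.log_rpow hX]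
    have e2 : Real.log (2 * T) = Real.log 2 + Real.log T := Real.log_mul (by norm_num) hT.ne'
    have e3 : Real.log (2 * a) = Real.log 2 + Real.log a := Real.log_mul (by norm_num) ha.ne'
    rw [e2] at h2
    have h3 : a * (T * Real.log X - Real.log (2 * a)) + T * (Real.log (1 - y)
        - (Real.log 2 + Real.log T)) ≤ 0 := by
      have k1 := mul_le_mul_of_nonneg_left h1 ha.le
      have k2 := mul_le_mul_of_nonneg_left h2 hT.le
      have k3 : a * (y / (2 * a) - 1) + T * ((1 - y) / (2 * T) - 1) = 0 := by
        field_simp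
        rw [hadef]; ring
      linarith
    have h5 : T * (a * Real.log X + Real.log (1 - y) - Real.log T + Real.log a)
        ≤ T * (-(1 + T)) := by
      have h6 : a = 1 / 2 - T := hadef
      have h7 : a * Real.log (2 * a) + T * (Real.log 2 + Real.log T)
          = 1 / 2 * Real.log (2 * a) + T * (Real.log T - Real.log a) := by
        rw [e3, h6]; ring
      nlinarith
    have := le_of_mul_le_mul_left h5 hT
    linarith
  have hpos : 0 < X ^ a * (1 - y) / T * a := by
    have : 0 < 1 - y := by linarith
    positivity
  rw [Real.log_le_iff_le_exp hpos] at key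
  rw [e1, le_div_iff₀ ha, show X ^ a - X ^ a * y = X ^ a * (1 - y) by ring]
  exact key

theorem sqrt_sub_rpow_div_le_of_lt_one {α X : ℝ} (hα : 1 / 2 < α) (hα1 : α < 1) (hX : 0 < X)
    (hX1 : X < 1) : (√X - X ^ (α - 1 / 2)) / (α - 1)
      ≤ Real.exp (-(1 + (1 - α))) / (α - 1 / 2) := by
  have h := rpow_sub_sqrt_div_le (T := 1 - α) (by linarith) (by linarith) hX hX1
  rw [show 1 / 2 - (1 - α) = α - 1 / 2 by ring] at h
  rwa [← neg_div_neg_eq, neg_sub, neg_sub]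

theorem rpow_mul_sqfreeErr_le {α : ℝ} (hα : 1 / 2 < α) (hα1 : α ≠ 1) {v : ℕ} (hv : 0 < v) {X : ℝ}
    (hX : 0 < X) (hX1 : X < 1) :
    X ^ (α - 1 / 2) * sqfreeErr α v X ≤ beta v * ((√X - X ^ (α - 1 / 2)) / (α - 1)) := by
  rw [rpow_mul_sqfreeErr hα1 hv hX, sqfreeSum_of_lt_one _ _ hX1]
  have := mul_nonneg (Real.rpow_pos_of_pos hX (α - 1 / 2)).le (mainGap_nonneg hα hα1 hv)
  linarith

theorem beta_pos {v : ℕ} (hv : 0 < v) : 0 < beta v := by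
  rw [beta_eq hv]
  have := coprimeDensity_pos 1 v
  positivity

theorem neg_rpow_mul_sqfreeErr_le {α : ℝ} (hα : 1 / 2 < α) (hα1 : α ≠ 1) {v : ℕ} (hv : 0 < v)
    {X : ℝ} (hX : 0 < X) (hX1 : X < 1) :
    -(X ^ (α - 1 / 2) * sqfreeErr α v X) ≤ mainGap α v := by
  rw [rpow_mul_sqfreeErr hα1 hv hX, sqfreeSum_of_lt_one _ _ hX1]
  have h1 := mul_nonneg (beta_pos hv).le (sqrt_sub_rpow_div_nonneg (α := α) hX hX1.le)
  have h2 : X ^ (α - 1 / 2) ≤ 1 := Real.rpow_le_one hX.le hX1.le (by linarith)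
  have h3 := mul_le_mul_of_nonneg_right h2 (mainGap_nonneg hα hα1 hv)
  linarith

end SqfreeAverage


namespace SqfreeAverage

open Finset Filter Topology

/-! ### The error term for odd moduli -/

theorem sqfreeSum_eq_one (α : ℝ) {X : ℝ} (h1 : 1 ≤ X) (h2 : X < 2) : sqfreeSum α 1 X = 1 := by
  have : ⌊X⌋₊ = 1 := by rw [Nat.floor_eq_iff (by linarith)]; norm_num; exact ⟨h1, by linarith⟩
  rw [sqfreeSum, this]; simp

theorem sqfreeSum_three (α : ℝ) : sqfreeSum α 1 3 = 1 + 1 / 2 ^ α + 1 / 3 ^ α := by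
  have h1 := sqfreeSum_succ α 1 1
  have h2 := sqfreeSum_succ α 1 2
  have h0 := sqfreeSum_eq_one α (le_refl 1) (by norm_num)
  have m2 := ArithmeticFunction.moebius_apply_prime Nat.prime_two
  have m3 := ArithmeticFunction.moebius_apply_prime Nat.prime_three
  norm_num [m2, m3] at h1 h2
  rw [h2, h1, h0]
  simp only [one_div]

theorem beta_mul_bConst_bounds : 1.0437 < beta 1 * bConst 1 ∧ beta 1 * bConst 1 < 1.04397 := by
  have h1 := beta_one_bounds
  have h2 := bConst_one_bounds
  constructor <;> nlinarith

theorem sqfreeRem_one_nonpos {X : ℝ} (h1 : 1 ≤ X) (h2 : X < 2) : sqfreeRem 1 X ≤ 0 := by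
  have h3 := beta_mul_bConst_bounds
  have h4 := mul_nonneg (beta_pos (v := 1) one_pos).le (Real.log_nonneg h1)
  rw [sqfreeRem, sqfreeSum_eq_one 1 h1 h2, mul_add]
  linarith

/-- On `[1, 2)` the remainder is `1 - beta 1 * (log X + bConst 1) ≤ 0`, and the worst case is `X →
2`. -/
theorem abs_sqfreeRem_one_le' {X : ℝ} (hX : 1 ≤ X) : |sqfreeRem 1 X| ≤ 0.66 / √X := by
  rcases lt_or_ge X 2 with h | h
  · have hs : 0 < √X := Real.sqrt_pos.2 (by linarith)
    have hs2 : √X ≤ 1.4143 := Real.sqrt_le_iff.2 ⟨by norm_num, by norm_num; linarith⟩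
    rw [abs_of_nonpos (sqfreeRem_one_nonpos hX h), le_div_iff₀ hs, sqfreeRem,
      sqfreeSum_eq_one 1 hX h]
    have h1 := beta_one_bounds
    have h2 := bConst_one_bounds
    have h3 := Real.log_two_lt_d9
    have h4 := Real.log_le_log (by linarith) h.le
    have h5 : beta 1 * (Real.log X + bConst 1) ≤ 0.607928 * 2.4104 := by
      have := Real.log_nonneg hX
      gcongr
      · linarith
      · linarith
      · linarith
    have h6 := beta_mul_bConst_bounds
    have h7 := mul_nonneg (beta_pos (v := 1) one_pos).le (Real.log_nonneg hX)
    rw [neg_sub]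
    calc (beta 1 * (Real.log X + bConst 1) - 1) * √X
        ≤ (0.607928 * 2.4104 - 1) * 1.4143 := by
          gcongr
      _ ≤ 0.66 := by norm_num
  · refine (abs_sqfreeRem_one_le h).trans ?_
    gcongr
    norm_num

variable {α : ℝ}

theorem one_add_neg_sub_div (h : α - 1 / 2 ≠ 0) :
    1 + -(α - 1) / (α - 1 / 2) = 1 / 2 / (α - 1 / 2) := by
  rw [eq_div_iff h, add_mul, div_mul_cancel₀ _ h]; ring

/-- The bound for `sqfreeAdj` at `Y = 1`, where both sums equal `1`. It shows that the gap is close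
to `1.044` when `α` is near `1`. -/
theorem abs_mainGap_one_sub_le (hα : 1 / 2 < α) (hα1 : α ≠ 1) :
    |mainGap α 1 - beta 1 * bConst 1| ≤ 0.66 * (|α - 1| / (α - 1 / 2)) := by
  have h := abs_sqfreeAdj_le hα hα1 (v := 1) one_pos (tendsto_sqfreeErr_one hα hα1) (le_refl 1)
    (by norm_num) (fun t ht => abs_sqfreeRem_one_le' ht)
  have e : sqfreeAdj α 1 1 = -(mainGap α 1 - beta 1 * bConst 1) := by
    rw [sqfreeAdj, sqfreeErr_eq hα1 one_pos one_pos, sqfreeRem,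
      sqfreeSum_eq_one _ le_rfl (by norm_num), sqfreeSum_eq_one _ le_rfl (by norm_num), mainGap]
    simp only [Real.one_rpow, Real.log_one]
    ring
  rwa [e, abs_neg, Real.one_rpow, div_one] at h

/-- For `0.9 ≤ α < 1.03` the gap is large enough; outside, the first entry of the maximum is. -/
theorem rpow_mul_sqfreeErr_one_le_small (hα : 1 / 2 < α) (hα1 : α ≠ 1) {X : ℝ} (hX : 0 < X)
    (hX1 : X < 1) : X ^ (α - 1 / 2) * sqfreeErr α 1 X
      ≤ max (0.43 * (1 + |α - 1| / (α - 1 / 2))) (mainGap α 1) := by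
  have ha : 0 < α - 1 / 2 := by linarith
  have hK := (abs_le.1 (abs_mainGap_one_sub_le hα hα1)).1
  have hb := beta_mul_bConst_bounds
  have hβ := beta_one_bounds
  refine (rpow_mul_sqfreeErr_le hα hα1 one_pos hX hX1).trans ?_
  rcases lt_or_gt_of_ne hα1 with h | h
  · rw [abs_of_neg (by linarith)] at hK ⊢
    have h1 := sqrt_sub_rpow_div_le_of_lt_one hα h hX hX1
    have h2 : beta 1 * ((√X - X ^ (α - 1 / 2)) / (α - 1)) ≤
        beta 1 * (Real.exp (-(1 + (1 - α))) / (α - 1 / 2)) :=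
      mul_le_mul_of_nonneg_left h1 (by linarith)
    refine h2.trans ?_
    rcases lt_or_ge α 0.9 with h3 | h3
    · refine le_max_of_le_left ?_
      have h4 : Real.exp (-(1 + (1 - α))) ≤ 0.335 :=
        (Real.exp_le_exp.2 (show _ ≤ -(1.1 : ℝ) by linarith)).trans
          (exp_neg_le (by norm_num) (by norm_num))
      rw [← mul_div_assoc, div_le_iff₀ ha]
      have e : 0.43 * (1 + -(α - 1) / (α - 1 / 2)) * (α - 1 / 2) = 0.215 := by
        rw [one_add_neg_sub_div ha.ne', mul_assoc, div_mul_cancel₀ _ ha.ne']; norm_num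
      rw [e]
      nlinarith
    · refine le_max_of_le_right ?_
      have h4 : Real.exp (-(1 + (1 - α))) ≤ 0.37 :=
        (Real.exp_le_exp.2 (show _ ≤ -(1 : ℝ) by linarith)).trans
          (by linarith [Real.exp_neg_one_lt_d9])
      have h5 : -(α - 1) / (α - 1 / 2) ≤ 0.25 := by
        rw [div_le_iff₀ ha]; linarith
      have h6 : beta 1 * (Real.exp (-(1 + (1 - α))) / (α - 1 / 2)) ≤ 0.61 * (0.37 / 0.4) := by
        gcongr
        · linarith
        · linarith
      norm_num at h6 ⊢
      linarith
  · rw [abs_of_pos (by linarith)] at hK ⊢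
    have h1 := sqrt_sub_rpow_div_le_of_one_lt h hX
    have h2 : beta 1 * ((√X - X ^ (α - 1 / 2)) / (α - 1)) ≤ 0.448 := by nlinarith
    refine h2.trans ?_
    rcases lt_or_ge α 1.03 with h3 | h3
    · refine le_max_of_le_right ?_
      have h5 : (α - 1) / (α - 1 / 2) ≤ 0.06 := by
        rw [div_le_iff₀ ha]; linarith
      linarith
    · refine le_max_of_le_left ?_
      have h5 : 0.05 ≤ (α - 1) / (α - 1 / 2) := by
        rw [le_div_iff₀ ha]; linarith
      linarith

/-- Since the remainder of exponent `1` is nonpositive on `[1, 2)`, only `sqfreeAdj` counts, giving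
`0.66 |α - 1| / (α - 1/2)`. This suffices while that ratio is at most `1.8`; for `α < 0.68` the
explicit formula gives `(α - 1/2) X^(α - 1/2) ≤ 0.18 · 1.18 < 0.215`. -/
theorem rpow_mul_sqfreeErr_one_le_mid (hα : 1 / 2 < α) (hα1 : α ≠ 1) {X : ℝ} (hX : 1 ≤ X)
    (hX2 : X < 2) : X ^ (α - 1 / 2) * sqfreeErr α 1 X ≤ 0.43 * (1 + |α - 1| / (α - 1 / 2)) := by
  have ha : 0 < α - 1 / 2 := by linarith
  have hX0 : 0 < X := by linarith
  have hXa : 0 < X ^ (α - 1 / 2) := Real.rpow_pos_of_pos hX0 _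
  have h1 : X ^ (α - 1 / 2) * sqfreeErr α 1 X ≤ 0.66 * (|α - 1| / (α - 1 / 2)) := by
    have h2 := (abs_le.1 (abs_sqfreeAdj_le hα hα1 (v := 1) one_pos (tendsto_sqfreeErr_one hα hα1)
      hX (by norm_num) (fun t ht => abs_sqfreeRem_one_le' (hX.trans ht)))).2
    rw [le_div_iff₀ hXa, mul_comm, sqfreeAdj] at h2
    have h3 := mul_nonneg (mul_nonneg hXa.le (Real.rpow_pos_of_pos hX0 (1 - α)).le)
      (neg_nonneg.2 (sqfreeRem_one_nonpos hX hX2))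
    linarith
  rcases lt_or_gt_of_ne hα1 with h | h
  · rw [abs_of_neg (by linarith)] at h1 ⊢
    rcases lt_or_ge α 0.68 with h3 | h3
    · have e : 0.43 * (1 + -(α - 1) / (α - 1 / 2)) = 0.215 / (α - 1 / 2) := by
        rw [one_add_neg_sub_div ha.ne', ← mul_div_assoc]; norm_num
      rw [e, rpow_mul_sqfreeErr hα1 one_pos hX0, sqfreeSum_eq_one _ hX hX2, le_div_iff₀ ha]
      have h4 := mainGap_nonneg hα hα1 (v := 1) one_pos
      have h5 : X ^ (α - 1 / 2) ≤ √X := by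
        rw [Real.sqrt_eq_rpow]
        exact Real.rpow_le_rpow_of_exponent_le hX (by linarith)
      have h6 : beta 1 * ((√X - X ^ (α - 1 / 2)) / (α - 1)) ≤ 0 :=
        mul_nonpos_of_nonneg_of_nonpos (beta_pos one_pos).le
          (div_nonpos_of_nonneg_of_nonpos (by linarith) (by linarith))
      have h7 : X ^ (α - 1 / 2) ≤ 1 + (α - 1 / 2) * 1 := by
        refine (Real.rpow_le_rpow hX0.le (show X ≤ 1 + 1 by linarith) ha.le).trans ?_
        exact rpow_one_add_le_one_add_mul_self (by norm_num) ha.le (by linarith)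
      have h8 : X ^ (α - 1 / 2) * (1 - mainGap α 1) ≤ X ^ (α - 1 / 2) * 1 := by
        gcongr; linarith
      nlinarith
    · have h5 : -(α - 1) / (α - 1 / 2) ≤ 1.8 := by
        rw [div_le_iff₀ ha]; linarith
      linarith
  · rw [abs_of_pos (by linarith)] at h1 ⊢
    have h5 : (α - 1) / (α - 1 / 2) ≤ 1 := by
      rw [div_le_iff₀ ha]; linarith
    linarith

/-- With `z = X^(α - 1/2)` the claim is `mainGap · (z - 1) + beta 1 · z (X^(1-α) - 1)/(1 - α) ≤ z`;
the two terms are at most `0.37 z` and `0.504 z`. -/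
theorem neg_rpow_mul_sqfreeErr_one_le_of_lt_one (hα : 1 / 2 < α) (hα1 : α < 1) {X : ℝ}
    (hX : 1 ≤ X) (hX2 : X < 2) : -(X ^ (α - 1 / 2) * sqfreeErr α 1 X) ≤ mainGap α 1 := by
  have ha : 0 < α - 1 / 2 := by linarith
  have hX0 : 0 < X := by linarith
  have hK := (abs_le.1 (abs_mainGap_one_sub_le hα hα1.ne)).2
  have hb := beta_mul_bConst_bounds
  have hβ := beta_one_bounds
  rw [rpow_mul_sqfreeErr hα1.ne one_pos hX0, sqfreeSum_eq_one _ hX hX2]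
  rw [abs_of_neg (by linarith)] at hK
  have hT : 0 < 1 - α := by linarith
  have hz : 0 < X ^ (α - 1 / 2) := Real.rpow_pos_of_pos hX0 _
  have hz1 : 1 ≤ X ^ (α - 1 / 2) := Real.one_le_rpow hX ha.le
  have hs : √X = X ^ (α - 1 / 2) * X ^ (1 - α) := (rpow_mul_rpow_one_sub hX0 α).symm
  have hlog : X ^ (α - 1 / 2) - 1 ≤ X ^ (α - 1 / 2) * ((α - 1 / 2) * 0.6932) := by
    have h1 := Real.log_le_sub_one_of_pos (inv_pos.2 hz)
    rw [Real.log_inv, Real.log_rpow hX0] at h1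
    have h2 := Real.log_le_log hX0 hX2.le
    have h3 := Real.log_two_lt_d9
    have h4 : (α - 1 / 2) * Real.log X ≤ (α - 1 / 2) * 0.6932 :=
      mul_le_mul_of_nonneg_left (by linarith) ha.le
    have h5 : 1 - (X ^ (α - 1 / 2))⁻¹ ≤ (α - 1 / 2) * 0.6932 := by linarith
    have h6 := mul_le_mul_of_nonneg_left h5 hz.le
    rwa [mul_sub, mul_one, mul_inv_cancel₀ hz.ne'] at h6
  -- Bernoulli for `√X ≤ 1 + 0.4143` with exponent `2 (1 - α) ≤ 1`.
  have hx : X ^ (1 - α) - 1 ≤ (1 - α) * 0.8286 := by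
    have h1 : √X ≤ 1 + 0.4143 :=
      Real.sqrt_le_iff.2 ⟨by norm_num, by norm_num; linarith⟩
    have h2 : X ^ (1 - α) = √X ^ (2 * (1 - α)) := by
      rw [Real.sqrt_eq_rpow, ← Real.rpow_mul hX0.le]; congr 1; ring
    have h3 : √X ^ (2 * (1 - α)) ≤ (1 + 0.4143) ^ (2 * (1 - α)) :=
      Real.rpow_le_rpow (Real.sqrt_nonneg _) h1 (by linarith)
    have h4 := rpow_one_add_le_one_add_mul_self (s := (0.4143 : ℝ)) (p := 2 * (1 - α))
      (by norm_num) (by linarith) (by linarith)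
    rw [h2]
    linarith
  set z := X ^ (α - 1 / 2) with hzdef
  have e : (√X - z) / (α - 1) = -(z * ((X ^ (1 - α) - 1) / (1 - α))) := by
    rw [hs, ← neg_sub 1 α]; field_simp
  have hP : (X ^ (1 - α) - 1) / (1 - α) ≤ 0.8286 := by
    rw [div_le_iff₀ hT]; linarith
  have hβP : beta 1 * (z * ((X ^ (1 - α) - 1) / (1 - α))) ≤ z * 0.504 := by
    rw [mul_left_comm]
    gcongr
    nlinarith
  have hK2 : mainGap α 1 * (α - 1 / 2) ≤ 1.045 * (α - 1 / 2) + 0.66 * (1 - α) := by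
    have h1 : mainGap α 1 ≤ 1.045 + 0.66 * (-(α - 1) / (α - 1 / 2)) := by linarith
    have h2 := mul_le_mul_of_nonneg_right h1 ha.le
    have e2 : (1.045 + 0.66 * (-(α - 1) / (α - 1 / 2))) * (α - 1 / 2)
        = 1.045 * (α - 1 / 2) + 0.66 * (1 - α) := by
      rw [add_mul, mul_assoc, div_mul_cancel₀ _ ha.ne']; ring
    linarith
  have hK3 : mainGap α 1 * (z - 1) ≤ z * 0.37 := by
    have h1 := mul_le_mul_of_nonneg_left hlog (mainGap_nonneg hα hα1.ne (v := 1) one_pos)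
    have h2 : mainGap α 1 * (z * ((α - 1 / 2) * 0.6932))
        = z * (mainGap α 1 * (α - 1 / 2) * 0.6932) := by ring
    have h3 : z * (mainGap α 1 * (α - 1 / 2) * 0.6932) ≤ z * 0.37 := by
      gcongr
      linarith
    linarith
  rw [e]
  linarith

theorem one_sub_le_trapezoid {y : ℝ} (hy : 0 ≤ y) :
    1 - Real.exp (-y) ≤ y * (1 + Real.exp (-y)) / 2 := by
  have h1 := Real.le_log_one_add_of_nonneg (x := Real.exp y - 1)
    (by linarith [Real.one_le_exp hy])
  rw [add_sub_cancel, Real.log_exp, div_le_iff₀ (by linarith [Real.exp_pos y])] at h1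
  have h2 : Real.exp y * Real.exp (-y) = 1 := by rw [← Real.exp_add]; simp
  have h3 := mul_le_mul_of_nonneg_right h1 (Real.exp_pos (-y)).le
  nlinarith

/-- The bound for `sqfreeAdj` at `Y = 3`, solved for the leading constant. Here `0.24827` is `0.43 /
√3` rounded up, and `0.4605` collects it with `0.2119`; the powers satisfy `3^(1-α) = 2^(1-α)
(2/3)^(α-1)`. -/
theorem leadConst_one_le (hα : 1 < α) :
    coprimeDensity α 1 * (zetaReal α / zetaReal (2 * α)) ≤ 1 + (2 : ℝ) ^ (1 - α) *
      (1 / 2 + 0.4605 * (2 / 3 : ℝ) ^ (α - 1) + beta 1 * (2 / 3 : ℝ) ^ (α - 1) / (α - 1)) := by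
  have ha : 0 < α - 1 / 2 := by linarith
  have hτ : 0 < α - 1 := by linarith
  have h := (abs_le.1 (abs_sqfreeAdj_le (by linarith) hα.ne' (v := 1) one_pos
    (tendsto_sqfreeErr_one (by linarith) hα.ne') (Y := 3) (by norm_num) (D := 0.43) (by norm_num)
    (fun t ht => abs_sqfreeRem_one_le (by linarith)))).1
  rw [sqfreeAdj, sqfreeErr_eq hα.ne' one_pos (by norm_num), sqfreeRem, sqfreeSum_three,
    sqfreeSum_three, abs_of_pos hτ, Real.rpow_one, Real.rpow_one] at h
  set A := coprimeDensity α 1 * (zetaReal α / zetaReal (2 * α)) with hA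
  have e2 : 1 / (2 : ℝ) ^ α = (2 : ℝ) ^ (1 - α) / 2 := by
    rw [Real.rpow_sub (by norm_num), Real.rpow_one]; field_simp
  have e3 : 1 / (3 : ℝ) ^ α = (3 : ℝ) ^ (1 - α) / 3 := by
    rw [Real.rpow_sub (by norm_num), Real.rpow_one]; field_simp
  have e4 : (3 : ℝ) ^ (1 - α) = (2 : ℝ) ^ (1 - α) * (2 / 3 : ℝ) ^ (α - 1) := by
    rw [Real.div_rpow (by norm_num) (by norm_num), ← neg_sub α 1, Real.rpow_neg (by norm_num),
      Real.rpow_neg (by norm_num)]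
    field_simp
  have e5 : 0.43 * ((α - 1) / (α - 1 / 2)) / (3 : ℝ) ^ (α - 1 / 2)
      ≤ 0.24827 * (3 : ℝ) ^ (1 - α) := by
    have h1 : (α - 1) / (α - 1 / 2) ≤ 1 := by rw [div_le_iff₀ ha]; linarith
    have h2 : (3 : ℝ) ^ (1 - α) = √3 / (3 : ℝ) ^ (α - 1 / 2) := by
      rw [Real.sqrt_eq_rpow, ← Real.rpow_sub (by norm_num)]; congr 1; ring
    have h3 : 1.73204 ≤ √3 := Real.le_sqrt_of_sq_le (by norm_num)
    rw [h2, ← mul_div_assoc (0.24827 : ℝ)]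
    rw [div_le_div_iff_of_pos_right (by positivity)]
    linarith
  have h3 := Real.log_three_lt_d9
  have h4 := beta_one_bounds
  have h5 := bConst_one_bounds
  have h6 : beta 1 * (Real.log 3 + bConst 1) ≤ 0.607928 * 2.815863 := by
    have h7 : 0 < Real.log 3 := Real.log_pos (by norm_num)
    gcongr
    · linarith
    · linarith
    · linarith
  rw [e2, e3] at h
  have h7 : (3 : ℝ) ^ (1 - α) * (1 + 1 / 2 + 1 / 3 - beta 1 * (Real.log 3 + bConst 1))
      ≥ (3 : ℝ) ^ (1 - α) * (1 / 3 - 0.2119) := by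
    apply mul_le_mul_of_nonneg_left _ (by positivity)
    norm_num at h6 ⊢
    linarith
  have h8 : A ≤ 1 + (2 : ℝ) ^ (1 - α) / 2 + (3 : ℝ) ^ (1 - α) * (0.4605 + beta 1 / (α - 1)) := by
    have : (0 : ℝ) < (3 : ℝ) ^ (1 - α) := by positivity
    nlinarith
  rw [e4] at h8
  refine h8.trans (le_of_eq ?_)
  ring

theorem ratio_cubic_le {ρ r : ℝ} (h0 : 0 ≤ ρ) (h2 : ρ ^ 2 ≤ r) :
    (1 / 2 + 0.4605 * ρ) * (1.41422 - r) + 0.2108 * ρ * (1 + r) ≤ 1 := by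
  have h4 : (1 / 2 + 0.4605 * ρ) * (1.41422 - r) + 0.2108 * ρ * (1 + r) ≤
      (1 / 2 + 0.4605 * ρ) * (1.41422 - ρ ^ 2) + 0.2108 * ρ * (1 + ρ ^ 2) := by nlinarith
  -- The left side is `ρ³ - 1.08 ρ + 0.432`: the tangent of `ρ³` at `0.6`, near the maximum, reduces
  -- the cubic to a quadratic.
  have h5 : 0 ≤ (ρ - 0.6) ^ 2 * (ρ + 1.2) := by positivity
  nlinarith [sq_nonneg (ρ - 0.6)]

/-- The claim reduces to `(A - 1)(z - 1) ≤ 1 + beta 1 / (α - 1) · (s - 1)` with `s = √X`. By `A - 1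
≤ r B` and `r z ≤ s` it suffices that `B (s - r)` is at most the right side. -/
theorem neg_rpow_mul_sqfreeErr_one_le_of_one_lt (hα : 1 < α) {X : ℝ}
    (hX : 1 ≤ X) (hX2 : X < 2) : -(X ^ (α - 1 / 2) * sqfreeErr α 1 X) ≤ mainGap α 1 := by
  have hX0 : 0 < X := by linarith
  have hτ : 0 < α - 1 := by linarith
  have hβ := beta_one_bounds
  have hA := leadConst_one_le hα
  have hsz := rpow_mul_rpow_one_sub hX0 α
  rw [rpow_mul_sqfreeErr hα.ne' one_pos hX0, sqfreeSum_eq_one _ hX hX2, mainGap]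
  set A := coprimeDensity α 1 * (zetaReal α / zetaReal (2 * α)) with hAdef
  set r := (2 : ℝ) ^ (1 - α) with hr
  set ρ := (2 / 3 : ℝ) ^ (α - 1) with hρ
  set z := X ^ (α - 1 / 2) with hz
  set s := √X with hs
  have hs1 : 1 ≤ s := Real.one_le_sqrt.2 hX
  have hs2 : s ≤ 1.41422 := Real.sqrt_le_iff.2 ⟨by norm_num, by norm_num; linarith⟩
  have hz1 : 1 ≤ z := Real.one_le_rpow hX (by linarith)
  have hr0 : 0 < r := by positivity
  have hr1 : r ≤ 1 := Real.rpow_le_one_of_one_le_of_nonpos (by norm_num) (by linarith)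
  have hρ0 : 0 < ρ := by positivity
  have hρ1 : ρ ≤ 1 := Real.rpow_le_one (by norm_num) (by norm_num) hτ.le
  have hρr : ρ ^ 2 ≤ r := by
    have e1 : ρ ^ 2 = (4 / 9 : ℝ) ^ (α - 1) := by
      rw [hρ, sq, ← Real.mul_rpow (by norm_num) (by norm_num)]; norm_num
    have e2 : r = (1 / 2 : ℝ) ^ (α - 1) := by
      rw [hr, ← neg_sub α 1, Real.rpow_neg (by norm_num), ← Real.inv_rpow (by norm_num), one_div]
    rw [e1, e2]
    exact Real.rpow_le_rpow (by norm_num) (by norm_num) hτ.le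
  have hrx : r ≤ X ^ (1 - α) := Real.rpow_le_rpow_of_nonpos hX0 hX2.le (by linarith)
  have hrz : r * z ≤ s := by rw [← hsz, mul_comm]; gcongr
  have htrap : (1 - r) / (α - 1) ≤ 0.34658 * (1 + r) := by
    have h1 := one_sub_le_trapezoid (y := Real.log 2 * (α - 1))
      (mul_nonneg (Real.log_nonneg (by norm_num)) hτ.le)
    have e : Real.exp (-(Real.log 2 * (α - 1))) = r := by
      rw [hr, Real.rpow_def_of_pos (by norm_num)]; congr 1; ring
    rw [e] at h1
    rw [div_le_iff₀ hτ]
    have h2 := Real.log_two_lt_d9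
    have h3 : 0 ≤ (α - 1) * (1 + r) := by positivity
    nlinarith
  set B := 1 / 2 + 0.4605 * ρ + beta 1 * ρ / (α - 1) with hB
  have hβτ : 0 < beta 1 / (α - 1) := div_pos (by linarith) hτ
  have hB0 : 0 < B := by
    have : 0 < beta 1 * ρ / (α - 1) := div_pos (mul_pos (by linarith) hρ0) hτ
    positivity
  have hβρ : beta 1 * ρ / (α - 1) * (1 - r) ≤ 0.2108 * ρ * (1 + r) := by
    have e : beta 1 * ρ / (α - 1) * (1 - r) = beta 1 * ρ * ((1 - r) / (α - 1)) := by ring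
    rw [e]
    calc beta 1 * ρ * ((1 - r) / (α - 1)) ≤ 0.607928 * ρ * (0.34658 * (1 + r)) := by
          gcongr
          exact hβ.2.le
      _ ≤ _ := by nlinarith [mul_pos hρ0 hr0]
  have hcub := ratio_cubic_le hρ0.le hρr
  have hend1 : B * (1 - r) ≤ 1 := by
    have : (1 / 2 + 0.4605 * ρ) * (1 - r) ≤ (1 / 2 + 0.4605 * ρ) * (1.41422 - r) := by
      gcongr; norm_num
    rw [hB, add_mul]
    linarith
  have hend2 : B * (1.41422 - r) ≤ 1 + beta 1 / (α - 1) * 0.41422 := by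
    have e : beta 1 * ρ / (α - 1) * (1.41422 - r)
        = beta 1 * ρ / (α - 1) * (1 - r) + beta 1 / (α - 1) * 0.41422 * ρ := by ring
    have h1 : beta 1 / (α - 1) * 0.41422 * ρ ≤ beta 1 / (α - 1) * 0.41422 * 1 := by gcongr
    rw [hB, add_mul, e]
    linarith
  -- Both sides are linear in `s`, so the two ends of `[1, 1.41422]` suffice; which one is needed
  -- depends on the comparison of slopes.
  have hmid : B * (s - r) ≤ 1 + beta 1 / (α - 1) * (s - 1) := by
    rcases le_total B (beta 1 / (α - 1)) with h | h
    · nlinarith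
    · nlinarith
  have hfin : (A - 1) * (z - 1) ≤ 1 + beta 1 / (α - 1) * (s - 1) := by
    have h1 : (A - 1) * (z - 1) ≤ r * B * (z - 1) := by
      gcongr
      linarith
    nlinarith
  have e : beta 1 * ((s - z) / (α - 1)) = beta 1 / (α - 1) * (s - z) := by ring
  rw [e]
  linarith

theorem abs_sqfreeErr_one_le (hα : 1 / 2 < α) (hα1 : α ≠ 1) {X : ℝ} (hX : 0 < X) :
    |sqfreeErr α 1 X| ≤ max (0.43 * (1 + |α - 1| / (α - 1 / 2))) (mainGap α 1)
      / X ^ (α - 1 / 2) := by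
  have hXa : 0 < X ^ (α - 1 / 2) := Real.rpow_pos_of_pos hX _
  rcases le_or_gt 2 X with h2 | h2
  · refine (abs_sqfreeErr_le_of_rem hα hα1 one_pos (tendsto_sqfreeErr_one hα hα1) (by linarith)
      (by norm_num) (fun t ht => abs_sqfreeRem_one_le (h2.trans ht))).trans ?_
    gcongr
    exact le_max_left _ _
  have e : |sqfreeErr α 1 X| * X ^ (α - 1 / 2) = |X ^ (α - 1 / 2) * sqfreeErr α 1 X| := by
    rw [abs_mul, abs_of_pos hXa, mul_comm]
  rw [le_div_iff₀ hXa, e, abs_le']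
  rcases le_or_gt 1 X with h1 | h1
  · refine ⟨(rpow_mul_sqfreeErr_one_le_mid hα hα1 h1 h2).trans (le_max_left _ _),
      le_max_of_le_right ?_⟩
    rcases lt_or_gt_of_ne hα1 with h | h
    · exact neg_rpow_mul_sqfreeErr_one_le_of_lt_one hα h h1 h2
    · exact neg_rpow_mul_sqfreeErr_one_le_of_one_lt h h1 h2
  · exact ⟨rpow_mul_sqfreeErr_one_le_small hα hα1 hX h1,
      le_max_of_le_right (neg_rpow_mul_sqfreeErr_le hα hα1 one_pos hX h1)⟩

end SqfreeAverage


namespace SqfreeAverage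

open Finset Filter Topology

/-! ### The error term for even moduli, and the exponent `1` -/

theorem sqrtFactor_two : sqrtFactor 2 = (1 - 1 / (2 : ℝ) ^ (1 / 2 : ℝ))⁻¹ := by
  simp [sqrtFactor, Nat.prime_two.primeFactors]

theorem le_sqrtFactor_two : 3.41 ≤ sqrtFactor 2 := by
  rw [sqrtFactor_two, ← Real.sqrt_eq_rpow]
  have h1 : 1.414 ≤ √2 := Real.le_sqrt_of_sq_le (by norm_num)
  have h2 : √2 ≤ 1.415 := Real.sqrt_le_iff.2 ⟨by norm_num, by norm_num⟩
  have h3 : 1 - 1 / √2 ≤ 1 / 3.41 := by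
    have : 1 / 1.4143 ≤ 1 / √2 := by
      apply one_div_le_one_div_of_le (by linarith)
      exact Real.sqrt_le_iff.2 ⟨by norm_num, by norm_num⟩
    norm_num at this ⊢
    linarith
  have h4 : 0 < 1 - 1 / √2 := by
    have : 1 / √2 ≤ 1 / 1.414 := one_div_le_one_div_of_le (by norm_num) h1
    norm_num at this ⊢
    linarith
  rw [le_inv_comm₀ (by norm_num) h4, ← one_div]
  exact h3

theorem sqrtFactor_pos : 0 < sqrtFactor 2 := by linarith [le_sqrtFactor_two]

/-- Passing from modulus `1` to `2` by the prime step already gives the decay; its poor constant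
does not matter here. -/
theorem tendsto_sqfreeErr_two {α : ℝ} (hα : 1 / 2 < α) (hα1 : α ≠ 1) :
    Tendsto (fun K : ℕ => sqfreeErr α 2 ((K : ℝ) ^ 2)) atTop (𝓝 0) := by
  set C := (1 - 1 / ((2 : ℕ) : ℝ) ^ (1 / 2 : ℝ))⁻¹ *
    max (0.43 * (1 + |α - 1| / (α - 1 / 2))) (mainGap α 1) with hC
  have h1 : ∀ X, 0 < X → |sqfreeErr α 2 X| ≤ C / X ^ (α - 1 / 2) := fun X hX => by
    have := abs_sqfreeErr_mul_le (q := 1) hα Nat.prime_two one_pos (by norm_num)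
      (fun X hX => abs_sqfreeErr_one_le hα hα1 hX) hX
    rwa [mul_one] at this
  have h2 : Tendsto (fun K : ℕ => C * (K : ℝ) ^ (-(2 * α - 1))) atTop (𝓝 0) := by
    have := ((tendsto_rpow_neg_atTop (show 0 < 2 * α - 1 by linarith)).comp
      tendsto_natCast_atTop_atTop).const_mul C
    simpa using this
  refine squeeze_zero_norm' ?_ h2
  filter_upwards [eventually_ge_atTop 1] with K hK
  have hK0 : (0 : ℝ) < K := by exact_mod_cast hK
  refine (h1 _ (by positivity)).trans (le_of_eq ?_)
  have e : ((K : ℝ) ^ 2) ^ (α - 1 / 2) = (K : ℝ) ^ (2 * α - 1) := by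
    rw [← Real.rpow_natCast, ← Real.rpow_mul hK0.le]; congr 1; push_cast; ring
  rw [e, Real.rpow_neg hK0.le, div_eq_mul_inv]

theorem beta_two_bounds : 0.4052 < beta 2 ∧ beta 2 < 0.405286 := by
  have := beta_one_bounds
  rw [beta_two_eq]
  constructor <;> linarith

/-- For `v = 2` the bound `0.409` holds from `X = 1` on, so only `X < 1` needs the explicit formula.
-/
theorem abs_sqfreeErr_two_le {α : ℝ} (hα : 1 / 2 < α) (hα1 : α ≠ 1) {X : ℝ} (hX : 0 < X) :
    |sqfreeErr α 2 X| ≤ max (0.409 * (1 + |α - 1| / (α - 1 / 2))) (mainGap α 2)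
      / X ^ (α - 1 / 2) := by
  have hXa : 0 < X ^ (α - 1 / 2) := Real.rpow_pos_of_pos hX _
  have ha : 0 < α - 1 / 2 := by linarith
  rcases le_or_gt 1 X with h1 | h1
  · refine (abs_sqfreeErr_le_of_rem hα hα1 two_pos (tendsto_sqfreeErr_two hα hα1) h1
      (by norm_num) (fun t ht => abs_sqfreeRem_two_le (h1.trans ht))).trans ?_
    gcongr
    exact le_max_left _ _
  have e : |sqfreeErr α 2 X| * X ^ (α - 1 / 2) = |X ^ (α - 1 / 2) * sqfreeErr α 2 X| := by
    rw [abs_mul, abs_of_pos hXa, mul_comm]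
  rw [le_div_iff₀ hXa, e, abs_le']
  refine ⟨(rpow_mul_sqfreeErr_le hα hα1 two_pos hX h1).trans (le_max_of_le_left ?_),
    le_max_of_le_right (neg_rpow_mul_sqfreeErr_le hα hα1 two_pos hX h1)⟩
  have hβ := beta_two_bounds
  rcases lt_or_gt_of_ne hα1 with h | h
  · have h2 := sqrt_sub_rpow_div_le_of_lt_one hα h hX h1
    have h3 : Real.exp (-(1 + (1 - α))) ≤ 0.37 :=
      (Real.exp_le_exp.2 (show _ ≤ -(1 : ℝ) by linarith)).trans
        (by linarith [Real.exp_neg_one_lt_d9])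
    rw [abs_of_neg (by linarith), one_add_neg_sub_div ha.ne']
    calc _ ≤ 0.405286 * (0.37 / (α - 1 / 2)) := by
          have h0 := sqrt_sub_rpow_div_nonneg (α := α) hX h1.le
          have h4 := h2.trans (div_le_div_of_nonneg_right h3 ha.le)
          exact mul_le_mul hβ.2.le h4 h0 (by norm_num)
      _ ≤ _ := by
          rw [← mul_div_assoc, ← mul_div_assoc]
          exact div_le_div_of_nonneg_right (by norm_num) ha.le
  · have h2 := sqrt_sub_rpow_div_le_of_one_lt h hX
    have h3 : 0 ≤ |α - 1| / (α - 1 / 2) := by positivity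
    nlinarith

theorem sqfreeErr_exponent_one {v : ℕ} (hv : 0 < v) (X : ℝ) :
    sqfreeErr 1 v X = sqfreeRem v X := by
  rw [sqfreeErr, sqfreeMain, if_pos rfl, sqfreeRem, beta_eq hv]

/-- Below `1` the logarithm and the constant have opposite signs, so the larger of the two
contributions bounds the absolute value. -/
theorem abs_sqfreeRem_le_of_lt_one {v : ℕ} (hv : 0 < v) {C X : ℝ} (hb : 0 ≤ bConst v)
    (h1 : beta v * bConst v ≤ C) (h2 : beta v * 0.73576 ≤ C) (hX : 0 < X) (hX1 : X < 1) :
    |sqfreeRem v X| ≤ C / √X := by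
  have hs : 0 < √X := Real.sqrt_pos.2 hX
  have hs1 : √X ≤ 1 := Real.sqrt_le_one.2 hX1.le
  have hβ := beta_pos hv
  have hl := Real.log_nonpos hX.le hX1.le
  have hlog := mul_le_mul_of_nonneg_left (sqrt_mul_neg_log_le hX) hβ.le
  have e : |sqfreeRem v X| * √X = |beta v * (√X * (Real.log X + bConst v))| := by
    rw [sqfreeRem, sqfreeSum_of_lt_one _ _ hX1, zero_sub, abs_neg, ← abs_of_pos hs, ← abs_mul,
      abs_of_pos hs]
    congr 1; ring
  rw [le_div_iff₀ hs, e, abs_le']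
  have k1 : 0 ≤ beta v * (√X * bConst v) := by positivity
  have k2 : 0 ≤ beta v * (√X * (-Real.log X)) :=
    mul_nonneg hβ.le (mul_nonneg hs.le (by linarith))
  have k3 : beta v * (√X * bConst v) ≤ beta v * (1 * bConst v) := by gcongr
  constructor <;> linarith

/-- The constant is dictated by `X → 1` from below, where `√X |R|` tends to `beta 1 * bConst 1`,
between `1.0437` and `1.04397`. -/
theorem abs_sqfreeRem_one_all {X : ℝ} (hX : 0 < X) : |sqfreeRem 1 X| ≤ 1.044 / √X := by
  have hb := beta_mul_bConst_bounds
  have hβ := beta_one_bounds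
  rcases lt_or_ge X 1 with h | h
  · exact abs_sqfreeRem_le_of_lt_one one_pos (by linarith [bConst_one_bounds.1]) (by linarith)
      (by linarith) hX h
  · refine (abs_sqfreeRem_one_le' h).trans ?_
    gcongr; norm_num

theorem abs_sqfreeRem_two_all {X : ℝ} (hX : 0 < X) :
    |sqfreeRem 2 X| ≤ sqrtFactor 2 * 0.232 / √X := by
  have hβ := beta_two_bounds
  have hs := le_sqrtFactor_two
  have hb := bConst_one_bounds
  have h2 := Real.log_two_gt_d9
  have h3 := Real.log_two_lt_d9
  rcases lt_or_ge X 1 with h | h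
  · refine abs_sqfreeRem_le_of_lt_one two_pos ?_ ?_ (by linarith) hX h
    · rw [bConst_two]; linarith
    · rw [bConst_two]; nlinarith
  · refine (abs_sqfreeRem_two_le h).trans ?_
    gcongr
    linarith

/-! ### The constants of the theorem -/

theorem le_Econst_left {α : ℝ} (hα1 : α ≠ 1) (v : ℕ) :
    Dconst v * (1 + |α - 1| / (α - 1 / 2)) ≤ Econst α v := by
  rw [Econst, if_neg hα1]; exact le_max_left _ _

theorem le_Econst_mid {α : ℝ} (hα1 : α ≠ 1) {v : ℕ} (hv : 0 < v) :
    (sqrtFactor v)⁻¹ * mainGap α v ≤ Econst α v := by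
  rw [Econst, if_neg hα1]
  refine le_max_of_le_right (le_max_of_le_left ?_)
  have e1 : phi (1 / 2) v / √(v : ℝ) = (sqrtFactor v)⁻¹ := by rw [← sqrt_div_phi hv, inv_div]
  have e2 : (v : ℝ) ^ α / kappa α v * (zetaReal α / zetaReal (2 * α))
      - (v : ℝ) / kappa 1 v * (6 / ((α - 1) * Real.pi ^ 2)) = mainGap α v := by
    rw [rpow_div_kappa α hv, mainGap, beta]
    have := sub_ne_zero.2 hα1
    field_simp
  rw [e1, e2]
  refine mul_le_mul_of_nonneg_left (le_abs_self _) ?_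
  rw [← e1]
  refine div_nonneg ?_ (Real.sqrt_nonneg _)
  refine mul_nonneg (by positivity) (prod_nonneg fun p hp => ?_)
  rw [sub_nonneg]
  have hp1 : (1 : ℝ) ≤ p := by exact_mod_cast (Nat.prime_of_mem_primeFactors hp).one_le
  rw [div_le_one (by positivity)]
  exact Real.one_le_rpow hp1 (by norm_num)

theorem sqfreeErr_one_le_Econst {α : ℝ} (hα : 1 / 2 < α) {X : ℝ} (hX : 0 < X) :
    |sqfreeErr α 1 X| ≤ Econst α 1 / X ^ (α - 1 / 2) := by
  by_cases hα1 : α = 1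
  · subst hα1
    rw [sqfreeErr_exponent_one one_pos, show (1 : ℝ) - 1 / 2 = 1 / 2 by norm_num,
      ← Real.sqrt_eq_rpow]
    simpa [Econst] using abs_sqfreeRem_one_all hX
  · refine (abs_sqfreeErr_one_le hα hα1 hX).trans ?_
    gcongr
    have h1 := le_Econst_left hα1 1
    have h2 := le_Econst_mid hα1 (v := 1) one_pos
    simp only [Dconst, sqrtFactor, Nat.primeFactors_one, prod_empty, inv_one, one_mul,
      if_true] at h1 h2
    exact max_le h1 h2

/-- The factor `sqrtFactor 2 ≥ 3.41` is split off for the passage to general even moduli: `0.409 ≤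
3.41 · 0.12`. -/
theorem sqfreeErr_two_le_Econst {α : ℝ} (hα : 1 / 2 < α) {X : ℝ} (hX : 0 < X) :
    |sqfreeErr α 2 X| ≤ sqrtFactor 2 * Econst α 2 / X ^ (α - 1 / 2) := by
  by_cases hα1 : α = 1
  · subst hα1
    rw [sqfreeErr_exponent_one two_pos, show (1 : ℝ) - 1 / 2 = 1 / 2 by norm_num,
      ← Real.sqrt_eq_rpow]
    simpa [Econst] using abs_sqfreeRem_two_all hX
  · refine (abs_sqfreeErr_two_le hα hα1 hX).trans ?_
    have ha : 0 < α - 1 / 2 := by linarith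
    gcongr
    have h1 := mul_le_mul_of_nonneg_left (le_Econst_left hα1 2) sqrtFactor_pos.le
    have h2 := mul_le_mul_of_nonneg_left (le_Econst_mid hα1 (v := 2) two_pos) sqrtFactor_pos.le
    rw [mul_inv_cancel_left₀ sqrtFactor_pos.ne'] at h2
    refine max_le (le_trans ?_ h1) h2
    have e : Dconst 2 = 0.120 := by simp [Dconst]
    rw [e, ← mul_assoc]
    have := le_sqrtFactor_two
    gcongr
    linarith

theorem Econst_one_pos {α : ℝ} (hα : 1 / 2 < α) : 0 < Econst α 1 := by
  by_cases hα1 : α = 1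
  · simp only [Econst, if_pos hα1, if_true]; norm_num
  · have ha : 0 < α - 1 / 2 := by linarith
    refine lt_of_lt_of_le ?_ (le_Econst_left hα1 1)
    simp only [Dconst, if_true]
    positivity

theorem abs_sqfreeErr_le_errCoeff {α : ℝ} (hα : 1 / 2 < α) {q : ℕ} (hq : 0 < q) {X : ℝ}
    (hX : 0 < X) : |sqfreeErr α q X| ≤ errCoeff α q / X ^ (α - 1 / 2) := by
  have h := abs_sqfreeErr_le hα (fun X hX => sqfreeErr_one_le_Econst hα hX)
    (fun X hX => sqfreeErr_two_le_Econst hα hX) hq hX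
  have e : errCoeff α q = sqrtFactor q * (if 2 ∣ q then Econst α 2 else Econst α 1) := by
    rw [errCoeff, sqrt_div_phi hq]
    split_ifs
    · rw [mul_div_cancel₀ _ (Econst_one_pos hα).ne']
    · rw [mul_one]
  rwa [e]

end SqfreeAverage

theorem lemma4p3 (X : ℝ) (hX : 0 < X) (q : ℕ) (hq : 0 < q) :
    |SqfreeAverage.sqfreeSum 1 q X
        - (q : ℝ) / SqfreeAverage.kappa 1 q * (6 / Real.pi ^ 2)
            * (Real.log X + SqfreeAverage.bConst q)|
      ≤ SqfreeAverage.errCoeff 1 q / √X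
    ∧ ∀ α : ℝ, 1 / 2 < α → α ≠ 1 →
      |SqfreeAverage.sqfreeSum α q X
          - ((q : ℝ) ^ α / SqfreeAverage.kappa α q
                * (SqfreeAverage.zetaReal α / SqfreeAverage.zetaReal (2 * α))
              - (q : ℝ) / SqfreeAverage.kappa 1 q * (6 / ((α - 1) * Real.pi ^ 2))
                * (1 / X ^ (α - 1)))|
        ≤ SqfreeAverage.errCoeff α q / X ^ (α - 1 / 2) := by
  have e1 : (q : ℝ) / SqfreeAverage.kappa 1 q = SqfreeAverage.coprimeDensity 1 q := by
    rw [← SqfreeAverage.rpow_div_kappa 1 hq, Real.rpow_one]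
  constructor
  · have h := SqfreeAverage.abs_sqfreeErr_le_errCoeff (α := 1) (by norm_num) hq hX
    rwa [show (1 : ℝ) - 1 / 2 = 1 / 2 by norm_num, ← Real.sqrt_eq_rpow, SqfreeAverage.sqfreeErr,
      SqfreeAverage.sqfreeMain, if_pos rfl, ← e1] at h
  · intro α hα hα1
    have h := SqfreeAverage.abs_sqfreeErr_le_errCoeff hα hq hX
    rwa [SqfreeAverage.sqfreeErr, SqfreeAverage.sqfreeMain, if_neg hα1,
      ← SqfreeAverage.rpow_div_kappa α hq, ← e1] at h
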